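/- Let $\mathbb S^1=\mathbb R/2\pi\mathbb Z$ with the uniform probability measure $d\theta/(2\pi)$, and let $\mathbb T^2=\mathbb S^1\times\mathbb S^1\ni(x,y)$ with the uniform probability measure $dx\,dy/(4\pi^2)$; all norms are taken with respect to these measures. Let $a\in[0,1/2]$, $p\in[1,2)$ and $\mu>0$. Let $\lambda_{a,p}(\mu)$ denote the optimal (i.e., largest) constant in $$\|\psi'-i\,a\,\psi\|_{L^2(\mathbb S^1)}^2+\mu\,\|\psi\|_{L^p(\mathbb S^1)}^2\ \ge\ \lambda_{a,p}(\mu)\,\|\psi\|_{L^2(\mathbb S^1)}^2\qquad\forall\,\psi\in H^1(\mathbb S^1,\mathbb C),$$ and let $\Lambda_{a,p}(\mu)$ denote the optimal constant in $$\|\partial_x\psi\|_{L^2(\mathbb T^2)}^2+\|\partial_y\psi-i\,a\,\psi\|_{L^2(\mathbb T^2)}^2+\mu\,\|\psi\|_{L^p(\mathbb T^2)}^2\ \ge\ \Lambda_{a,p}(\mu)\,\|\psi\|_{L^2(\mathbb T^2)}^2\qquad\forall\,\psi\in H^1(\mathbb T^2,\mathbb C).$$ A nonzero $\psi\in H^1(\mathbb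 T^2,\mathbb C)$ that achieves equality in the second inequality is called an optimal function. Then both optimal constants exist, and: 1. If $\mu\le\frac1{2-p}$, then $\Lambda_{a,p}(\mu)=\lambda_{a,p}(\mu)$ and, unless $(a,p,\mu)=(0,1,1)$, any optimal function does not depend on $x$ (almost everywhere). 2. $\Lambda_{a,p}(\mu)=a^2+\mu$ if and only if $\mu\,(2-p)+4\,a^2\le1$. In that case, unless $(a,p,\mu)=(0,1,1)$, the optimal functions are exactly the nonzero constants (almost everywhere). -/

import Mathlib

open MeasureTheory
open scoped ContDiff

noncomputable section

namespace MagneticTorus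

instance instTwoPiPos : Fact (0 < 2 * Real.pi) := ⟨Real.two_pi_pos⟩

/-- The circle `S¹ = ℝ / 2πℤ`. -/
abbrev S1 : Type := AddCircle (2 * Real.pi)

/-- The flat torus `T² = S¹ × S¹`, with coordinates `(x, y)`. -/
abbrev T2 : Type := S1 × S1

/-- The uniform probability measure `dθ / 2π` on the circle. -/
def circleMeasure : Measure S1 := AddCircle.haarAddCircle

/-- The uniform probability measure `dx dy / 4π²` on the torus. -/
def torusMeasure : Measure T2 := circleMeasure.prod circleMeasure

/-! ### Smooth test functions and their derivatives -/

/-- `φ` is smooth on the circle: its `2π`-periodic lift to `ℝ` is smooth. -/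
def IsSmoothCircle (φ : S1 → ℂ) : Prop :=
  ContDiff ℝ ∞ (fun t : ℝ => φ (t : S1))

/-- `φ` is smooth on the torus: its doubly `2π`-periodic lift to `ℝ²` is smooth. -/
def IsSmoothTorus (φ : T2 → ℂ) : Prop :=
  ContDiff ℝ ∞ (fun q : ℝ × ℝ => φ ((q.1 : S1), (q.2 : S1)))

/-- The derivative `φ'` of a function on the circle. -/
def circleDeriv (φ : S1 → ℂ) (θ : S1) : ℂ :=
  deriv (fun t : ℝ => φ (θ + (t : S1))) 0

/-- The partial derivative `∂ₓ φ` of a function on the torus. -/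
def torusDerivX (φ : T2 → ℂ) (z : T2) : ℂ :=
  deriv (fun t : ℝ => φ (z.1 + (t : S1), z.2)) 0

/-- The partial derivative `∂_y φ` of a function on the torus. -/
def torusDerivY (φ : T2 → ℂ) (z : T2) : ℂ :=
  deriv (fun t : ℝ => φ (z.1, z.2 + (t : S1))) 0

/-! ### Sobolev spaces -/

/-- `ψ` belongs to `H¹(S¹, ℂ)` and `g` is its weak derivative. -/
structure IsH1Circle (ψ g : S1 → ℂ) : Prop where
  memLp : MemLp ψ 2 circleMeasure
  memLp_deriv : MemLp g 2 circleMeasure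
  weakDeriv : ∀ φ : S1 → ℂ, IsSmoothCircle φ →
    ∫ θ, ψ θ * circleDeriv φ θ ∂circleMeasure = - ∫ θ, g θ * φ θ ∂circleMeasure

/-- `ψ` belongs to `H¹(T²)` and `gx`, `gy` are its weak partial derivatives `∂ₓψ`, `∂_yψ`. As the
magnetic potential is a bounded constant, `ψ ∈ L²` and `(∂ₓψ, ∂_yψ - i a ψ) ∈ L²` mean the same as
`ψ, ∂ₓψ, ∂_yψ ∈ L²`, so this is also the magnetic Sobolev space. -/
structure IsH1Torus (ψ gx gy : T2 → ℂ) : Prop where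
  memLp : MemLp ψ 2 torusMeasure
  memLp_derivX : MemLp gx 2 torusMeasure
  memLp_derivY : MemLp gy 2 torusMeasure
  weakDerivX : ∀ φ : T2 → ℂ, IsSmoothTorus φ →
    ∫ z, ψ z * torusDerivX φ z ∂torusMeasure = - ∫ z, gx z * φ z ∂torusMeasure
  weakDerivY : ∀ φ : T2 → ℂ, IsSmoothTorus φ →
    ∫ z, ψ z * torusDerivY φ z ∂torusMeasure = - ∫ z, gy z * φ z ∂torusMeasure

/-! ### The inequalities and their optimal constants -/

/-- `‖f‖_{L^p}²`, for a real exponent `p`. -/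
def lpNormSq {X : Type*} [MeasurableSpace X] (m : Measure X) (p : ℝ) (f : X → ℂ) : ℝ :=
  (∫ x, ‖f x‖ ^ p ∂m) ^ (2 / p)

/-- `‖ψ' - i a ψ‖₂² + μ ‖ψ‖_p²` on the circle, for `ψ` with weak derivative `g`. -/
def circleEnergy (a p μ : ℝ) (ψ g : S1 → ℂ) : ℝ :=
  (∫ θ, ‖g θ - Complex.I * (a : ℂ) * ψ θ‖ ^ 2 ∂circleMeasure) + μ * lpNormSq circleMeasure p ψ

/-- `‖∂ₓψ‖₂² + ‖∂_yψ - i a ψ‖₂² + μ ‖ψ‖_p²` on the torus, for `ψ` with weak partial derivatives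
`gx`, `gy`. -/
def torusEnergy (a p μ : ℝ) (ψ gx gy : T2 → ℂ) : ℝ :=
  (∫ z, (‖gx z‖ ^ 2 + ‖gy z - Complex.I * (a : ℂ) * ψ z‖ ^ 2) ∂torusMeasure)
    + μ * lpNormSq torusMeasure p ψ

/-- The constants `L` for which `‖ψ' - i a ψ‖₂² + μ ‖ψ‖_p² ≥ L ‖ψ‖₂²` on `H¹(S¹, ℂ)`. -/
def circleConstants (a p μ : ℝ) : Set ℝ :=
  {L | ∀ ψ g : S1 → ℂ, IsH1Circle ψ g →
    L * ∫ θ, ‖ψ θ‖ ^ 2 ∂circleMeasure ≤ circleEnergy a p μ ψ g}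

/-- The constants `L` for which `‖∇_A ψ‖₂² + μ ‖ψ‖_p² ≥ L ‖ψ‖₂²` on `H¹(T²)`. -/
def torusConstants (a p μ : ℝ) : Set ℝ :=
  {L | ∀ ψ gx gy : T2 → ℂ, IsH1Torus ψ gx gy →
    L * ∫ z, ‖ψ z‖ ^ 2 ∂torusMeasure ≤ torusEnergy a p μ ψ gx gy}

/-- The optimal constant `λ_{a,p}(μ)` on the circle. -/
def circleOptimal (a p μ : ℝ) : ℝ := sSup (circleConstants a p μ)

/-- The optimal constant `Λ_{a,p}(μ)` on the torus. -/
def torusOptimal (a p μ : ℝ) : ℝ := sSup (torusConstants a p μ)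

/-- `ψ` is an optimal function on the torus: a nonzero function in `H¹(T²)` that realizes equality
in the inequality with the optimal constant. -/
def IsTorusOptimizer (a p μ : ℝ) (ψ : T2 → ℂ) : Prop :=
  ∃ gx gy : T2 → ℂ, IsH1Torus ψ gx gy ∧ ¬ (∀ᵐ z ∂torusMeasure, ψ z = 0) ∧
    torusEnergy a p μ ψ gx gy = torusOptimal a p μ * ∫ z, ‖ψ z‖ ^ 2 ∂torusMeasure

end MagneticTorus

end

namespace MagneticTorus

/-! On the circle, the heat flow yields a Beckner inequality: `‖u‖₂² - ‖u‖ₚ² ≤ (2 - p) ‖u'‖₂²`,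
improved when `p > 1` by a quadratic remainder comparable to `(‖u‖₂² - ‖u‖ₚ²)² / ‖u‖₂²`
(`beckner_heat`, `beckner`). If `ψ` does not vanish, put `u = |ψ|`. The phase has an integer winding
number, and minimizing over phases bounds the magnetic energy below by `1 - 4a²` times `‖u'‖₂²` plus
`4a²` times the half-flux energy of a function with the same modulus (`exists_phase`). The half-flux
energy is at least `‖u‖₂² / 4` (`half_flux_le`), so when `μ(2 - p) ≤ 1 - 4a²` the Beckner inequality
gives the constant `a² + μ`. Nonvanishing functions are dense in `H¹`, hence `rigidity`. Conversely,
the second variation at the constant `1` in the direction `cos y + 2ia sin y` is negative as soon as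
the condition fails (`notMem_circleConstants`).

Uniqueness has to survive the density argument, so it is proved in the quantitative form "squared
entropy is at most a constant times mass times deficit" (`rigidity_remainder`). For `p > 1` this
comes from the Beckner remainder. For `p = 1` that remainder is void; if `a > 0` one uses instead
that a nonconstant modulus cannot be optimal both for Poincaré and for the half-flux inequality
(`sq_variance_le`).

On the torus, joint convexity of the Bregman divergence of `t ^ q`, `q = 2/p`, shows that the
`p`-norms of the slices in `x` and in `y` add up to at most `‖ψ‖₂² + ‖ψ‖ₚ²`
(`lpNormSq_subadditive`). Integrating the Beckner inequality in `x` over `y`, and the circle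
inequality in `y` over `x`, then bounds the torus deficit below by `(1 - μ(2 - p)) ‖∂ₓψ‖₂²`
(`torusEnergy_sub_ge`). Functions of `y` alone give the reverse comparison, so the two constants
agree if `μ(2 - p) ≤ 1`. The Beckner remainder, or the strict margin `μ < 1` for `p = 1`, forces
`∂ₓψ = 0` at equality. For `p = μ = 1` and `a > 0`, averaging in `x` does the job
(`torusCoeff_eq_zero_of_one`). The triple `(0, 1, 1)` is a genuine exception: `1 + ε cos x` with
`|ε| ≤ 1` is optimal there. -/

instance : IsProbabilityMeasure circleMeasure :=
  inferInstanceAs (IsProbabilityMeasure AddCircle.haarAddCircle)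

instance : Measure.IsOpenPosMeasure circleMeasure :=
  inferInstanceAs (Measure.IsOpenPosMeasure AddCircle.haarAddCircle)

instance : IsProbabilityMeasure torusMeasure :=
  inferInstanceAs (IsProbabilityMeasure (circleMeasure.prod circleMeasure))

theorem integrable_of_continuous {X E : Type*} [TopologicalSpace X] [CompactSpace X]
    [MeasurableSpace X] [OpensMeasurableSpace X] [NormedAddCommGroup E]
    [SecondCountableTopologyEither X E] {m : Measure X} [IsFiniteMeasure m] {f : X → E}
    (hf : Continuous f) : Integrable f m := by
  obtain ⟨C, hC⟩ := isCompact_univ.exists_bound_of_continuousOn hf.continuousOn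
  exact Integrable.of_bound hf.aestronglyMeasurable C (.of_forall fun x => hC x trivial)

theorem memLp_of_continuous {X E : Type*} [TopologicalSpace X] [CompactSpace X]
    [MeasurableSpace X] [OpensMeasurableSpace X] [NormedAddCommGroup E]
    [SecondCountableTopologyEither X E] {m : Measure X} [IsFiniteMeasure m] {f : X → E}
    (hf : Continuous f) (p : ENNReal) : MemLp f p m := by
  obtain ⟨C, hC⟩ := isCompact_univ.exists_bound_of_continuousOn hf.continuousOn
  exact MemLp.of_bound hf.aestronglyMeasurable C (.of_forall fun x => hC x trivial)

/-! ### Calculus on the circle -/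

section Circle

variable {E : Type*} [NormedAddCommGroup E] [NormedSpace ℝ E]

theorem integral_circle_eq (f : S1 → E) :
    ∫ x, f x ∂circleMeasure = (2 * Real.pi)⁻¹ • ∫ t in (0 : ℝ)..2 * Real.pi, f (t : S1) := by
  have h := AddCircle.intervalIntegral_preimage (2 * Real.pi) 0 f
  rw [zero_add] at h
  rw [h]
  exact AddCircle.integral_haarAddCircle

/-- `f'` is the classical derivative of the function `f` on the circle. -/
def HasCircleDeriv (f f' : S1 → E) : Prop :=
  ∀ t : ℝ, HasDerivAt (fun t : ℝ => f (t : S1)) (f' (t : S1)) t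

theorem continuous_circle_iff {Y : Type*} [TopologicalSpace Y] {f : S1 → Y} :
    Continuous f ↔ Continuous fun t : ℝ => f (t : S1) :=
  ⟨fun h => h.comp (AddCircle.continuous_mk' _), fun h => continuous_coinduced_dom.2 h⟩

theorem HasCircleDeriv.continuous {f f' : S1 → E} (h : HasCircleDeriv f f') : Continuous f :=
  continuous_circle_iff.2 (continuous_iff_continuousAt.2 fun t => (h t).continuousAt)

/-- A periodic function has no boundary terms. Applied to products, this supplies the integrations
by parts on the circle. -/
theorem HasCircleDeriv.integral_eq_zero [CompleteSpace E] {f f' : S1 → E} (h : HasCircleDeriv f f')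
    (hf' : Continuous f') : ∫ x, f' x ∂circleMeasure = 0 := by
  rw [integral_circle_eq, intervalIntegral.integral_eq_sub_of_hasDerivAt (fun t _ => h t)
    ((continuous_circle_iff.1 hf').intervalIntegrable _ _)]
  have : ((2 * Real.pi : ℝ) : S1) = ((0 : ℝ) : S1) := by
    rw [AddCircle.coe_period]; rfl
  rw [this, sub_self, smul_zero]

end Circle

theorem HasCircleDeriv.mul {A : Type*} [NormedRing A] [NormedAlgebra ℝ A] {f f' g g' : S1 → A}
    (hf : HasCircleDeriv f f') (hg : HasCircleDeriv g g') :
    HasCircleDeriv (fun x => f x * g x) (fun x => f' x * g x + f x * g' x) :=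
  fun t => (hf t).mul (hg t)

/-! ### Fourier series and weak derivatives on the circle -/

theorem hasCircleDeriv_fourier (n : ℤ) :
    HasCircleDeriv (fun x : S1 => (fourier n x : ℂ)) (fun x => Complex.I * n * fourier n x) := by
  intro t
  have h := hasDerivAt_fourier (2 * Real.pi) n t
  have e : 2 * (Real.pi : ℂ) * Complex.I * n / ((2 * Real.pi : ℝ) : ℂ) = Complex.I * n := by
    have : (Real.pi : ℂ) ≠ 0 := by exact_mod_cast Real.pi_ne_zero
    push_cast
    field_simp
  rw [e] at h
  exact h

theorem norm_fourier (n : ℤ) (x : S1) : ‖(fourier n x : ℂ)‖ = 1 := by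
  rw [fourier_apply]; exact Circle.norm_coe _

theorem fourier_coe (n : ℤ) (t : ℝ) : (fourier n (t : S1) : ℂ) = Complex.exp (n * t * Complex.I) := by
  rw [fourier_coe_apply]
  congr 1
  have : (Real.pi : ℂ) ≠ 0 := by exact_mod_cast Real.pi_ne_zero
  push_cast
  field_simp

theorem continuous_fourier (n : ℤ) : Continuous fun x : S1 => (fourier n x : ℂ) :=
  (fourier n).continuous

theorem HasCircleDeriv.circleDeriv_eq {f f' : S1 → ℂ} (h : HasCircleDeriv f f') :
    circleDeriv f = f' := by
  funext x
  induction x using QuotientAddGroup.induction_on with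
  | H s =>
    have h1 : HasDerivAt (fun t : ℝ => f ((s + t : ℝ) : S1)) (f' ((s + 0 : ℝ) : S1)) 0 :=
      HasDerivAt.comp_const_add s 0 (h (s + 0))
    rw [add_zero] at h1
    exact h1.deriv

theorem IsSmoothCircle.hasCircleDeriv {f : S1 → ℂ} (h : IsSmoothCircle f) :
    HasCircleDeriv f (circleDeriv f) := by
  intro s
  have hd : DifferentiableAt ℝ (fun t : ℝ => f (t : S1)) s :=
    (h.differentiable (by simp)).differentiableAt
  have hd' : HasDerivAt (fun t : ℝ => f (t : S1)) (deriv (fun t : ℝ => f (t : S1)) (s + 0)) (s + 0) := by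
    rw [add_zero]; exact hd.hasDerivAt
  have h1 : HasDerivAt (fun t : ℝ => f ((s + t : ℝ) : S1)) (deriv (fun t : ℝ => f (t : S1)) (s + 0)) 0 :=
    HasDerivAt.comp_const_add s 0 hd'
  have h2 : circleDeriv f (s : S1) = deriv (fun t : ℝ => f (t : S1)) s := by
    rw [add_zero] at h1
    exact h1.deriv
  rw [h2]
  exact hd.hasDerivAt

theorem IsSmoothCircle.continuous_circleDeriv {f : S1 → ℂ} (h : IsSmoothCircle f) :
    Continuous (circleDeriv f) := by
  rw [continuous_circle_iff]
  have : (fun t : ℝ => circleDeriv f (t : S1)) = deriv (fun t : ℝ => f (t : S1)) :=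
    funext fun t => ((h.hasCircleDeriv t).deriv).symm
  rw [this]
  exact h.continuous_deriv (by simp)

theorem HasCircleDeriv.isH1Circle {f f' : S1 → ℂ} (h : HasCircleDeriv f f') (hf' : Continuous f') :
    IsH1Circle f f' where
  memLp := memLp_of_continuous h.continuous _
  memLp_deriv := memLp_of_continuous hf' _
  weakDeriv φ hφ := by
    have h0 := (h.mul hφ.hasCircleDeriv).integral_eq_zero
      ((hf'.mul hφ.hasCircleDeriv.continuous).add (h.continuous.mul hφ.continuous_circleDeriv))
    rw [integral_add (f := fun x => f' x * φ x) (g := fun x => f x * circleDeriv φ x)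
      (integrable_of_continuous (hf'.mul hφ.hasCircleDeriv.continuous))
      (integrable_of_continuous (h.continuous.mul hφ.continuous_circleDeriv))] at h0
    linear_combination h0

theorem isSmoothCircle_fourier (n : ℤ) : IsSmoothCircle fun x : S1 => (fourier n x : ℂ) := by
  have : (fun t : ℝ => (fourier n (t : S1) : ℂ)) = fun t : ℝ => Complex.exp (n * t * Complex.I) :=
    funext fun t => fourier_coe n t
  unfold IsSmoothCircle
  rw [this]
  exact ((contDiff_const.mul Complex.ofRealCLM.contDiff).mul contDiff_const).cexp

/-- Test the weak derivative against the character of frequency `-n`. -/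
theorem IsH1Circle.fourierCoeff_deriv {ψ g : S1 → ℂ} (h : IsH1Circle ψ g) (n : ℤ) :
    fourierCoeff g n = Complex.I * n * fourierCoeff ψ n := by
  have h1 := h.weakDeriv _ (isSmoothCircle_fourier (-n))
  rw [(hasCircleDeriv_fourier (-n)).circleDeriv_eq] at h1
  have h2 : ∫ θ, ψ θ * (Complex.I * ((-n : ℤ) : ℂ) * fourier (-n) θ) ∂circleMeasure
      = -(Complex.I * n * fourierCoeff ψ n) := by
    rw [fourierCoeff, ← integral_const_mul, ← integral_neg]
    refine integral_congr_ae (.of_forall fun x => ?_)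
    simp only [smul_eq_mul]
    push_cast
    ring
  rw [h2] at h1
  rw [neg_inj.1 h1, fourierCoeff]
  refine integral_congr_ae (.of_forall fun x => ?_)
  simp only [smul_eq_mul]
  ring

theorem hasSum_sq_fourierCoeff_circle {f : S1 → ℂ} (hf : MemLp f 2 circleMeasure) :
    HasSum (fun n => ‖fourierCoeff f n‖ ^ 2) (∫ x, ‖f x‖ ^ 2 ∂circleMeasure) := by
  have hf' : MemLp f 2 (AddCircle.haarAddCircle (T := 2 * Real.pi)) := hf
  have h := hasSum_sq_fourierCoeff (T := 2 * Real.pi) (hf'.toLp f)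
  have e : ∀ n, fourierCoeff (hf'.toLp f) n = fourierCoeff f n := fun n =>
    congrFun (fourierCoeff_congr_ae hf'.coeFn_toLp) n
  simp only [e] at h
  convert h using 1
  refine integral_congr_ae ?_
  filter_upwards [hf'.coeFn_toLp] with x hx
  rw [hx]

theorem fourierCoeff_sub_mul {f g : S1 → ℂ} (hf : MemLp f 2 circleMeasure)
    (hg : MemLp g 2 circleMeasure) (z : ℂ) (n : ℤ) :
    fourierCoeff (fun x => g x - z * f x) n = fourierCoeff g n - z * fourierCoeff f n := by
  have i1 : Integrable f circleMeasure := hf.integrable (by norm_num)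
  have i2 : Integrable g circleMeasure := hg.integrable (by norm_num)
  have h := fourierCoeff.add (T := 2 * Real.pi) i2 (i1.const_mul (-z))
  have h2 := fourierCoeff.const_mul (T := 2 * Real.pi) f (-z) n
  have e : (fun x => g x - z * f x) = g + fun x => -z * f x := by
    funext x
    simp only [Pi.add_apply]
    ring
  rw [e, h, Pi.add_apply, h2]
  ring

/-- The magnetic energy is diagonal in Fourier series, so the spectral gaps used below are
statements about the integers `n` in the weights `(n - a)²`. -/
theorem IsH1Circle.hasSum_kinetic {ψ g : S1 → ℂ} (h : IsH1Circle ψ g) (a : ℝ) :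
    HasSum (fun n : ℤ => ((n : ℝ) - a) ^ 2 * ‖fourierCoeff ψ n‖ ^ 2)
      (∫ θ, ‖g θ - Complex.I * (a : ℂ) * ψ θ‖ ^ 2 ∂circleMeasure) := by
  have h1 := hasSum_sq_fourierCoeff_circle
    (h.memLp_deriv.sub (h.memLp.const_mul (Complex.I * (a : ℂ))))
  convert h1 using 2 with n
  have := fourierCoeff_sub_mul h.memLp h.memLp_deriv (Complex.I * (a : ℂ)) n
  have e : fourierCoeff (g - fun x => Complex.I * (a : ℂ) * ψ x) n
      = Complex.I * (((n : ℝ) - a : ℝ) : ℂ) * fourierCoeff ψ n := by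
    rw [show (g - fun x => Complex.I * (a : ℂ) * ψ x) = fun x => g x - Complex.I * (a : ℂ) * ψ x from rfl,
      this, h.fourierCoeff_deriv]
    push_cast
    ring
  rw [e, norm_mul, norm_mul, Complex.norm_I, one_mul, mul_pow, Complex.norm_real, Real.norm_eq_abs,
    sq_abs]
  rfl

open Filter Topology

/-! ### Heat flow of a trigonometric polynomial -/

/-- The real part of a trigonometric polynomial after the heat flow has run for the time `τ ^ 2`. -/
noncomputable def heat (s : Finset ℤ) (c : ℤ → ℂ) (τ : ℝ) (x : S1) : ℝ :=
  (∑ n ∈ s, c n * (Real.exp (-((n : ℝ) ^ 2 * τ ^ 2)) : ℂ) * fourier n x).re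

/-- The Fourier coefficients of the derivative. -/
noncomputable def derivCoeff (c : ℤ → ℂ) (n : ℤ) : ℂ := Complex.I * n * c n

theorem HasCircleDeriv.re {f f' : S1 → ℂ} (h : HasCircleDeriv f f') :
    HasCircleDeriv (fun x => (f x).re) (fun x => (f' x).re) :=
  fun t => by
    have := Complex.reCLM.hasFDerivAt.comp_hasDerivAt t (h t)
    exact this

theorem HasCircleDeriv.ofReal {f f' : S1 → ℝ} (h : HasCircleDeriv f f') :
    HasCircleDeriv (fun x => (f x : ℂ)) (fun x => (f' x : ℂ)) :=
  fun t => (h t).ofReal_comp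

theorem heat_hasCircleDeriv (s : Finset ℤ) (c : ℤ → ℂ) (τ : ℝ) :
    HasCircleDeriv (heat s c τ) (heat s (derivCoeff c) τ) := by
  refine HasCircleDeriv.re fun t => ?_
  refine HasDerivAt.fun_sum fun n _ => ?_
  refine (((hasCircleDeriv_fourier n) t).const_mul
    (c n * (Real.exp (-((n : ℝ) ^ 2 * τ ^ 2)) : ℂ))).congr_deriv ?_
  simp only [derivCoeff]
  ring

/-- Running the flow for the time `τ²` costs the factor `2τ`. In exchange it is defined, and keeps
lower bounds, for every real `τ`, so two-sided derivatives at `τ = 0` make sense. -/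
theorem heat_hasDerivAt (s : Finset ℤ) (c : ℤ → ℂ) (τ : ℝ) (x : S1) :
    HasDerivAt (fun τ => heat s c τ x) (2 * τ * heat s (derivCoeff (derivCoeff c)) τ x) τ := by
  have h : HasDerivAt (fun τ : ℝ => ∑ n ∈ s, c n * (Real.exp (-((n : ℝ) ^ 2 * τ ^ 2)) : ℂ) *
      (fourier n x : ℂ)) (∑ n ∈ s, (2 * τ : ℝ) • (derivCoeff (derivCoeff c) n *
        (Real.exp (-((n : ℝ) ^ 2 * τ ^ 2)) : ℂ) * fourier n x)) τ := by
    refine HasDerivAt.fun_sum fun n _ => ?_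
    have h1 : HasDerivAt (fun τ : ℝ => Real.exp (-((n : ℝ) ^ 2 * τ ^ 2)))
        (Real.exp (-((n : ℝ) ^ 2 * τ ^ 2)) * (-((n : ℝ) ^ 2 * (2 * τ)))) τ := by
      have := ((hasDerivAt_pow 2 τ).const_mul ((n : ℝ) ^ 2)).neg.exp
      simpa using this
    refine ((h1.ofReal_comp.const_mul (c n)).mul_const (fourier n x : ℂ)).congr_deriv ?_
    simp only [derivCoeff, Complex.real_smul]
    push_cast
    linear_combination (2 * τ * n ^ 2 * c n * Complex.exp (-((n : ℂ) ^ 2 * τ ^ 2)) *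
      (fourier n x : ℂ)) * (-Complex.I_mul_I)
  have := Complex.reCLM.hasFDerivAt.comp_hasDerivAt τ h
  rw [← Finset.smul_sum] at this
  refine this.congr_deriv ?_
  simp [heat]

theorem heat_continuous (s : Finset ℤ) (c : ℤ → ℂ) :
    Continuous fun z : ℝ × S1 => heat s c z.1 z.2 := by
  refine Complex.continuous_re.comp (continuous_finsetSum _ fun n _ => ?_)
  have := (continuous_fourier n).comp (continuous_snd : Continuous (Prod.snd : ℝ × S1 → S1))
  have h2 : Continuous fun z : ℝ × S1 => (Real.exp (-((n : ℝ) ^ 2 * z.1 ^ 2)) : ℂ) := by fun_prop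
  exact (continuous_const.mul h2).mul this

theorem heat_abs_le (s : Finset ℤ) (c : ℤ → ℂ) (τ : ℝ) (x : S1) :
    |heat s c τ x| ≤ ∑ n ∈ s, ‖c n‖ := by
  refine (Complex.abs_re_le_norm _).trans ((norm_sum_le _ _).trans (Finset.sum_le_sum fun n _ => ?_))
  rw [norm_mul, norm_mul, norm_fourier, mul_one, Complex.norm_real, Real.norm_eq_abs,
    abs_of_pos (Real.exp_pos _)]
  refine mul_le_of_le_one_right (norm_nonneg _) (Real.exp_le_one_iff.2 ?_)
  have : 0 ≤ (n : ℝ) ^ 2 * τ ^ 2 := by positivity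
  linarith

theorem integral_fourier (n : ℤ) :
    ∫ x : S1, (fourier n x : ℂ) ∂circleMeasure = if n = 0 then 1 else 0 := by
  split_ifs with h
  · subst h
    simp
  · have h1 := (hasCircleDeriv_fourier n).integral_eq_zero
      (continuous_const.mul (continuous_fourier n))
    rw [integral_const_mul] at h1
    have : (Complex.I * n : ℂ) ≠ 0 := mul_ne_zero Complex.I_ne_zero (by exact_mod_cast h)
    exact (mul_eq_zero.1 h1).resolve_left this

theorem integral_heat (s : Finset ℤ) (c : ℤ → ℂ) (τ : ℝ) :
    ∫ x, heat s c τ x ∂circleMeasure = if 0 ∈ s then (c 0).re else 0 := by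
  have hi : ∀ n ∈ s, Integrable (fun x : S1 => c n * (Real.exp (-((n : ℝ) ^ 2 * τ ^ 2)) : ℂ) *
      (fourier n x : ℂ)) circleMeasure := fun n _ =>
    integrable_of_continuous (continuous_const.mul (continuous_fourier n))
  have h := integral_re (integrable_finsetSum s hi)
  simp only [heat]
  refine h.trans ?_
  rw [integral_finsetSum s hi]
  simp only [integral_const_mul, integral_fourier, mul_ite, mul_one, mul_zero,
    Finset.sum_ite_eq']
  split_ifs <;> simp

theorem heat_tendsto (s : Finset ℤ) (c : ℤ → ℂ) (x : S1) :
    Tendsto (fun τ => heat s c τ x) atTop (𝓝 (if 0 ∈ s then (c 0).re else 0)) := by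
  have h : Tendsto (fun τ : ℝ => ∑ n ∈ s, c n * (Real.exp (-((n : ℝ) ^ 2 * τ ^ 2)) : ℂ) *
      (fourier n x : ℂ)) atTop (𝓝 (∑ n ∈ s, if n = 0 then c n else 0)) := by
    refine tendsto_finsetSum _ fun n _ => ?_
    split_ifs with hn
    · subst hn
      simp
    · have h1 : Tendsto (fun τ : ℝ => Real.exp (-((n : ℝ) ^ 2 * τ ^ 2))) atTop (𝓝 0) := by
        refine Real.tendsto_exp_neg_atTop_nhds_zero.comp ?_
        exact (tendsto_pow_atTop two_ne_zero).const_mul_atTop (by positivity)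
      have h2 := (Complex.continuous_ofReal.tendsto 0).comp h1
      have h3 := (h2.const_mul (c n)).mul_const (fourier n x : ℂ)
      simpa using h3
  have h2 := (Complex.continuous_re.tendsto _).comp h
  have e : (∑ n ∈ s, if n = 0 then c n else 0).re = if 0 ∈ s then (c 0).re else 0 := by
    rw [Finset.sum_ite_eq']
    split_ifs <;> simp
  rw [← e]
  exact h2

/-- The characteristic function of a centred Gaussian of variance `2τ²` at `n` is `exp(-n²τ²)`, so
the heat flow averages translates of the initial datum against this Gaussian. -/
theorem heat_eq_integral (s : Finset ℤ) (c : ℤ → ℂ) (τ x : ℝ) :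
    heat s c τ (x : S1) = ∫ y, heat s c 0 ((x + y : ℝ) : S1)
      ∂ProbabilityTheory.gaussianReal 0 (Real.toNNReal (2 * τ ^ 2)) := by
  set γ := ProbabilityTheory.gaussianReal 0 (Real.toNNReal (2 * τ ^ 2)) with hγ
  have : IsProbabilityMeasure γ := ProbabilityTheory.instIsProbabilityMeasureGaussianReal _ _
  have hi : ∀ n ∈ s, Integrable (fun y : ℝ => c n * (Real.exp (-((n : ℝ) ^ 2 * (0 : ℝ) ^ 2)) : ℂ) *
      (fourier n ((x + y : ℝ) : S1) : ℂ)) γ := fun n _ => by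
    refine Integrable.of_bound (C := ‖c n‖) ?_ (.of_forall fun y => ?_)
    · exact (continuous_const.mul ((continuous_fourier n).comp
        ((AddCircle.continuous_mk' _).comp (continuous_const.add continuous_id)))).aestronglyMeasurable
    · rw [norm_mul, norm_mul, norm_fourier]; simp
  have h := integral_re (integrable_finsetSum s hi)
  simp only [heat]
  refine Eq.trans ?_ h.symm
  rw [integral_finsetSum s hi]
  congr 1
  refine Finset.sum_congr rfl fun n _ => ?_
  rw [integral_const_mul]
  have hc := ProbabilityTheory.charFun_gaussianReal (μ := 0) (v := (Real.toNNReal (2 * τ ^ 2))) (n : ℝ)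
  rw [charFun_apply_real] at hc
  have e : ∀ y : ℝ, (fourier n ((x + y : ℝ) : S1) : ℂ)
      = fourier n (x : S1) * Complex.exp ((n : ℝ) * y * Complex.I) := fun y => by
    rw [fourier_coe, fourier_coe, ← Complex.exp_add]
    congr 1
    push_cast
    ring
  simp only [e]
  rw [integral_const_mul, hc]
  have e2 : Complex.exp (((n : ℝ) : ℂ) * ((0 : ℝ) : ℂ) * Complex.I - ((Real.toNNReal (2 * τ ^ 2) : ℝ) : ℂ) * ((n : ℝ) : ℂ) ^ 2 / 2)
      = (Real.exp (-((n : ℝ) ^ 2 * τ ^ 2)) : ℂ) := by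
    rw [Complex.ofReal_exp]
    congr 1
    rw [Real.coe_toNNReal _ (by positivity)]
    push_cast
    ring
  rw [e2]
  simp
  ring

/-- Minimum principle: a Gaussian average of values that are at least `m` is at least `m`. -/
theorem le_heat {s : Finset ℤ} {c : ℤ → ℂ} {m : ℝ} (h : ∀ x, m ≤ heat s c 0 x) (τ : ℝ) (x : S1) :
    m ≤ heat s c τ x := by
  induction x using QuotientAddGroup.induction_on with
  | H x =>
    have := heat_eq_integral s c τ x
    refine le_of_le_of_eq ?_ this.symm
    set γ := ProbabilityTheory.gaussianReal 0 (Real.toNNReal (2 * τ ^ 2))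
    have : IsProbabilityMeasure γ := ProbabilityTheory.instIsProbabilityMeasureGaussianReal _ _
    have h1 : ∫ _ : ℝ, m ∂γ = m := by simp
    rw [← h1]
    refine integral_mono (integrable_const _) ?_ fun y => h _
    refine Integrable.of_bound (C := ∑ n ∈ s, ‖c n‖) ?_ (.of_forall fun y => heat_abs_le _ _ _ _)
    exact (((heat_hasCircleDeriv s c 0).continuous).comp
        ((AddCircle.continuous_mk' _).comp (continuous_const.add continuous_id))).aestronglyMeasurable

/-! ### Integral identities on the circle -/

theorem HasCircleDeriv.rpow {f f' : S1 → ℝ} (h : HasCircleDeriv f f') (hf : ∀ x, 0 < f x) (r : ℝ) :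
    HasCircleDeriv (fun x => f x ^ r) (fun x => r * f x ^ (r - 1) * f' x) := fun t =>
  ((h t).rpow_const (p := r) (.inl (hf _).ne')).congr_deriv (by ring)

theorem continuous_rpow_of_pos {X : Type*} [TopologicalSpace X] {f : X → ℝ} (hf : Continuous f)
    (h0 : ∀ x, 0 < f x) (r : ℝ) : Continuous fun x => f x ^ r :=
  hf.rpow_const fun x => .inl (h0 x).ne'

/-- Poincaré inequality: the mean kills the mode `0`, and `n² ≥ 1` on all the others. -/
theorem integral_sq_le_of_integral_eq_zero {f f' : S1 → ℂ} (h : HasCircleDeriv f f')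
    (hf' : Continuous f') (h0 : ∫ x, f x ∂circleMeasure = 0) :
    ∫ x, ‖f x‖ ^ 2 ∂circleMeasure ≤ ∫ x, ‖f' x‖ ^ 2 ∂circleMeasure := by
  have h1 := h.isH1Circle hf'
  have h2 := h1.hasSum_kinetic 0
  simp only [sub_zero, Complex.ofReal_zero, mul_zero, zero_mul] at h2
  refine hasSum_le (fun n => ?_) (hasSum_sq_fourierCoeff_circle h1.memLp) h2
  rcases eq_or_ne n 0 with rfl | hn
  · have : fourierCoeff f 0 = 0 := by
      rw [fourierCoeff, ← h0]
      refine integral_congr_ae (.of_forall fun x => ?_)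
      simp
    simp [this]
  · refine le_mul_of_one_le_left (sq_nonneg _) ?_
    have : (1 : ℤ) ≤ n ^ 2 := by
      have := Int.one_le_abs hn
      nlinarith [sq_abs n]
    exact_mod_cast this

theorem integral_sq_le_of_integral_eq_zero_real {f f' : S1 → ℝ} (h : HasCircleDeriv f f')
    (hf' : Continuous f') (h0 : ∫ x, f x ∂circleMeasure = 0) :
    ∫ x, f x ^ 2 ∂circleMeasure ≤ ∫ x, f' x ^ 2 ∂circleMeasure := by
  have := integral_sq_le_of_integral_eq_zero h.ofReal (Complex.continuous_ofReal.comp hf')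
    (by rw [integral_complex_ofReal, h0]; rfl)
  simpa using this

theorem integral_rpow_mul_deriv2 {f f₁ f₂ : S1 → ℝ} (hf : ∀ x, 0 < f x)
    (h₁ : HasCircleDeriv f f₁) (h₂ : HasCircleDeriv f₁ f₂) (q : ℝ) (hc : Continuous f₂) :
    ∫ x, f x ^ (q - 1) * f₂ x ∂circleMeasure
      = -(q - 1) * ∫ x, f x ^ (q - 2) * f₁ x ^ 2 ∂circleMeasure := by
  have c := fun r => continuous_rpow_of_pos h₁.continuous hf r
  have h := ((h₁.rpow hf (q - 1)).mul h₂).integral_eq_zero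
    (((continuous_const.mul (c _)).mul h₂.continuous).mul h₂.continuous |>.add ((c _).mul hc))
  rw [integral_add (f := fun x => (q - 1) * f x ^ (q - 1 - 1) * f₁ x * f₁ x)
    (g := fun x => f x ^ (q - 1) * f₂ x)
    (integrable_of_continuous (((continuous_const.mul (c _)).mul h₂.continuous).mul h₂.continuous))
    (integrable_of_continuous ((c _).mul hc))] at h
  have e : ∫ x, (q - 1) * f x ^ (q - 1 - 1) * f₁ x * f₁ x ∂circleMeasure
      = (q - 1) * ∫ x, f x ^ (q - 2) * f₁ x ^ 2 ∂circleMeasure := by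
    rw [← integral_const_mul]
    refine integral_congr_ae (.of_forall fun x => ?_)
    simp only
    rw [show q - 1 - 1 = q - 2 by ring]
    ring
  rw [e] at h
  linarith

/-- Integrate the derivative of `f ^ (q - 3) * f₁ ^ 3`. -/
theorem integral_rpow_mul_sq_mul_deriv2 {f f₁ f₂ : S1 → ℝ} (hf : ∀ x, 0 < f x)
    (h₁ : HasCircleDeriv f f₁) (h₂ : HasCircleDeriv f₁ f₂) (q : ℝ) (hc : Continuous f₂) :
    3 * ∫ x, f x ^ (q - 3) * f₁ x ^ 2 * f₂ x ∂circleMeasure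
      = (3 - q) * ∫ x, f x ^ (q - 4) * f₁ x ^ 4 ∂circleMeasure := by
  have c := fun r => continuous_rpow_of_pos h₁.continuous hf r
  have c1 := h₂.continuous
  have h := ((h₁.rpow hf (q - 3)).mul ((h₂.mul h₂).mul h₂)).integral_eq_zero
    (by have := c (q - 3); have := c (q - 3 - 1); fun_prop)
  rw [← integral_const_mul, ← integral_const_mul, ← sub_eq_zero, ← integral_sub
    (integrable_of_continuous (by have := c (q - 3); fun_prop))
    (integrable_of_continuous (by have := c (q - 4); fun_prop)), ← h]
  refine integral_congr_ae (.of_forall fun x => ?_)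
  simp only
  rw [show q - 3 - 1 = q - 4 by ring]
  ring

/-- This is the Poincaré inequality for `f ^ (q / 2 - 1) * f₁`, which has mean zero because it is a
multiple of the derivative of `f ^ (q / 2)`. -/
theorem integral_rpow_mul_le {f f₁ f₂ : S1 → ℝ} (hf : ∀ x, 0 < f x)
    (h₁ : HasCircleDeriv f f₁) (h₂ : HasCircleDeriv f₁ f₂) (q : ℝ) (hq : q ≠ 0)
    (hc : Continuous f₂) :
    ∫ x, f x ^ (q - 2) * f₁ x ^ 2 ∂circleMeasure
      ≤ (q - 2) ^ 2 / 4 * ∫ x, f x ^ (q - 4) * f₁ x ^ 4 ∂circleMeasure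
        + (q - 2) * ∫ x, f x ^ (q - 3) * f₁ x ^ 2 * f₂ x ∂circleMeasure
        + ∫ x, f x ^ (q - 2) * f₂ x ^ 2 ∂circleMeasure := by
  have c := fun r => continuous_rpow_of_pos h₁.continuous hf r
  have c1 := h₂.continuous
  have hm : ∫ x, f x ^ (q / 2 - 1) * f₁ x ∂circleMeasure = 0 := by
    have h := (h₁.rpow hf (q / 2)).integral_eq_zero (by have := c (q / 2 - 1); fun_prop)
    have e : ∀ x, q / 2 * f x ^ (q / 2 - 1) * f₁ x = q / 2 * (f x ^ (q / 2 - 1) * f₁ x) :=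
      fun x => by ring
    simp only [e] at h
    rw [integral_const_mul] at h
    exact (mul_eq_zero.1 h).resolve_left (by positivity)
  have h := integral_sq_le_of_integral_eq_zero_real ((h₁.rpow hf (q / 2 - 1)).mul h₂)
    (by have := c (q / 2 - 1); have := c (q / 2 - 1 - 1); fun_prop) hm
  have p2 : ∀ x, (f x ^ (q / 2 - 1)) ^ 2 = f x ^ (q - 2) := fun x => by
    rw [← Real.rpow_natCast, ← Real.rpow_mul (hf x).le]; congr 1; push_cast; ring
  have p4 : ∀ x, (f x ^ (q / 2 - 1 - 1)) ^ 2 = f x ^ (q - 4) := fun x => by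
    rw [← Real.rpow_natCast, ← Real.rpow_mul (hf x).le]; congr 1; push_cast; ring
  have p3 : ∀ x, f x ^ (q / 2 - 1 - 1) * f x ^ (q / 2 - 1) = f x ^ (q - 3) := fun x => by
    rw [← Real.rpow_add (hf x)]; congr 1; ring
  have e1 : ∫ x, (f x ^ (q / 2 - 1) * f₁ x) ^ 2 ∂circleMeasure
      = ∫ x, f x ^ (q - 2) * f₁ x ^ 2 ∂circleMeasure := by
    simp only [mul_pow, p2]
  rw [e1] at h
  refine h.trans_eq ?_
  rw [← integral_const_mul, ← integral_const_mul, ← integral_add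
    (integrable_of_continuous (by have := c (q - 4); fun_prop))
    (integrable_of_continuous (by have := c (q - 3); fun_prop)), ← integral_add
    (integrable_of_continuous (by have := c (q - 4); have := c (q - 3); fun_prop))
    (integrable_of_continuous (by have := c (q - 2); fun_prop))]
  refine integral_congr_ae (.of_forall fun x => ?_)
  simp only
  rw [← p2, ← p3, ← p4]
  ring

/-- The carré du champ computation. The left side is the time derivative of `∫ f ^ (q - 2) f₁ ^ 2`
under `∂ₜ f = f₂`. Integration by parts leaves `∫ f ^ (q - 2) f₂ ^ 2` and a mixed term; Poincaré
controls the former, and the mixed term is a multiple of `∫ f ^ (q - 4) f₁ ^ 4`. -/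
theorem dissipation_le {f f₁ f₂ f₃ : S1 → ℝ} (hf : ∀ x, 0 < f x) (h₁ : HasCircleDeriv f f₁)
    (h₂ : HasCircleDeriv f₁ f₂) (h₃ : HasCircleDeriv f₂ f₃) (q : ℝ) (hq : q ≠ 0)
    (hc : Continuous f₃) :
    ∫ x, ((q - 2) * f x ^ (q - 3) * f₂ x * f₁ x ^ 2 + 2 * f x ^ (q - 2) * f₁ x * f₃ x) ∂circleMeasure
      ≤ -2 * (∫ x, f x ^ (q - 2) * f₁ x ^ 2 ∂circleMeasure)
        - q * (2 - q) / 6 * ∫ x, f x ^ (q - 4) * f₁ x ^ 4 ∂circleMeasure := by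
  have c := fun r => continuous_rpow_of_pos h₁.continuous hf r
  have c1 := h₂.continuous
  have c2 := h₃.continuous
  have hZ := integral_rpow_mul_sq_mul_deriv2 hf h₁ h₂ q c2
  have hP := integral_rpow_mul_le hf h₁ h₂ q hq c2
  have h := ((h₁.rpow hf (q - 2)).mul (h₂.mul h₃)).integral_eq_zero
    (by have := c (q - 2); have := c (q - 2 - 1); fun_prop)
  have h' := congrArg (2 * ·) h
  simp only [mul_zero] at h'
  have e : ∫ x, ((q - 2) * f x ^ (q - 3) * f₂ x * f₁ x ^ 2 + 2 * f x ^ (q - 2) * f₁ x * f₃ x)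
      ∂circleMeasure = -2 * (∫ x, f x ^ (q - 2) * f₂ x ^ 2 ∂circleMeasure)
        - (q - 2) * ∫ x, f x ^ (q - 3) * f₁ x ^ 2 * f₂ x ∂circleMeasure := by
    rw [← integral_const_mul, ← integral_const_mul, ← integral_sub
      (integrable_of_continuous (by have := c (q - 2); fun_prop))
      (integrable_of_continuous (by have := c (q - 3); fun_prop)), ← sub_eq_zero, ← integral_sub
      (integrable_of_continuous (by have := c (q - 2); have := c (q - 3); fun_prop))
      (integrable_of_continuous (by have := c (q - 2); have := c (q - 3); fun_prop)),
      ← h', ← integral_const_mul]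
    refine integral_congr_ae (.of_forall fun x => ?_)
    simp only
    rw [show q - 2 - 1 = q - 3 by ring]
    ring
  rw [e]
  -- The quartic term ends up with `(q - 2)² / 2 + (q - 2)(3 - q) / 3 = -q (2 - q) / 6`.
  linear_combination 2 * hP + (q - 2) / 3 * hZ

theorem sq_integral_le {f g : S1 → ℝ} (hf : Continuous f) (hg : Continuous g) :
    (∫ x, f x * g x ∂circleMeasure) ^ 2
      ≤ (∫ x, f x ^ 2 ∂circleMeasure) * ∫ x, g x ^ 2 ∂circleMeasure := by
  have key : ∀ t : ℝ, 0 ≤ (∫ x, g x ^ 2 ∂circleMeasure) * (t * t)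
      + 2 * (∫ x, f x * g x ∂circleMeasure) * t + ∫ x, f x ^ 2 ∂circleMeasure := fun t => by
    have h0 : 0 ≤ ∫ x, (f x + t * g x) ^ 2 ∂circleMeasure := integral_nonneg fun x => sq_nonneg _
    have e : ∫ x, (f x + t * g x) ^ 2 ∂circleMeasure = (∫ x, g x ^ 2 ∂circleMeasure) * (t * t)
      + 2 * (∫ x, f x * g x ∂circleMeasure) * t + ∫ x, f x ^ 2 ∂circleMeasure := by
      rw [← integral_mul_const, ← integral_const_mul, ← integral_mul_const, ← integral_add
        (integrable_of_continuous (by fun_prop)) (integrable_of_continuous (by fun_prop)),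
        ← integral_add (integrable_of_continuous (by fun_prop))
        (integrable_of_continuous (by fun_prop))]
      refine integral_congr_ae (.of_forall fun x => ?_)
      simp only
      ring
    linarith
  have := discrim_le_zero key
  unfold discrim at this
  linarith

theorem hasDerivAt_integral_circle {F F' : ℝ → S1 → ℝ} (hF : Continuous fun z : ℝ × S1 => F z.1 z.2)
    (hF' : Continuous fun z : ℝ × S1 => F' z.1 z.2)
    (h : ∀ τ x, HasDerivAt (fun τ => F τ x) (F' τ x) τ) (τ : ℝ) :
    HasDerivAt (fun τ => ∫ x, F τ x ∂circleMeasure) (∫ x, F' τ x ∂circleMeasure) τ := by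
  obtain ⟨C, hC⟩ := ((isCompact_Icc (a := τ - 1) (b := τ + 1)).prod
    (isCompact_univ (X := S1))).exists_bound_of_continuousOn hF'.continuousOn
  have cF : ∀ τ, Continuous (F τ) := fun τ => hF.comp (continuous_const.prodMk continuous_id)
  have cF' : ∀ τ, Continuous (F' τ) := fun τ => hF'.comp (continuous_const.prodMk continuous_id)
  refine (hasDerivAt_integral_of_dominated_loc_of_deriv_le (bound := fun _ => C)
    (Icc_mem_nhds (by linarith) (by linarith) : Set.Icc (τ - 1) (τ + 1) ∈ 𝓝 τ)
    (.of_forall fun τ => (cF τ).aestronglyMeasurable) (integrable_of_continuous (cF τ))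
    (cF' τ).aestronglyMeasurable (.of_forall fun x σ hσ => hC (σ, x) ⟨hσ, trivial⟩)
    (integrable_const _) (.of_forall fun x σ _ => h σ x)).2

theorem exists_pos_lower_bound {f : S1 → ℝ} (hf : Continuous f) (h : ∀ x, 0 < f x) :
    ∃ m, 0 < m ∧ ∀ x, m ≤ f x := by
  obtain ⟨x, _, hx⟩ := isCompact_univ.exists_isMinOn (Set.univ_nonempty (α := S1)) hf.continuousOn
  exact ⟨f x, h x, fun y => hx (Set.mem_univ y)⟩

/-! ### Entropy and its dissipation along the heat flow -/

section Flow

variable {s : Finset ℤ} {c : ℤ → ℂ}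

theorem heat_pos (h : ∀ x, 0 < heat s c 0 x) (τ : ℝ) (x : S1) : 0 < heat s c τ x := by
  obtain ⟨m, hm, hm'⟩ := exists_pos_lower_bound (heat_hasCircleDeriv s c 0).continuous h
  exact hm.trans_le (le_heat hm' τ x)

theorem continuous_heat_rpow (h : ∀ x, 0 < heat s c 0 x) (r : ℝ) :
    Continuous fun z : ℝ × S1 => heat s c z.1 z.2 ^ r :=
  continuous_rpow_of_pos (heat_continuous s c) (fun z => heat_pos h z.1 z.2) r

/-- The weighted Dirichlet integral `∫ f ^ (q - 2) * f' ^ 2` along the heat flow. -/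
noncomputable def heatFisher (s : Finset ℤ) (c : ℤ → ℂ) (q τ : ℝ) : ℝ :=
  ∫ x, heat s c τ x ^ (q - 2) * heat s (derivCoeff c) τ x ^ 2 ∂circleMeasure

/-- The integral `∫ f ^ q` along the heat flow. -/
noncomputable def heatMass (s : Finset ℤ) (c : ℤ → ℂ) (q τ : ℝ) : ℝ :=
  ∫ x, heat s c τ x ^ q ∂circleMeasure

theorem heatFisher_nonneg (h : ∀ x, 0 < heat s c 0 x) (q τ : ℝ) : 0 ≤ heatFisher s c q τ :=
  integral_nonneg fun x => mul_nonneg (Real.rpow_nonneg (heat_pos h τ x).le _) (sq_nonneg _)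

theorem heatMass_pos (h : ∀ x, 0 < heat s c 0 x) (q τ : ℝ) : 0 < heatMass s c q τ := by
  have cc := continuous_rpow_of_pos (heat_hasCircleDeriv s c τ).continuous (heat_pos h τ) q
  obtain ⟨m, hm, hm'⟩ := exists_pos_lower_bound cc fun x => Real.rpow_pos_of_pos (heat_pos h τ x) q
  refine hm.trans_le ?_
  calc m = ∫ _, m ∂circleMeasure := by simp
    _ ≤ _ := integral_mono (integrable_const _) (integrable_of_continuous cc) hm'

/-- Entropy production: one integration by parts turns `∫ f ^ (q - 1) f''` into the weighted
Dirichlet integral. -/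
theorem hasDerivAt_heatMass (h : ∀ x, 0 < heat s c 0 x) (q τ : ℝ) :
    HasDerivAt (heatMass s c q) (-(2 * τ * (q * (q - 1))) * heatFisher s c q τ) τ := by
  have h2 := integral_rpow_mul_deriv2 (heat_pos h τ) (heat_hasCircleDeriv s c τ)
    (heat_hasCircleDeriv s (derivCoeff c) τ) q (heat_hasCircleDeriv s _ τ).continuous
  have h1 := hasDerivAt_integral_circle (F := fun τ x => heat s c τ x ^ q)
    (F' := fun τ x => 2 * τ * heat s (derivCoeff (derivCoeff c)) τ x * q * heat s c τ x ^ (q - 1))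
    (continuous_heat_rpow h q)
    (by have := continuous_heat_rpow h (q - 1)
        have := heat_continuous s (derivCoeff (derivCoeff c))
        fun_prop)
    (fun τ x => (heat_hasDerivAt s c τ x).rpow_const (.inl (heat_pos h τ x).ne')) τ
  refine h1.congr_deriv ?_
  rw [heatFisher, show -(2 * τ * (q * (q - 1))) * ∫ x, heat s c τ x ^ (q - 2) *
      heat s (derivCoeff c) τ x ^ 2 ∂circleMeasure = 2 * τ * q * (-(q - 1) * ∫ x, heat s c τ x ^ (q - 2) *
      heat s (derivCoeff c) τ x ^ 2 ∂circleMeasure) by ring, ← h2, ← integral_const_mul]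
  refine integral_congr_ae (.of_forall fun x => ?_)
  simp only
  ring

/-- By Cauchy–Schwarz, `(∫ f ^ (q - 2) f'²)² ≤ ∫ f ^ q * ∫ f ^ (q - 4) f'⁴`. This replaces the
quartic term of `dissipation_le` and closes the differential inequality in terms of the two
functionals `heatFisher` and `heatMass`. -/
theorem hasDerivAt_heatFisher (h : ∀ x, 0 < heat s c 0 x) {q : ℝ} (hq : q ∈ Set.Ioc (1 : ℝ) 2)
    {τ : ℝ} (hτ : 0 ≤ τ) :
    ∃ d, HasDerivAt (heatFisher s c q) d τ ∧ d ≤ -(2 * τ) * (2 * heatFisher s c q τ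
      + q * (2 - q) / 6 * (heatFisher s c q τ ^ 2 / heatMass s c q τ)) := by
  have cf := heat_continuous s c
  have cf1 := heat_continuous s (derivCoeff c)
  have cf2 := heat_continuous s (derivCoeff (derivCoeff c))
  have cf3 := heat_continuous s (derivCoeff (derivCoeff (derivCoeff c)))
  have cr := fun r => continuous_heat_rpow h r
  have hd := dissipation_le (heat_pos h τ) (heat_hasCircleDeriv s c τ)
    (heat_hasCircleDeriv s _ τ) (heat_hasCircleDeriv s _ τ) q (by linarith [hq.1])
    (heat_hasCircleDeriv s _ τ).continuous
  refine ⟨_, hasDerivAt_integral_circle (F' := fun τ x => 2 * τ * ((q - 2) * heat s c τ x ^ (q - 3)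
      * heat s (derivCoeff (derivCoeff c)) τ x * heat s (derivCoeff c) τ x ^ 2
      + 2 * heat s c τ x ^ (q - 2) * heat s (derivCoeff c) τ x
        * heat s (derivCoeff (derivCoeff (derivCoeff c))) τ x))
    (by have := cr (q - 2); fun_prop) (by have := cr (q - 2); have := cr (q - 3); fun_prop)
    (fun τ x => ?_) τ, ?_⟩
  · refine (((heat_hasDerivAt s c τ x).rpow_const (p := q - 2) (.inl (heat_pos h τ x).ne')).mul
      ((heat_hasDerivAt s (derivCoeff c) τ x).pow 2)).congr_deriv ?_
    rw [show q - 2 - 1 = q - 3 by ring]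
    simp
    ring
  · rw [integral_const_mul]
    have hcs := sq_integral_le (f := fun x => heat s c τ x ^ (q / 2))
      (g := fun x => heat s c τ x ^ (q / 2 - 2) * heat s (derivCoeff c) τ x ^ 2)
      (continuous_rpow_of_pos (heat_hasCircleDeriv s c τ).continuous (heat_pos h τ) _)
      ((continuous_rpow_of_pos (heat_hasCircleDeriv s c τ).continuous (heat_pos h τ) _).mul
        ((heat_hasCircleDeriv s _ τ).continuous.pow 2))
    have e1 : ∀ x, heat s c τ x ^ (q / 2) * (heat s c τ x ^ (q / 2 - 2)
        * heat s (derivCoeff c) τ x ^ 2)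
        = heat s c τ x ^ (q - 2) * heat s (derivCoeff c) τ x ^ 2 := fun x => by
      rw [← mul_assoc, ← Real.rpow_add (heat_pos h τ x)]; congr 2; ring
    have e2 : ∀ x, (heat s c τ x ^ (q / 2)) ^ 2 = heat s c τ x ^ q := fun x => by
      rw [← Real.rpow_natCast, ← Real.rpow_mul (heat_pos h τ x).le]; congr 1; push_cast; ring
    have e3 : ∀ x, (heat s c τ x ^ (q / 2 - 2) * heat s (derivCoeff c) τ x ^ 2) ^ 2
        = heat s c τ x ^ (q - 4) * heat s (derivCoeff c) τ x ^ 4 := fun x => by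
      rw [mul_pow, ← pow_mul, ← Real.rpow_natCast, ← Real.rpow_mul (heat_pos h τ x).le]
      congr 2; push_cast; ring
    simp only [e1, e2, e3] at hcs
    have hM := heatMass_pos h q τ
    have hY : heatFisher s c q τ ^ 2 / heatMass s c q τ
        ≤ ∫ x, heat s c τ x ^ (q - 4) * heat s (derivCoeff c) τ x ^ 4 ∂circleMeasure := by
      rw [div_le_iff₀' hM]
      exact hcs
    have hk : 0 ≤ q * (2 - q) / 6 := by
      have := hq.1; have := hq.2
      exact div_nonneg (mul_nonneg (by linarith) (by linarith)) (by norm_num)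
    have h3 := mul_le_mul_of_nonneg_left hY hk
    have h4 : (0 : ℝ) ≤ 2 * τ := by linarith
    calc _ ≤ 2 * τ * (-2 * heatFisher s c q τ - q * (2 - q) / 6 *
          (heatFisher s c q τ ^ 2 / heatMass s c q τ)) :=
          mul_le_mul_of_nonneg_left (hd.trans (by rw [← heatFisher]; linarith)) h4
      _ = _ := by ring

theorem tendsto_heatMass (h : ∀ x, 0 < heat s c 0 x) {q : ℝ} (hq : 0 < q) :
    Tendsto (heatMass s c q) atTop (𝓝 ((∫ x, heat s c 0 x ∂circleMeasure) ^ q)) := by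
  have := tendsto_integral_filter_of_dominated_convergence (μ := circleMeasure) (l := atTop)
    (F := fun τ x => heat s c τ x ^ q)
    (f := fun _ => (∫ x, heat s c 0 x ∂circleMeasure) ^ q)
    (fun _ => (∑ n ∈ s, ‖c n‖) ^ q)
    (.of_forall fun τ => (continuous_rpow_of_pos (heat_hasCircleDeriv s c τ).continuous
      (heat_pos h τ) _).aestronglyMeasurable)
    (.of_forall fun τ => .of_forall fun x => ?_) (integrable_const _)
    (.of_forall fun x => ?_)
  · rw [integral_const, probReal_univ, one_smul] at this
    exact this
  · rw [Real.norm_eq_abs, abs_of_nonneg (Real.rpow_nonneg (heat_pos h τ x).le _)]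
    exact Real.rpow_le_rpow (heat_pos h τ x).le ((le_abs_self _).trans (heat_abs_le s c τ x)) hq.le
  · rw [integral_heat]
    exact (heat_tendsto s c x).rpow_const (.inr hq.le)

theorem tendsto_heatFisher (h : ∀ x, 0 < heat s c 0 x) {q : ℝ} (hq : q ≤ 2) :
    Tendsto (heatFisher s c q) atTop (𝓝 0) := by
  obtain ⟨m, hm, hm'⟩ := exists_pos_lower_bound (heat_hasCircleDeriv s c 0).continuous h
  have hb : ∀ τ x, heat s c τ x ^ (q - 2) ≤ m ^ (q - 2) := fun τ x =>
    Real.rpow_le_rpow_of_nonpos hm (le_heat hm' τ x) (by linarith)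
  have := tendsto_integral_filter_of_dominated_convergence (μ := circleMeasure) (l := atTop)
    (F := fun τ x => heat s c τ x ^ (q - 2) * heat s (derivCoeff c) τ x ^ 2)
    (f := fun _ => 0)
    (fun _ => m ^ (q - 2) * (∑ n ∈ s, ‖derivCoeff c n‖) ^ 2)
    (.of_forall fun τ => ((continuous_rpow_of_pos (heat_hasCircleDeriv s c τ).continuous
      (heat_pos h τ) _).mul ((heat_hasCircleDeriv s _ τ).continuous.pow 2)).aestronglyMeasurable)
    (.of_forall fun τ => .of_forall fun x => ?_) (integrable_const _)
    (.of_forall fun x => ?_)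
  · rw [integral_zero] at this
    exact this
  · have h0 := Real.rpow_nonneg (heat_pos h τ x).le (q - 2)
    rw [Real.norm_eq_abs, abs_of_nonneg (mul_nonneg h0 (sq_nonneg _)), ← sq_abs (heat s _ τ x)]
    exact mul_le_mul (hb τ x) (pow_le_pow_left₀ (abs_nonneg _) (heat_abs_le _ _ _ _) 2)
      (sq_nonneg _) (h0.trans (hb τ x))
  · have h1 : Tendsto (fun τ => heat s (derivCoeff c) τ x) atTop (𝓝 0) := by
      simpa [derivCoeff] using heat_tendsto s (derivCoeff c) x
    have h2 : Tendsto (fun τ => m ^ (q - 2) * heat s (derivCoeff c) τ x ^ 2) atTop (𝓝 0) := by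
      simpa using (h1.pow 2).const_mul (m ^ (q - 2))
    refine squeeze_zero (fun τ => mul_nonneg (Real.rpow_nonneg (heat_pos h τ x).le _) (sq_nonneg _))
      (fun τ => mul_le_mul_of_nonneg_right (hb τ x) (sq_nonneg _)) h2

/-- A real function with nonpositive derivative on `[0, ∞)` and limit `0` is nonnegative there. -/
theorem nonneg_of_deriv_nonpos_of_tendsto {H H' : ℝ → ℝ} (h : ∀ τ, 0 ≤ τ → HasDerivAt H (H' τ) τ)
    (h' : ∀ τ, 0 ≤ τ → H' τ ≤ 0) (hl : Tendsto H atTop (𝓝 0)) {τ : ℝ} (hτ : 0 ≤ τ) : 0 ≤ H τ := by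
  have ha : AntitoneOn H (Set.Ici 0) := antitoneOn_of_hasDerivWithinAt_nonpos (convex_Ici 0)
    (fun x hx => (h x hx).continuousAt.continuousWithinAt)
    (fun x hx => (h x (interior_subset hx)).hasDerivWithinAt)
    (fun x hx => h' x (interior_subset hx))
  refine le_of_tendsto hl ?_
  filter_upwards [eventually_ge_atTop τ] with σ hσ
  exact ha hτ (hτ.trans hσ) hσ

/-- The entropy deficit, corrected by a multiple of the squared entropy, decreases along the flow to
`0`, hence is nonnegative at the start. The parameter `σ` linearizes the resulting quadratic
remainder: the inequality becomes affine in the integrals of `f ^ q` and the power of the mean, and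
can later be integrated over slices with one common `σ`. -/
theorem beckner_heat (h : ∀ x, 0 < heat s c 0 x) {q : ℝ} (hq : q ∈ Set.Ioc (1 : ℝ) 2) (σ : ℝ) :
    (1 + (2 - q) / (6 * (q - 1)) * σ)
        * (heatMass s c q 0 - (∫ x, heat s c 0 x ∂circleMeasure) ^ q)
      ≤ q * (q - 1) / 2 * heatFisher s c q 0
        + (2 - q) / (6 * (q - 1)) / 2 * σ ^ 2 * heatMass s c q 0 := by
  obtain ⟨hq1, hq2⟩ := hq
  set κ := (2 - q) / (6 * (q - 1)) with hκ
  have hq0 : 0 < q * (q - 1) := mul_pos (by linarith) (by linarith)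
  have hκ0 : 0 ≤ κ := div_nonneg (by linarith) (by linarith)
  have hκ1 : κ * (q * (q - 1)) = q * (2 - q) / 6 := by
    rw [hκ]
    have : q - 1 ≠ 0 := by linarith
    field_simp
  set Q := (∫ x, heat s c 0 x ∂circleMeasure) ^ q with hQ
  set W := heatFisher s c q with hW
  set M := heatMass s c q with hM
  have hMd : ∀ τ, HasDerivAt M (-(2 * τ * (q * (q - 1))) * W τ) τ := fun τ => hasDerivAt_heatMass h q τ
  have hMpos : ∀ τ, 0 < M τ := fun τ => heatMass_pos h q τ
  have hWnn : ∀ τ, 0 ≤ W τ := fun τ => heatFisher_nonneg h q τ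
  have hex : ∀ τ : ℝ, ∃ d, 0 ≤ τ → HasDerivAt W d τ ∧
      d ≤ -(2 * τ) * (2 * W τ + q * (2 - q) / 6 * (W τ ^ 2 / M τ)) := fun τ => by
    by_cases hτ : 0 ≤ τ
    · obtain ⟨d, hd⟩ := hasDerivAt_heatFisher h ⟨hq1, hq2⟩ hτ
      exact ⟨d, fun _ => hd⟩
    · exact ⟨0, fun h => absurd h hτ⟩
  choose W' hW' using hex
  have lM : Tendsto (fun τ => M τ - Q) atTop (𝓝 0) := by
    have := (tendsto_heatMass h (by linarith : 0 < q)).sub_const Q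
    rw [sub_self] at this
    exact this
  have lW : Tendsto W atTop (𝓝 0) := tendsto_heatFisher h hq2
  have hk6 : 0 ≤ q * (2 - q) / 6 := by
    rw [← hκ1]; exact mul_nonneg hκ0 hq0.le
  -- the linear inequality at every time
  have hE : ∀ τ, 0 ≤ τ → 0 ≤ q * (q - 1) / 2 * W τ - (M τ - Q) := fun τ hτ => by
    refine nonneg_of_deriv_nonpos_of_tendsto (H := fun τ => q * (q - 1) / 2 * W τ - (M τ - Q))
      (H' := fun τ => q * (q - 1) / 2 * W' τ - -(2 * τ * (q * (q - 1))) * W τ)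
      (fun τ hτ => ((hW' τ hτ).1.const_mul _).sub ((hMd τ).sub_const Q)) (fun τ hτ => ?_)
      (by simpa using (lW.const_mul (q * (q - 1) / 2)).sub lM) hτ
    have h1 := mul_le_mul_of_nonneg_left (hW' τ hτ).2 (by linarith : 0 ≤ q * (q - 1) / 2)
    have h2 : 0 ≤ q * (q - 1) / 2 * (2 * τ * (q * (2 - q) / 6 * (W τ ^ 2 / M τ))) :=
      mul_nonneg (by linarith) (mul_nonneg (by linarith) (mul_nonneg hk6
        (div_nonneg (sq_nonneg _) (hMpos τ).le)))
    linear_combination h1 + h2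
  have hanti : ∀ τ, 0 ≤ τ → M τ ≤ M 0 := fun τ hτ => by
    have ha : AntitoneOn M (Set.Ici 0) := antitoneOn_of_hasDerivWithinAt_nonpos (convex_Ici 0)
      (fun x _ => (hMd x).continuousAt.continuousWithinAt)
      (fun x _ => (hMd x).hasDerivWithinAt)
      (fun x hx => by
        have hx0 : 0 ≤ x := interior_subset hx
        have : 0 ≤ 2 * x * (q * (q - 1)) * W x :=
          mul_nonneg (mul_nonneg (by linarith) hq0.le) (hWnn x)
        linarith)
    exact ha (Set.self_mem_Ici) hτ hτ
  have hM0 := hMpos 0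
  have hM0' := hM0.ne'
  -- The new derivative term is at most a multiple of `W²`, by the linear inequality `hE` at time
  -- `τ`. The constant `κ` is chosen so that it is exactly absorbed by the dissipation, `κ q (q - 1)
  -- = q (2 - q) / 6`; the frozen denominator `M 0` is harmless since `M` decreases.
  have hG : 0 ≤ q * (q - 1) / 2 * W 0 - (M 0 - Q) - κ / 2 * ((M 0 - Q) ^ 2 / M 0) := by
    refine nonneg_of_deriv_nonpos_of_tendsto
      (H := fun τ => q * (q - 1) / 2 * W τ - (M τ - Q) - κ / 2 * ((M τ - Q) ^ 2 / M 0))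
      (H' := fun τ => q * (q - 1) / 2 * W' τ - -(2 * τ * (q * (q - 1))) * W τ
        - κ / 2 * (2 * (M τ - Q) * (-(2 * τ * (q * (q - 1))) * W τ) / M 0))
      (fun τ hτ => (((hW' τ hτ).1.const_mul _).sub ((hMd τ).sub_const Q)).sub
        ((((((hMd τ).sub_const Q).pow 2).div_const (M 0)).const_mul (κ / 2)).congr_deriv
          (by simp))) (fun τ hτ => ?_)
      (by simpa using ((lW.const_mul (q * (q - 1) / 2)).sub lM).sub
            (((lM.pow 2).div_const (M 0)).const_mul (κ / 2))) le_rfl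
    have h1 := mul_le_mul_of_nonneg_left (hW' τ hτ).2 (by linarith : 0 ≤ q * (q - 1) / 2)
    have h2 : W τ ^ 2 / M 0 ≤ W τ ^ 2 / M τ :=
      div_le_div_of_nonneg_left (sq_nonneg _) (hMpos τ) (hanti τ hτ)
    have h3 := mul_le_mul_of_nonneg_left h2
      (mul_nonneg (by linarith : 0 ≤ q * (q - 1) / 2) (mul_nonneg (by linarith : 0 ≤ 2 * τ) hk6))
    have h4 := mul_le_mul_of_nonneg_right (sub_nonneg.1 (hE τ hτ))
      (div_nonneg (mul_nonneg (mul_nonneg (mul_nonneg hκ0 (by linarith : 0 ≤ 2 * τ)) hq0.le)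
        (hWnn τ)) hM0.le)
    have e5 : q * (q - 1) / 2 * W τ * (κ * (2 * τ) * (q * (q - 1)) * W τ / M 0)
      = q * (q - 1) / 2 * (2 * τ * (q * (2 - q) / 6)) * (W τ ^ 2 / M 0) := by
      rw [← hκ1]; ring
    linear_combination h1 + h3 + h4 + e5
  -- Completing the square: `(M - Q)² / M ≥ 2σ (M - Q) - σ² M`.
  have h7 : 0 ≤ κ / 2 * ((M 0 - Q - σ * M 0) ^ 2 / M 0) :=
    mul_nonneg (by linarith) (div_nonneg (sq_nonneg _) hM0.le)
  have e7 : (M 0 - Q - σ * M 0) ^ 2 / M 0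
      = (M 0 - Q) ^ 2 / M 0 - 2 * σ * (M 0 - Q) + σ ^ 2 * M 0 := by
    field_simp
    ring
  rw [e7] at h7
  linear_combination hG + h7

end Flow

/-! ### The Beckner inequality on the circle -/

theorem exists_rep (x : S1) : ∃ t : ℝ, 0 ≤ t ∧ t ≤ 2 * Real.pi ∧ (t : S1) = x := by
  have := (AddCircle.equivIco (2 * Real.pi) 0 x).2
  refine ⟨AddCircle.equivIco (2 * Real.pi) 0 x, this.1, by linarith [this.2], ?_⟩
  exact (AddCircle.equivIco (2 * Real.pi) 0).symm_apply_apply x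

theorem HasCircleDeriv.abs_le {f f' : S1 → ℝ} (h : HasCircleDeriv f f') {C : ℝ}
    (hC : ∀ x, |f' x| ≤ C) (h0 : f 0 = 0) (x : S1) : |f x| ≤ C * (2 * Real.pi) := by
  obtain ⟨t, ht0, ht1, rfl⟩ := exists_rep x
  have h1 := Convex.norm_image_sub_le_of_norm_hasDerivWithin_le
    (f := fun t : ℝ => f (t : S1)) (f' := fun t : ℝ => f' (t : S1)) (s := Set.univ) (C := C) (x := 0)
    (y := t) (fun x _ => (h x).hasDerivWithinAt) (fun x _ => hC x) convex_univ trivial trivial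
  have e : f ((0 : ℝ) : S1) = 0 := h0
  rw [e, sub_zero, sub_zero, Real.norm_eq_abs, Real.norm_eq_abs, abs_of_nonneg ht0] at h1
  exact h1.trans (mul_le_mul_of_nonneg_left ht1 ((abs_nonneg _).trans (hC 0)))

/-- Approximate `f'` uniformly by a trigonometric polynomial, drop its small mean, integrate term by
term, and fix the constant of integration by matching the value at `0`. -/
theorem exists_heat_approx {f f' : S1 → ℝ} (h : HasCircleDeriv f f') (hf' : Continuous f') {ε : ℝ}
    (hε : 0 < ε) : ∃ s c, ∀ x, |heat s c 0 x - f x| ≤ ε ∧ |heat s (derivCoeff c) 0 x - f' x| ≤ ε := by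
  have hπ := Real.pi_gt_three
  -- Dropping the mean doubles the error to `2δ`, and integrating over a length at most `2π` gives
  -- `4πδ = ε`.
  set δ := ε / (4 * Real.pi) with hδ
  have hδ0 : 0 < δ := by positivity
  let F : C(S1, ℂ) := ⟨fun x => (f' x : ℂ), Complex.continuous_ofReal.comp hf'⟩
  have hF : F ∈ (Submodule.span ℂ (Set.range (@fourier (2 * Real.pi)))).topologicalClosure := by
    rw [span_fourier_closure_eq_top]; trivial
  obtain ⟨P, hP, hd⟩ := Metric.mem_closure_iff.1 hF δ hδ0
  obtain ⟨l, rfl⟩ := Finsupp.mem_span_range_iff_exists_finsupp.1 hP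
  have hsum : ∀ x, (l.sum fun n a => a • (fourier n : C(S1, ℂ))) x
      = ∑ n ∈ l.support, l n * (fourier n x : ℂ) := fun x => by
    rw [Finsupp.sum, ContinuousMap.sum_apply]
    rfl
  have hdx : ∀ x, ‖(f' x : ℂ) - ∑ n ∈ l.support, l n * (fourier n x : ℂ)‖ ≤ δ := fun x => by
    have h1 := (ContinuousMap.dist_apply_le_dist (f := F) x).trans hd.le
    rw [dist_eq_norm, hsum] at h1
    exact h1
  have hmean : ∫ x : S1, ∑ n ∈ l.support, l n * (fourier n x : ℂ) ∂circleMeasure = l 0 := by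
    have hi : ∀ n ∈ l.support, Integrable (fun x : S1 => l n * (fourier n x : ℂ)) circleMeasure :=
      fun n _ => integrable_of_continuous (continuous_const.mul (continuous_fourier n))
    rw [integral_finsetSum _ hi]
    simp only [integral_const_mul, integral_fourier, mul_ite, mul_one, mul_zero,
      Finset.sum_ite_eq', Finsupp.mem_support_iff, ne_eq, ite_not]
    split_ifs with h0
    · exact h0.symm
    · rfl
  have hl0 : ‖l 0‖ ≤ δ := by
    have i1 : Integrable (fun x => (f' x : ℂ)) circleMeasure :=
      integrable_of_continuous (Complex.continuous_ofReal.comp hf')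
    have i2 : Integrable (fun x : S1 => ∑ n ∈ l.support, l n * (fourier n x : ℂ)) circleMeasure :=
      integrable_of_continuous (continuous_finsetSum _ fun n _ =>
        continuous_const.mul (continuous_fourier n))
    have h1 := integral_sub i1 i2
    have h2 : ∫ x, (f' x : ℂ) ∂circleMeasure = 0 := by
      rw [integral_complex_ofReal, h.integral_eq_zero hf']; rfl
    rw [hmean, h2, zero_sub] at h1
    have h3 := norm_integral_le_of_norm_le_const (μ := circleMeasure) (.of_forall hdx)
    rw [h1, norm_neg] at h3
    simpa using h3
  set s := insert 0 l.support with hs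
  let c1 : ℤ → ℂ := fun n => if n = 0 then 0 else l n / (Complex.I * n)
  let c : ℤ → ℂ := fun n => if n = 0 then ((f 0 - heat s c1 0 0 : ℝ) : ℂ) else l n / (Complex.I * n)
  have hc : ∀ x, heat s c 0 x = heat s c1 0 x + (f 0 - heat s c1 0 0) := fun x => by
    have e : ∀ n ∈ s, c n * (Real.exp (-((n : ℝ) ^ 2 * (0 : ℝ) ^ 2)) : ℂ) * (fourier n x : ℂ)
        = c1 n * (Real.exp (-((n : ℝ) ^ 2 * (0 : ℝ) ^ 2)) : ℂ) * (fourier n x : ℂ)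
          + if n = 0 then ((f 0 - heat s c1 0 0 : ℝ) : ℂ) else 0 := fun n _ => by
      by_cases hn : n = 0
      · subst hn
        simp [c, c1]
      · simp [c, c1, hn]
    have h0 : (0 : ℤ) ∈ s := Finset.mem_insert_self _ _
    rw [heat, Finset.sum_congr rfl e, Finset.sum_add_distrib, Finset.sum_ite_eq', if_pos h0,
      Complex.add_re, Complex.ofReal_re]
    rfl
  have hcd : ∀ n, derivCoeff c n = if n = 0 then 0 else l n := fun n => by
    by_cases hn : n = 0
    · simp [derivCoeff, hn]
    · have : (n : ℂ) ≠ 0 := by exact_mod_cast hn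
      simp only [derivCoeff, c, hn, if_false]
      field_simp [Complex.I_ne_zero]
  have hd2 : ∀ x, heat s (derivCoeff c) 0 x
      = (∑ n ∈ l.support, l n * (fourier n x : ℂ) - l 0).re := fun x => by
    rw [heat]
    congr 1
    have e : ∀ n ∈ s, derivCoeff c n * (Real.exp (-((n : ℝ) ^ 2 * (0 : ℝ) ^ 2)) : ℂ)
        * (fourier n x : ℂ) = l n * (fourier n x : ℂ) - if n = 0 then l 0 else 0 := fun n _ => by
      rw [hcd]
      by_cases hn : n = 0
      · subst hn
        simp
      · simp [hn]
    have h0 : (0 : ℤ) ∈ s := Finset.mem_insert_self _ _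
    rw [Finset.sum_congr rfl e, Finset.sum_sub_distrib, Finset.sum_ite_eq', if_pos h0, hs,
      Finset.sum_insert_of_eq_zero_if_notMem]
    intro h
    rw [Finsupp.notMem_support_iff.1 h, zero_mul]
  have hd3 : ∀ x, |heat s (derivCoeff c) 0 x - f' x| ≤ 2 * δ := fun x => by
    rw [hd2]
    have e : (∑ n ∈ l.support, l n * (fourier n x : ℂ) - l 0).re - f' x
        = -((f' x : ℂ) - ∑ n ∈ l.support, l n * (fourier n x : ℂ) + l 0).re := by
      simp
      ring
    rw [e, abs_neg]
    refine (Complex.abs_re_le_norm _).trans ((norm_add_le _ _).trans ?_)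
    linarith [hdx x]
  refine ⟨s, c, fun x => ⟨?_, (hd3 x).trans ?_⟩⟩
  · have h1 : HasCircleDeriv (fun x => heat s c 0 x - f x) fun x => heat s (derivCoeff c) 0 x - f' x :=
      fun t => (heat_hasCircleDeriv s c 0 t).sub (h t)
    refine (h1.abs_le hd3 ?_ x).trans_eq ?_
    · simp only [hc]; ring
    · rw [hδ]; field_simp; ring
  · rw [hδ, ← mul_div_assoc, div_le_iff₀ (by positivity)]
    nlinarith

theorem tendsto_integral_of_bounded {X : Type*} [TopologicalSpace X] [CompactSpace X]
    [MeasurableSpace X] [OpensMeasurableSpace X] {m : Measure X} [IsFiniteMeasure m]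
    {F : ℕ → X → ℝ} {f : X → ℝ} {C : ℝ} (hF : ∀ n, Continuous (F n)) (hC : ∀ n x, |F n x| ≤ C)
    (h : ∀ x, Tendsto (fun n => F n x) atTop (𝓝 (f x))) :
    Tendsto (fun n => ∫ x, F n x ∂m) atTop (𝓝 (∫ x, f x ∂m)) :=
  tendsto_integral_of_dominated_convergence (fun _ => C) (fun n => (hF n).aestronglyMeasurable)
    (integrable_const _) (fun n => .of_forall (hC n)) (.of_forall h)

theorem beckner_rpow {f f' : S1 → ℝ} (h : HasCircleDeriv f f') (hf' : Continuous f')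
    (hf : ∀ x, 0 < f x) {q : ℝ} (hq : q ∈ Set.Ioc (1 : ℝ) 2) (σ : ℝ) :
    (1 + (2 - q) / (6 * (q - 1)) * σ)
        * (∫ x, f x ^ q ∂circleMeasure - (∫ x, f x ∂circleMeasure) ^ q)
      ≤ q * (q - 1) / 2 * ∫ x, f x ^ (q - 2) * f' x ^ 2 ∂circleMeasure
        + (2 - q) / (6 * (q - 1)) / 2 * σ ^ 2 * ∫ x, f x ^ q ∂circleMeasure := by
  obtain ⟨m, hm, hm'⟩ := exists_pos_lower_bound h.continuous hf
  obtain ⟨C, hC⟩ := isCompact_univ.exists_bound_of_continuousOn h.continuous.continuousOn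
  obtain ⟨C', hC'⟩ := isCompact_univ.exists_bound_of_continuousOn hf'.continuousOn
  have hε : ∀ n : ℕ, 0 < m / 2 * (1 / ((n : ℝ) + 1)) := fun n => by positivity
  have hε1 : ∀ n : ℕ, m / 2 * (1 / ((n : ℝ) + 1)) ≤ m / 2 := fun n => by
    refine mul_le_of_le_one_right (by linarith) ?_
    rw [div_le_one (by positivity)]
    linarith [(Nat.cast_nonneg n : (0 : ℝ) ≤ n)]
  have hε2 : Tendsto (fun n : ℕ => m / 2 * (1 / ((n : ℝ) + 1))) atTop (𝓝 0) := by
    simpa using tendsto_one_div_add_atTop_nhds_zero_nat.const_mul (m / 2)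
  choose s c hsc using fun n => exists_heat_approx h hf' (hε n)
  have l0 : ∀ x, Tendsto (fun n => heat (s n) (c n) 0 x) atTop (𝓝 (f x)) := fun x =>
    tendsto_iff_dist_tendsto_zero.2 (squeeze_zero (fun _ => dist_nonneg)
      (fun n => (hsc n x).1) hε2)
  have l1 : ∀ x, Tendsto (fun n => heat (s n) (derivCoeff (c n)) 0 x) atTop (𝓝 (f' x)) := fun x =>
    tendsto_iff_dist_tendsto_zero.2 (squeeze_zero (fun _ => dist_nonneg)
      (fun n => (hsc n x).2) hε2)
  have hlow : ∀ n x, m / 2 ≤ heat (s n) (c n) 0 x := fun n x => by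
    have := (abs_le.1 (hsc n x).1).1
    linarith [hm' x, hε1 n]
  have hup : ∀ n x, heat (s n) (c n) 0 x ≤ C + m / 2 := fun n x => by
    have := (abs_le.1 (hsc n x).1).2
    linarith [le_of_abs_le (hC x trivial), hε1 n]
  have hup' : ∀ n x, |heat (s n) (derivCoeff (c n)) 0 x| ≤ C' + m / 2 := fun n x => by
    have h1 := abs_sub_abs_le_abs_sub (heat (s n) (derivCoeff (c n)) 0 x) (f' x)
    have h2 : |f' x| ≤ C' := hC' x trivial
    linarith [(hsc n x).2, hε1 n]
  have hpos : ∀ n x, 0 < heat (s n) (c n) 0 x := fun n x => by linarith [hlow n x]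
  have cont := fun n => (heat_hasCircleDeriv (s n) (c n) 0).continuous
  have cont' := fun n => (heat_hasCircleDeriv (s n) (derivCoeff (c n)) 0).continuous
  have L0 := tendsto_integral_of_bounded (m := circleMeasure) cont
    (fun n x => (abs_of_pos (hpos n x)).le.trans (hup n x)) l0
  have Lq := tendsto_integral_of_bounded (m := circleMeasure)
    (fun n => continuous_rpow_of_pos (cont n) (hpos n) q)
    (C := (C + m / 2) ^ q) (fun n x => by
      rw [abs_of_nonneg (Real.rpow_nonneg (hpos n x).le _)]
      exact Real.rpow_le_rpow (hpos n x).le (hup n x) (by linarith [hq.1]))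
    (fun x => (l0 x).rpow_const (.inl (hf x).ne'))
  have Lw := tendsto_integral_of_bounded (m := circleMeasure)
    (F := fun n x => heat (s n) (c n) 0 x ^ (q - 2) * heat (s n) (derivCoeff (c n)) 0 x ^ 2)
    (fun n => (continuous_rpow_of_pos (cont n) (hpos n) (q - 2)).mul ((cont' n).pow 2))
    (C := (m / 2) ^ (q - 2) * (C' + m / 2) ^ 2) (fun n x => by
      have h0 := Real.rpow_nonneg (hpos n x).le (q - 2)
      have h1 := Real.rpow_le_rpow_of_nonpos (by linarith) (hlow n x) (by linarith [hq.2] : q - 2 ≤ 0)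
      rw [abs_of_nonneg (mul_nonneg h0 (sq_nonneg _)), ← sq_abs (heat _ _ _ x)]
      exact mul_le_mul h1 (pow_le_pow_left₀ (abs_nonneg _) (hup' n x) 2) (sq_nonneg _) (h0.trans h1))
    (fun x => ((l0 x).rpow_const (.inl (hf x).ne')).mul ((l1 x).pow 2))
  refine le_of_tendsto_of_tendsto'
    ((Lq.sub (L0.rpow_const (p := q) (.inr (by linarith [hq.1])))).const_mul _)
    ((Lw.const_mul _).add (Lq.const_mul _)) fun n => ?_
  exact beckner_heat (hpos n) hq σ

/-- The constant in front of the quadratic remainder term of the improved Beckner inequality. -/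
noncomputable def remainderConst (p : ℝ) : ℝ := (p - 1) / (3 * (2 - p))

theorem remainderConst_nonneg {p : ℝ} (hp : p ∈ Set.Ico (1 : ℝ) 2) : 0 ≤ remainderConst p :=
  div_nonneg (by linarith [hp.1]) (by linarith [hp.2])

theorem remainderConst_pos {p : ℝ} (hp : p ∈ Set.Ico (1 : ℝ) 2) (h : p ≠ 1) :
    0 < remainderConst p :=
  div_pos (by have := lt_of_le_of_ne hp.1 h.symm; linarith) (by linarith [hp.2])

/-- Substitute `f = u ^ p` and `q = 2 / p`: the weight cancels, and the Dirichlet integral becomes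
`p² ∫ u'²`. -/
theorem beckner_of_pos {u u' : S1 → ℝ} (h : HasCircleDeriv u u') (hu' : Continuous u')
    (hu : ∀ x, 0 < u x) {p : ℝ} (hp : p ∈ Set.Ico (1 : ℝ) 2) (σ : ℝ) :
    (1 + remainderConst p * σ)
        * (∫ x, u x ^ 2 ∂circleMeasure - (∫ x, u x ^ p ∂circleMeasure) ^ (2 / p))
      ≤ (2 - p) * ∫ x, u' x ^ 2 ∂circleMeasure
        + remainderConst p / 2 * σ ^ 2 * ∫ x, u x ^ 2 ∂circleMeasure := by
  obtain ⟨hp1, hp2⟩ := hp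
  have hp0 : p ≠ 0 := by linarith
  have hp3 : 2 - p ≠ 0 := by linarith
  have hb := beckner_rpow (h.rpow hu p)
    ((continuous_const.mul (continuous_rpow_of_pos h.continuous hu _)).mul hu')
    (fun x => Real.rpow_pos_of_pos (hu x) p) (q := 2 / p)
    ⟨by rw [lt_div_iff₀ (by linarith)]; linarith, by rw [div_le_iff₀ (by linarith)]; linarith⟩ σ
  have e1 : ∀ x, (u x ^ p) ^ (2 / p) = u x ^ 2 := fun x => by
    rw [← Real.rpow_mul (hu x).le, mul_div_cancel₀ _ hp0]; exact Real.rpow_two _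
  have e2 : ∀ x, (u x ^ p) ^ (2 / p - 2) * (p * u x ^ (p - 1) * u' x) ^ 2 = p ^ 2 * u' x ^ 2 :=
    fun x => by
    have : (u x ^ p) ^ (2 / p - 2) * (u x ^ (p - 1)) ^ 2 = 1 := by
      rw [← Real.rpow_mul (hu x).le, ← Real.rpow_natCast, ← Real.rpow_mul (hu x).le,
        ← Real.rpow_add (hu x)]
      have e0 : p * (2 / p - 2) + (p - 1) * ((2 : ℕ) : ℝ) = 0 := by
        push_cast
        field_simp
        ring
      rw [e0, Real.rpow_zero]
    linear_combination p ^ 2 * u' x ^ 2 * this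
  have e3 : (2 - 2 / p) / (6 * (2 / p - 1)) = remainderConst p := by
    have : 2 / p - 1 = (2 - p) / p := by field_simp
    rw [this, remainderConst]
    field_simp
    ring
  have e4 : 2 / p * (2 / p - 1) / 2 * p ^ 2 = 2 - p := by
    field_simp
  simp only [e1, e2, e3, integral_const_mul] at hb
  rw [← mul_assoc, e4] at hb
  exact hb

/-- Apply the positive case to `√(|ψ|² + ε²)`, whose derivative is bounded by `|ψ'|`, and let `ε →
0`. -/
theorem beckner {ψ ψ' : S1 → ℂ} (h : HasCircleDeriv ψ ψ') (hψ' : Continuous ψ') {p : ℝ}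
    (hp : p ∈ Set.Ico (1 : ℝ) 2) (σ : ℝ) :
    (1 + remainderConst p * σ)
        * (∫ x, ‖ψ x‖ ^ 2 ∂circleMeasure - lpNormSq circleMeasure p ψ)
      ≤ (2 - p) * ∫ x, ‖ψ' x‖ ^ 2 ∂circleMeasure
        + remainderConst p / 2 * σ ^ 2 * ∫ x, ‖ψ x‖ ^ 2 ∂circleMeasure := by
  let N : ℝ → S1 → ℝ := fun ε x => (ψ x).re * (ψ x).re + (ψ x).im * (ψ x).im + ε ^ 2
  have hN : ∀ ε x, N ε x = ‖ψ x‖ ^ 2 + ε ^ 2 := fun ε x => by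
    simp only [N]; rw [Complex.sq_norm, Complex.normSq_apply]
  have hNpos : ∀ ε : ℝ, 0 < ε → ∀ x, 0 < N ε x := fun ε hε x => by rw [hN]; positivity
  have hre : HasCircleDeriv (fun x => (ψ x).re) fun x => (ψ' x).re := h.re
  have him : HasCircleDeriv (fun x => (ψ x).im) fun x => (ψ' x).im := fun t =>
    Complex.imCLM.hasFDerivAt.comp_hasDerivAt t (h t)
  have hNd : ∀ ε, HasCircleDeriv (N ε)
      fun x => 2 * ((ψ x).re * (ψ' x).re + (ψ x).im * (ψ' x).im) := fun ε t =>
    (((hre.mul hre t).add (him.mul him t)).add_const (ε ^ 2)).congr_deriv (by ring)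
  have cψ := h.continuous
  obtain ⟨C, hC⟩ := isCompact_univ.exists_bound_of_continuousOn cψ.continuousOn
  let e : ℕ → ℝ := fun n => 1 / ((n : ℝ) + 1)
  have he : ∀ n, 0 < e n := fun n => by positivity
  have he1 : ∀ n, e n ≤ 1 := fun n => by
    simp only [e]
    rw [div_le_one (by positivity)]
    linarith [(Nat.cast_nonneg n : (0 : ℝ) ≤ n)]
  have he0 : Tendsto e atTop (𝓝 0) := tendsto_one_div_add_atTop_nhds_zero_nat
  have hl : ∀ x, Tendsto (fun n => N (e n) x) atTop (𝓝 (‖ψ x‖ ^ 2)) := fun x => by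
    simp only [hN]
    simpa using (he0.pow 2).const_add (‖ψ x‖ ^ 2)
  have hb : ∀ n x, N (e n) x ≤ C ^ 2 + 1 := fun n x => by
    rw [hN]
    have h1 := pow_le_pow_left₀ (norm_nonneg _) (hC x trivial) 2
    have h2 := pow_le_one₀ (n := 2) (he n).le (he1 n)
    linarith
  have hp0 : 0 < p := by linarith [hp.1]
  have L2 := tendsto_integral_of_bounded (m := circleMeasure) (fun n => (hNd (e n)).continuous)
    (fun n x => (abs_of_pos (hNpos _ (he n) x)).le.trans (hb n x)) hl
  have Lp := tendsto_integral_of_bounded (m := circleMeasure)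
    (fun n => continuous_rpow_of_pos (hNd (e n)).continuous (hNpos _ (he n)) (p / 2))
    (C := (C ^ 2 + 1) ^ (p / 2)) (fun n x => by
      rw [abs_of_nonneg (Real.rpow_nonneg (hNpos _ (he n) x).le _)]
      exact Real.rpow_le_rpow (hNpos _ (he n) x).le (hb n x) (by linarith))
    (fun x => (hl x).rpow_const (.inr (by linarith)))
  have ep : ∀ x, (‖ψ x‖ ^ 2) ^ (p / 2) = ‖ψ x‖ ^ p := fun x => by
    rw [← Real.rpow_natCast, ← Real.rpow_mul (norm_nonneg _)]; congr 1; push_cast; ring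
  simp only [ep] at Lp
  refine le_of_tendsto_of_tendsto'
    ((L2.sub (Lp.rpow_const (p := 2 / p) (.inr (by positivity)))).const_mul _)
    ((L2.const_mul _).const_add _) fun n => ?_
  have hNp := hNpos _ (he n)
  have hbk := beckner_of_pos ((hNd (e n)).rpow hNp (1 / 2))
    (by have := continuous_rpow_of_pos (hNd (e n)).continuous hNp (1 / 2 - 1); fun_prop)
    (fun x => Real.rpow_pos_of_pos (hNp x) _) hp σ
  have e1 : ∀ x, (N (e n) x ^ (1 / 2 : ℝ)) ^ 2 = N (e n) x := fun x => by
    rw [← Real.sqrt_eq_rpow, Real.sq_sqrt (hNp x).le]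
  have e2 : ∀ x, (N (e n) x ^ (1 / 2 : ℝ)) ^ p = N (e n) x ^ (p / 2) := fun x => by
    rw [← Real.rpow_mul (hNp x).le]; congr 1; ring
  simp only [e1, e2] at hbk
  refine hbk.trans (add_le_add_left (mul_le_mul_of_nonneg_left ?_ (by linarith [hp.2])) _)
  refine integral_mono (integrable_of_continuous
    (by have := continuous_rpow_of_pos (hNd (e n)).continuous hNp (1 / 2 - 1); fun_prop))
    (integrable_of_continuous (by fun_prop)) fun x => ?_
  have e3 : (N (e n) x ^ (1 / 2 - 1 : ℝ)) ^ 2 = (N (e n) x)⁻¹ := by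
    rw [← Real.rpow_natCast, ← Real.rpow_mul (hNp x).le, ← Real.rpow_neg_one]
    congr 1; norm_num
  have e4 : (1 / 2 * N (e n) x ^ (1 / 2 - 1 : ℝ) *
      (2 * ((ψ x).re * (ψ' x).re + (ψ x).im * (ψ' x).im))) ^ 2
      = (N (e n) x)⁻¹ * ((ψ x).re * (ψ' x).re + (ψ x).im * (ψ' x).im) ^ 2 := by
    rw [← e3]; ring
  simp only
  rw [e4, inv_mul_le_iff₀ (hNp x), Complex.sq_norm, Complex.normSq_apply]
  simp only [N]
  -- Lagrange's identity: what is dropped from `|ψ|² |ψ'|²` is the square of the imaginary part of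
  -- `ψ' ψ̄`.
  nlinarith [sq_nonneg ((ψ x).re * (ψ' x).im - (ψ x).im * (ψ' x).re), sq_nonneg (e n * (ψ' x).re),
    sq_nonneg (e n * (ψ' x).im)]

/-! ### Phases of nonvanishing functions on the circle -/

theorem coe_two_pi : ((2 * Real.pi : ℝ) : S1) = 0 := AddCircle.coe_period _

theorem exists_hasCircleDeriv {g : S1 → ℝ} (hg : Continuous g) (h0 : ∫ x, g x ∂circleMeasure = 0) :
    ∃ G, HasCircleDeriv G g := by
  have hc : Continuous fun t : ℝ => g (t : S1) := continuous_circle_iff.1 hg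
  let L : ℝ → ℝ := fun t => ∫ s in (0 : ℝ)..t, g (s : S1)
  have hd : ∀ t : ℝ, HasDerivAt L (g (t : S1)) t := fun t =>
    intervalIntegral.integral_hasDerivAt_right (hc.intervalIntegrable _ _)
      (hc.stronglyMeasurableAtFilter _ _) hc.continuousAt
  have hP : Function.Periodic L (2 * Real.pi) := fun t => by
    have h1 : Function.Periodic (fun t : ℝ => g (t : S1)) (2 * Real.pi) := fun t => by
      simp only [AddCircle.coe_add, coe_two_pi, add_zero]
    have h2 := h1.intervalIntegral_add_eq 0 t
    rw [integral_circle_eq, smul_eq_zero] at h0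
    have h3 := h0.resolve_left (by positivity)
    rw [zero_add] at h2
    have h4 := intervalIntegral.integral_add_adjacent_intervals
      (hc.intervalIntegrable (μ := volume) 0 t) (hc.intervalIntegrable (μ := volume) t (t + 2 * Real.pi))
    rw [← h2, h3, add_zero] at h4
    exact h4.symm
  exact ⟨hP.lift, fun t => hd t⟩

/-- The winding number. With `L` a primitive of `ψ' / ψ` along the real line, `ψ exp(-L)` is
constant, so periodicity of `ψ` forces `exp(-L(2π)) = 1`. -/
theorem exists_integral_logDeriv_eq_int {ψ ψ' : S1 → ℂ} (h : HasCircleDeriv ψ ψ')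
    (hψ' : Continuous ψ') (h0 : ∀ x, ψ x ≠ 0) :
    ∃ k : ℤ, ∫ x, (ψ' x / ψ x).im ∂circleMeasure = k := by
  have hq : Continuous fun x => ψ' x / ψ x := hψ'.div h.continuous h0
  have hc : Continuous fun t : ℝ => ψ' (t : S1) / ψ (t : S1) := continuous_circle_iff.1 hq
  let L : ℝ → ℂ := fun t => ∫ s in (0 : ℝ)..t, ψ' (s : S1) / ψ (s : S1)
  have hd : ∀ t : ℝ, HasDerivAt L (ψ' (t : S1) / ψ (t : S1)) t := fun t =>
    intervalIntegral.integral_hasDerivAt_right (hc.intervalIntegrable _ _)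
      (hc.stronglyMeasurableAtFilter _ _) hc.continuousAt
  have hK : ∀ t : ℝ, HasDerivAt (fun t : ℝ => ψ (t : S1) * Complex.exp (-L t)) 0 t := fun t =>
    ((h t).mul (hd t).neg.cexp).congr_deriv (by
      have := h0 (t : S1)
      simp only [Pi.neg_apply]
      field_simp
      ring)
  have h1 := is_const_of_deriv_eq_zero (fun t => (hK t).differentiableAt) (fun t => (hK t).deriv)
    (2 * Real.pi) 0
  have hL0 : L 0 = 0 := intervalIntegral.integral_same
  simp only [hL0, neg_zero, Complex.exp_zero, mul_one, coe_two_pi] at h1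
  have h2 : Complex.exp (-L (2 * Real.pi)) = 1 := by
    have e : ((0 : ℝ) : S1) = 0 := rfl
    rw [e] at h1
    exact mul_left_cancel₀ (h0 0) (h1.trans (mul_one _).symm)
  obtain ⟨n, hn⟩ := Complex.exp_eq_one_iff.1 h2
  refine ⟨-n, ?_⟩
  have h3 := integral_im (integrable_of_continuous (m := circleMeasure) hq)
  refine h3.trans ?_
  rw [integral_circle_eq]
  have h4 : L (2 * Real.pi) = -(n * (2 * Real.pi * Complex.I)) := by rw [← hn, neg_neg]
  change ((2 * Real.pi)⁻¹ • L (2 * Real.pi)).im = _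
  rw [h4, Complex.real_smul]
  have e : (((2 * Real.pi)⁻¹ : ℝ) : ℂ) * -(n * (2 * Real.pi * Complex.I)) = ((-n : ℤ) : ℂ) * Complex.I := by
    have : (Real.pi : ℂ) ≠ 0 := by exact_mod_cast Real.pi_ne_zero
    push_cast
    field_simp
  rw [e]
  simp

/-- The diamagnetic estimate: the magnetic energy of a nonvanishing function dominates a combination
of the energy of its modulus and of the half-flux energy of a function with the same modulus. -/
theorem exists_phase {ψ ψ' : S1 → ℂ} (h : HasCircleDeriv ψ ψ') (hψ' : Continuous ψ')
    (h0 : ∀ x, ψ x ≠ 0) {a : ℝ} (ha : a ∈ Set.Icc (0 : ℝ) (1 / 2)) :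
    ∃ (u' : S1 → ℝ) (w w' : S1 → ℂ), HasCircleDeriv (fun x => ‖ψ x‖) u' ∧ Continuous u' ∧
      HasCircleDeriv w w' ∧ Continuous w' ∧ (∀ x, ‖w x‖ = ‖ψ x‖) ∧
      (1 - 4 * a ^ 2) * ∫ x, u' x ^ 2 ∂circleMeasure
        + 4 * a ^ 2 * ∫ x, ‖w' x - Complex.I * ((1 / 2 : ℝ) : ℂ) * w x‖ ^ 2 ∂circleMeasure
        ≤ ∫ x, ‖ψ' x - Complex.I * (a : ℂ) * ψ x‖ ^ 2 ∂circleMeasure := by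
  obtain ⟨k, hk⟩ := exists_integral_logDeriv_eq_int h hψ' h0
  have hre : HasCircleDeriv (fun x => (ψ x).re) fun x => (ψ' x).re := h.re
  have him : HasCircleDeriv (fun x => (ψ x).im) fun x => (ψ' x).im := fun t =>
    Complex.imCLM.hasFDerivAt.comp_hasDerivAt t (h t)
  have hpos : ∀ x, 0 < ‖ψ x‖ := fun x => norm_pos_iff.2 (h0 x)
  have hN : ∀ x, ‖ψ x‖ ^ 2 = (ψ x).re * (ψ x).re + (ψ x).im * (ψ x).im := fun x => by
    rw [Complex.sq_norm, Complex.normSq_apply]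
  have cψ := h.continuous
  have cn : Continuous fun x => ‖ψ x‖ := cψ.norm
  set u : S1 → ℝ := fun x => ‖ψ x‖ with hu
  set u' : S1 → ℝ := fun x => ((ψ x).re * (ψ' x).re + (ψ x).im * (ψ' x).im) / ‖ψ x‖ with hu'
  set η : S1 → ℝ := fun x => (ψ' x / ψ x).im with hη
  have cu' : Continuous u' := by
    refine Continuous.div (by fun_prop) cn fun x => (hpos x).ne'
  have cη : Continuous η := Complex.continuous_im.comp (hψ'.div cψ h0)
  have hηN : ∀ x, η x * ‖ψ x‖ ^ 2 = (ψ x).re * (ψ' x).im - (ψ x).im * (ψ' x).re := fun x => by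
    have : Complex.normSq (ψ x) ≠ 0 := fun h => h0 x (Complex.normSq_eq_zero.1 h)
    rw [hη, Complex.sq_norm]
    simp only [Complex.div_im]
    field_simp
  have hu'N : ∀ x, u' x * ‖ψ x‖ = (ψ x).re * (ψ' x).re + (ψ x).im * (ψ' x).im := fun x =>
    div_mul_cancel₀ _ (hpos x).ne'
  have hdu : HasCircleDeriv u u' := fun t => by
    have h1 := ((hre.mul hre t).add (him.mul him t)).sqrt
      (by have := hN (t : S1); have := hpos (t : S1); simp only [Pi.add_apply]; rw [← hN]; positivity)
    have e : ∀ x : S1, Real.sqrt ((ψ x).re * (ψ x).re + (ψ x).im * (ψ x).im) = ‖ψ x‖ := fun x => by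
      rw [← hN, Real.sqrt_sq (norm_nonneg _)]
    simp only [Pi.add_apply, e] at h1
    have e2 : (fun t : ℝ => u (t : S1)) = fun t : ℝ => Real.sqrt (((fun t : ℝ => (ψ (t : S1)).re * (ψ (t : S1)).re)
        + fun t : ℝ => (ψ (t : S1)).im * (ψ (t : S1)).im) t) := by
      funext t
      simp only [Pi.add_apply, e, hu]
    rw [e2]
    refine h1.congr_deriv ?_
    simp only [hu']
    ring
  -- Polar decomposition of the energy density: `η` is the derivative of the phase.
  have key : ∀ x, ‖ψ' x - Complex.I * (a : ℂ) * ψ x‖ ^ 2 = u' x ^ 2 + (u x * (η x - a)) ^ 2 :=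
    fun x => by
    have h1 := hpos x
    have h2 := hηN x
    have h3 := hu'N x
    have h4 := hN x
    have e1 : ‖ψ' x - Complex.I * (a : ℂ) * ψ x‖ ^ 2
        = ((ψ' x).re + a * (ψ x).im) ^ 2 + ((ψ' x).im - a * (ψ x).re) ^ 2 := by
      rw [Complex.sq_norm, Complex.normSq_apply]
      simp
      ring
    rw [e1]
    have hne : ‖ψ x‖ ^ 2 ≠ 0 := by positivity
    refine mul_left_cancel₀ hne ?_
    have e2 : ‖ψ x‖ ^ 2 * (u' x ^ 2 + (u x * (η x - a)) ^ 2)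
        = (u' x * ‖ψ x‖) ^ 2 + (η x * ‖ψ x‖ ^ 2 - a * ‖ψ x‖ ^ 2) ^ 2 := by
      simp only [hu]; ring
    rw [e2, h2, h3, h4]
    ring
  have cu : Continuous u := cn
  have cinv : Continuous fun x => (u x)⁻¹ := cu.inv₀ fun x => (hpos x).ne'
  set S := ∫ x, (u x)⁻¹ ^ 2 ∂circleMeasure with hS
  have hSpos : 0 < S := by
    obtain ⟨m, hm, hm'⟩ := exists_pos_lower_bound (cinv.pow 2)
      fun x => pow_pos (inv_pos.2 (hpos x)) 2
    refine hm.trans_le ?_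
    calc m = ∫ _, m ∂circleMeasure := by simp
      _ ≤ _ := integral_mono (integrable_const _) (integrable_of_continuous (cinv.pow 2)) hm'
  have hcs := sq_integral_le (f := fun x => u x * (η x - a)) (g := fun x => (u x)⁻¹)
    (by fun_prop) cinv
  have e3 : ∀ x, u x * (η x - a) * (u x)⁻¹ = η x - a := fun x => by
    have := (hpos x).ne'
    simp only [hu]
    field_simp
  simp only [e3] at hcs
  rw [integral_sub (integrable_of_continuous cη) (integrable_const _), hk] at hcs
  simp only [integral_const, probReal_univ, one_smul] at hcs
  -- Zero is an integer closest to `a`; this is where `0 ≤ a ≤ 1/2` enters.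
  have hka : a ^ 2 ≤ ((k : ℝ) - a) ^ 2 := by
    obtain ⟨ha0, ha1⟩ := ha
    rcases le_or_gt k 0 with hk0 | hk0
    · have : (k : ℝ) ≤ 0 := by exact_mod_cast hk0
      nlinarith
    · have : (1 : ℝ) ≤ k := by exact_mod_cast hk0
      nlinarith
  have hA : a ^ 2 / S ≤ ∫ x, (u x * (η x - a)) ^ 2 ∂circleMeasure := by
    rw [div_le_iff₀ hSpos]
    exact hka.trans hcs
  -- Equality in Cauchy–Schwarz requires a phase velocity relative to the flux proportional to
  -- `u⁻²`. At flux `1/2` and winding number `0` the phase velocity is `1/2 - c u⁻²`, and mean zero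
  -- forces `c S = 1/2`. The resulting energy excess is `c² S = 1 / (4S)`, and `4a²` times this is
  -- the bound `a² / S` found for `ψ`.
  set c := 1 / (2 * S) with hc
  obtain ⟨θ, hθ⟩ := exists_hasCircleDeriv (g := fun x => 1 / 2 - c * (u x)⁻¹ ^ 2) (by fun_prop) (by
    rw [integral_sub (integrable_const _) (integrable_of_continuous (by fun_prop)),
      integral_const_mul, ← hS, hc]
    simp only [integral_const, probReal_univ, one_smul]
    field_simp
    ring)
  have cθ := hθ.continuous
  let w : S1 → ℂ := fun x => (u x : ℂ) * Complex.exp (Complex.I * (θ x : ℂ))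
  let w' : S1 → ℂ := fun x => ((u' x : ℂ) + Complex.I * (u x * (1 / 2 - c * (u x)⁻¹ ^ 2) : ℝ))
    * Complex.exp (Complex.I * (θ x : ℂ))
  have hw : HasCircleDeriv w w' := fun t => by
    refine ((hdu.ofReal t).mul ((hθ.ofReal t).const_mul Complex.I).cexp).congr_deriv ?_
    simp only [w']
    push_cast
    ring
  have hexp : ∀ x, ‖Complex.exp (Complex.I * (θ x : ℂ))‖ = 1 := fun x => by
    rw [mul_comm]; exact Complex.norm_exp_ofReal_mul_I _
  have key2 : ∀ x, ‖w' x - Complex.I * ((1 / 2 : ℝ) : ℂ) * w x‖ ^ 2 = u' x ^ 2 + c ^ 2 * (u x)⁻¹ ^ 2 :=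
    fun x => by
    have e1 : w' x - Complex.I * ((1 / 2 : ℝ) : ℂ) * w x
        = ((u' x : ℂ) + (-(c * (u x)⁻¹) : ℝ) * Complex.I) * Complex.exp (Complex.I * (θ x : ℂ)) := by
      have : (u x : ℂ) ≠ 0 := by exact_mod_cast (hpos x).ne'
      simp only [w', w]
      push_cast
      field_simp
      ring
    rw [e1, norm_mul, hexp, mul_one, Complex.sq_norm, Complex.normSq_add_mul_I]
    ring
  refine ⟨u', w, w', hdu, cu', hw, ?_, fun x => ?_, ?_⟩
  · exact Continuous.mul (by fun_prop) (by fun_prop)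
  · simp only [w]
    rw [norm_mul, hexp, mul_one, Complex.norm_real, Real.norm_eq_abs, abs_of_pos (hpos x)]
  · simp only [key, key2]
    rw [integral_add (integrable_of_continuous (by fun_prop)) (integrable_of_continuous (by fun_prop)),
      integral_add (integrable_of_continuous (by fun_prop)) (integrable_of_continuous (by fun_prop)),
      integral_const_mul, ← hS]
    have e5 : 4 * a ^ 2 * (c ^ 2 * S) = a ^ 2 / S := by
      rw [hc]; field_simp; ring
    linear_combination hA + e5

/-! ### Trigonometric polynomials on the circle -/

/-- The trigonometric polynomial with coefficients `c` on the set of frequencies `s`. -/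
noncomputable def trig (s : Finset ℤ) (c : ℤ → ℂ) (x : S1) : ℂ := ∑ n ∈ s, c n * fourier n x

theorem trig_hasCircleDeriv (s : Finset ℤ) (c : ℤ → ℂ) :
    HasCircleDeriv (trig s c) (trig s (derivCoeff c)) := fun t =>
  HasDerivAt.fun_sum fun n _ => (((hasCircleDeriv_fourier n) t).const_mul (c n)).congr_deriv (by
    simp only [derivCoeff]; ring)

theorem continuous_trig (s : Finset ℤ) (c : ℤ → ℂ) : Continuous (trig s c) :=
  (trig_hasCircleDeriv s c).continuous

theorem fourierCoeff_trig (s : Finset ℤ) (c : ℤ → ℂ) (m : ℤ) :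
    fourierCoeff (trig s c) m = if m ∈ s then c m else 0 := by
  have e : ∀ x : S1, (fourier (-m) x : ℂ) • trig s c x = ∑ n ∈ s, c n * (fourier (n - m) x : ℂ) :=
    fun x => by
    rw [smul_eq_mul, trig, Finset.mul_sum]
    refine Finset.sum_congr rfl fun n _ => ?_
    rw [sub_eq_add_neg, fourier_add]
    ring
  change ∫ x : S1, (fourier (-m) x : ℂ) • trig s c x ∂circleMeasure = _
  simp only [e]
  have hi : ∀ n ∈ s, Integrable (fun x : S1 => c n * (fourier (n - m) x : ℂ)) circleMeasure :=
    fun n _ => integrable_of_continuous (continuous_const.mul (continuous_fourier _))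
  rw [integral_finsetSum s hi]
  simp only [integral_const_mul, integral_fourier, sub_eq_zero, mul_ite, mul_one, mul_zero,
    Finset.sum_ite_eq']

theorem integral_norm_sq_trig (s : Finset ℤ) (c : ℤ → ℂ) :
    ∫ x, ‖trig s c x‖ ^ 2 ∂circleMeasure = ∑ n ∈ s, ‖c n‖ ^ 2 := by
  have h : HasSum (fun n => ‖fourierCoeff (trig s c) n‖ ^ 2)
      (∑ n ∈ s, ‖fourierCoeff (trig s c) n‖ ^ 2) :=
    hasSum_sum_of_ne_finset_zero fun n hn => by simp [fourierCoeff_trig, hn]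
  rw [(hasSum_sq_fourierCoeff_circle (memLp_of_continuous (continuous_trig s c) _)).unique h]
  exact Finset.sum_congr rfl fun n hn => by rw [fourierCoeff_trig, if_pos hn]

theorem hasSum_sq_sub_trig {f : S1 → ℂ} (hf : MemLp f 2 circleMeasure) (s : Finset ℤ) :
    HasSum (fun n => if n ∈ s then 0 else ‖fourierCoeff f n‖ ^ 2)
      (∫ x, ‖f x - trig s (fourierCoeff f) x‖ ^ 2 ∂circleMeasure) := by
  have hg : MemLp (trig s (fourierCoeff f)) 2 circleMeasure :=
    memLp_of_continuous (continuous_trig s _) _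
  have h := hasSum_sq_fourierCoeff_circle (hf.sub hg)
  have e : ∀ n, fourierCoeff (f - trig s (fourierCoeff f)) n
      = if n ∈ s then 0 else fourierCoeff f n := fun n => by
    have h1 := fourierCoeff_sub_mul hg hf 1 n
    simp only [one_mul] at h1
    change fourierCoeff (fun x => f x - trig s (fourierCoeff f) x) n = _
    rw [h1, fourierCoeff_trig]
    split_ifs <;> simp
  simp only [e] at h
  convert h using 2 with n
  · split_ifs <;> simp
  · rfl

theorem integral_sq_sub_trig {f : S1 → ℂ} (hf : MemLp f 2 circleMeasure) (s : Finset ℤ) :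
    ∫ x, ‖f x - trig s (fourierCoeff f) x‖ ^ 2 ∂circleMeasure
      = ∫ x, ‖f x‖ ^ 2 ∂circleMeasure - ∑ n ∈ s, ‖fourierCoeff f n‖ ^ 2 := by
  have h0 : HasSum (fun n => if n ∈ s then ‖fourierCoeff f n‖ ^ 2 else 0)
      (∑ n ∈ s, if n ∈ s then ‖fourierCoeff f n‖ ^ 2 else 0) :=
    hasSum_sum_of_ne_finset_zero fun n hn => by simp [hn]
  have h1 := (hasSum_sq_sub_trig hf s).add h0
  have h2 := h1.unique (a₂ := ∫ x, ‖f x‖ ^ 2 ∂circleMeasure) (by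
    convert hasSum_sq_fourierCoeff_circle hf using 2 with n
    split_ifs <;> simp)
  rw [← h2, Finset.sum_congr rfl fun n hn => if_pos hn]
  ring

theorem integral_norm_sq_trig_mul_fourier (s : Finset ℤ) (c : ℤ → ℂ) (k : ℤ) :
    ∫ x, ((‖trig s c x‖ ^ 2 : ℝ) : ℂ) * fourier (-k) x ∂circleMeasure
      = ∑ n ∈ s, ∑ m ∈ s, if n - m = k then c n * (starRingEnd ℂ) (c m) else 0 := by
  have e : ∀ x : S1, ((‖trig s c x‖ ^ 2 : ℝ) : ℂ) * fourier (-k) x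
      = ∑ n ∈ s, ∑ m ∈ s, c n * (starRingEnd ℂ) (c m) * (fourier (n - m - k) x : ℂ) := fun x => by
    have h1 : ((‖trig s c x‖ ^ 2 : ℝ) : ℂ) = trig s c x * (starRingEnd ℂ) (trig s c x) := by
      rw [Complex.mul_conj, Complex.normSq_eq_norm_sq]
    rw [h1, trig, map_sum, Finset.sum_mul_sum, Finset.sum_mul]
    refine Finset.sum_congr rfl fun n _ => ?_
    rw [Finset.sum_mul]
    refine Finset.sum_congr rfl fun m _ => ?_
    rw [map_mul, ← fourier_neg, show n - m - k = n + (-m + -k) by ring, fourier_add, fourier_add]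
    ring
  simp only [e]
  have hi : ∀ n m, Integrable (fun x : S1 => c n * (starRingEnd ℂ) (c m) *
      (fourier (n - m - k) x : ℂ)) circleMeasure := fun n m =>
    integrable_of_continuous (continuous_const.mul (continuous_fourier _))
  rw [integral_finsetSum s fun n _ => integrable_finsetSum s fun m _ => hi n m]
  refine Finset.sum_congr rfl fun n _ => ?_
  rw [integral_finsetSum s fun m _ => hi n m]
  refine Finset.sum_congr rfl fun m _ => ?_
  rw [integral_const_mul, integral_fourier]
  simp only [sub_eq_zero, mul_ite, mul_one, mul_zero]

/-- A Fourier coefficient of `‖f‖ ^ 2` is close to the one of the squared modulus of a truncation. -/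
theorem norm_sq_fourier_truncation_le {f : S1 → ℂ} (hf : Continuous f) (s : Finset ℤ) (k : ℤ) :
    ‖∫ x, ((‖f x‖ ^ 2 : ℝ) : ℂ) * fourier (-k) x ∂circleMeasure
        - ∑ n ∈ s, ∑ m ∈ s, if n - m = k then fourierCoeff f n * (starRingEnd ℂ) (fourierCoeff f m)
          else 0‖ ^ 2
      ≤ 4 * (∫ x, ‖f x‖ ^ 2 ∂circleMeasure)
        * ∫ x, ‖f x - trig s (fourierCoeff f) x‖ ^ 2 ∂circleMeasure := by
  have hm : MemLp f 2 circleMeasure := memLp_of_continuous hf _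
  set P := trig s (fourierCoeff f) with hP
  have cP : Continuous P := continuous_trig _ _
  have cF := continuous_fourier (-k)
  rw [← integral_norm_sq_trig_mul_fourier, ← integral_sub
    (f := fun x => ((‖f x‖ ^ 2 : ℝ) : ℂ) * fourier (-k) x)
    (g := fun x => ((‖P x‖ ^ 2 : ℝ) : ℂ) * fourier (-k) x)
    (integrable_of_continuous ((Complex.continuous_ofReal.comp (hf.norm.pow 2)).mul cF))
    (integrable_of_continuous ((Complex.continuous_ofReal.comp (cP.norm.pow 2)).mul cF))]
  have h1 : ‖∫ x, (((‖f x‖ ^ 2 : ℝ) : ℂ) * fourier (-k) x - ((‖P x‖ ^ 2 : ℝ) : ℂ) * fourier (-k) x)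
      ∂circleMeasure‖ ≤ ∫ x, ‖f x - P x‖ * (‖f x‖ + ‖P x‖) ∂circleMeasure := by
    refine norm_integral_le_of_norm_le (integrable_of_continuous (by fun_prop)) (.of_forall fun x => ?_)
    rw [← sub_mul, norm_mul, norm_fourier, mul_one, ← Complex.ofReal_sub, Complex.norm_real,
      Real.norm_eq_abs, sq_sub_sq, abs_mul,
      abs_of_nonneg (add_nonneg (norm_nonneg (f x)) (norm_nonneg (P x))),
      mul_comm (‖f x‖ + ‖P x‖)]
    exact mul_le_mul_of_nonneg_right (abs_norm_sub_norm_le _ _)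
      (add_nonneg (norm_nonneg _) (norm_nonneg _))
  have h2 := sq_integral_le (f := fun x => ‖f x - P x‖) (g := fun x => ‖f x‖ + ‖P x‖)
    (by fun_prop) (by fun_prop)
  have h3 : ∫ x, (‖f x‖ + ‖P x‖) ^ 2 ∂circleMeasure
      ≤ 2 * ∫ x, ‖f x‖ ^ 2 ∂circleMeasure + 2 * ∫ x, ‖P x‖ ^ 2 ∂circleMeasure := by
    rw [← integral_const_mul, ← integral_const_mul, ← integral_add
      (integrable_of_continuous (by fun_prop)) (integrable_of_continuous (by fun_prop))]
    refine integral_mono (integrable_of_continuous (by fun_prop))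
      (integrable_of_continuous (by fun_prop)) fun x => ?_
    simp only
    nlinarith [sq_nonneg (‖f x‖ - ‖P x‖)]
  have h4 : ∫ x, ‖P x‖ ^ 2 ∂circleMeasure ≤ ∫ x, ‖f x‖ ^ 2 ∂circleMeasure := by
    have h5 := integral_sq_sub_trig hm s
    have h6 : 0 ≤ ∫ x, ‖f x - trig s (fourierCoeff f) x‖ ^ 2 ∂circleMeasure :=
      integral_nonneg fun x => sq_nonneg _
    rw [hP, integral_norm_sq_trig]
    linarith
  have h7 : 0 ≤ ∫ x, ‖f x - P x‖ ^ 2 ∂circleMeasure := integral_nonneg fun x => sq_nonneg _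
  refine (pow_le_pow_left₀ (norm_nonneg _) h1 2).trans (h2.trans ?_)
  rw [mul_comm]
  exact mul_le_mul_of_nonneg_right (by linarith) h7

/-! ### Rigidity on the circle for nonvanishing functions -/

theorem lpNormSq_one {X : Type*} [MeasurableSpace X] (m : Measure X) (f : X → ℂ) :
    lpNormSq m 1 f = (∫ x, ‖f x‖ ∂m) ^ 2 := by
  simp [lpNormSq]

/-- At half flux the modes `0` and `1` share the lowest weight `1/4`; elsewhere `(n - 1/2)² - 1/4 =
n² - n ≥ 2`. -/
theorem half_flux_le {w w' : S1 → ℂ} (h : HasCircleDeriv w w') (hw' : Continuous w') :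
    1 / 4 * (∫ x, ‖w x‖ ^ 2 ∂circleMeasure)
        + 2 * ∫ x, ‖w x - trig {0, 1} (fourierCoeff w) x‖ ^ 2 ∂circleMeasure
      ≤ ∫ x, ‖w' x - Complex.I * ((1 / 2 : ℝ) : ℂ) * w x‖ ^ 2 ∂circleMeasure := by
  have h1 := h.isH1Circle hw'
  refine hasSum_le (fun n => ?_) (((hasSum_sq_fourierCoeff_circle h1.memLp).mul_left (1 / 4)).add
    ((hasSum_sq_sub_trig h1.memLp {0, 1}).mul_left 2)) (h1.hasSum_kinetic (1 / 2))
  have h2 := sq_nonneg ‖fourierCoeff w n‖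
  split_ifs with hn
  · simp only [Finset.mem_insert, Finset.mem_singleton] at hn
    rcases hn with rfl | rfl <;> push_cast <;> linarith
  · simp only [Finset.mem_insert, Finset.mem_singleton, not_or] at hn
    have h3 : (2 : ℤ) ≤ n ^ 2 - n := by
      rcases lt_or_gt_of_ne hn.1 with h4 | h4
      · nlinarith
      · have : 2 ≤ n := by have := hn.2; omega
        nlinarith
    have h5 : (2 : ℝ) ≤ (n : ℝ) ^ 2 - n := by exact_mod_cast h3
    nlinarith

/-- Away from the modes `-1, 0, 1` the gap `n² - 1` is at least `3`. -/
theorem poincare_remainder {u u' : S1 → ℝ} (h : HasCircleDeriv u u') (hu' : Continuous u') :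
    ∫ x, u x ^ 2 ∂circleMeasure - (∫ x, u x ∂circleMeasure) ^ 2
        + 3 * ∫ x, ‖(u x : ℂ) - trig {-1, 0, 1} (fourierCoeff fun x => (u x : ℂ)) x‖ ^ 2 ∂circleMeasure
      ≤ ∫ x, u' x ^ 2 ∂circleMeasure := by
  have h1 := h.ofReal.isH1Circle (Complex.continuous_ofReal.comp hu')
  set U : S1 → ℂ := fun x => (u x : ℂ) with hU
  have h0 : ‖fourierCoeff U 0‖ ^ 2 = (∫ x, u x ∂circleMeasure) ^ 2 := by
    have : fourierCoeff U 0 = ((∫ x, u x ∂circleMeasure : ℝ) : ℂ) := by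
      rw [← integral_complex_ofReal, fourierCoeff]
      refine integral_congr_ae (.of_forall fun x => ?_)
      simp [hU]
    rw [this, Complex.norm_real, Real.norm_eq_abs, sq_abs]
  have hk := h1.hasSum_kinetic 0
  have hm := hasSum_sq_fourierCoeff_circle h1.memLp
  have hz := hasSum_ite_eq (0 : ℤ) (‖fourierCoeff U 0‖ ^ 2)
  simp only [sub_zero, Complex.ofReal_zero, mul_zero, zero_mul, Complex.norm_real,
    Real.norm_eq_abs, sq_abs] at hk
  have hm2 : ∫ x, ‖U x‖ ^ 2 ∂circleMeasure = ∫ x, u x ^ 2 ∂circleMeasure := by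
    simp only [hU, Complex.norm_real, Real.norm_eq_abs, sq_abs]
  rw [← h0, ← hm2]
  refine hasSum_le (fun n => ?_) ((hm.sub hz).add
    ((hasSum_sq_sub_trig h1.memLp {-1, 0, 1}).mul_left 3)) hk
  have h2 := sq_nonneg ‖fourierCoeff U n‖
  split_ifs with hn hn' hn'
  · subst hn; simp
  · subst hn; simp at hn'
  · simp only [Finset.mem_insert, Finset.mem_singleton] at hn'
    rcases hn' with rfl | rfl | rfl
    · push_cast; linarith
    · exact absurd rfl hn
    · push_cast; linarith
  · simp only [Finset.mem_insert, Finset.mem_singleton, not_or] at hn'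
    have h3 : (4 : ℤ) ≤ n ^ 2 := by
      rcases lt_or_gt_of_ne hn'.2.1 with h4 | h4
      · have : n ≤ -2 := by have := hn'.1; omega
        nlinarith
      · have : 2 ≤ n := by have := hn'.2.2; omega
        nlinarith
    have h5 : (4 : ℝ) ≤ (n : ℝ) ^ 2 := by exact_mod_cast h3
    nlinarith

/-- A quantitative form of the fact that a nonconstant function cannot be optimal in both the
Poincaré inequality and the half-flux inequality. -/
theorem sq_variance_le {u u' : S1 → ℝ} (h : HasCircleDeriv u u') (hu' : Continuous u')
    {w w' : S1 → ℂ} (hw : HasCircleDeriv w w') (hw' : Continuous w') (hwu : ∀ x, ‖w x‖ = u x) :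
    (∫ x, u x ^ 2 ∂circleMeasure - (∫ x, u x ∂circleMeasure) ^ 2) ^ 2
      ≤ 25 * (∫ x, u x ^ 2 ∂circleMeasure) *
        ((∫ x, ‖w' x - Complex.I * ((1 / 2 : ℝ) : ℂ) * w x‖ ^ 2 ∂circleMeasure
          - 1 / 4 * ∫ x, u x ^ 2 ∂circleMeasure)
        + (∫ x, u' x ^ 2 ∂circleMeasure
          - (∫ x, u x ^ 2 ∂circleMeasure - (∫ x, u x ∂circleMeasure) ^ 2))) := by
  have hD1 := half_flux_le hw hw'
  have hD2 := poincare_remainder h hu'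
  have hF1 := norm_sq_fourier_truncation_le hw.continuous {0, 1} 2
  have hF2 := norm_sq_fourier_truncation_le h.ofReal.continuous {-1, 0, 1} 2
  have hP := integral_sq_sub_trig (memLp_of_continuous h.ofReal.continuous _) {-1, 0, 1}
  set U : S1 → ℂ := fun x => (u x : ℂ) with hU
  have hUn : ∀ x, ‖(u x : ℂ)‖ ^ 2 = u x ^ 2 := fun x => by
    simp only [Complex.norm_real, Real.norm_eq_abs, sq_abs]
  have c0 : fourierCoeff U 0 = ((∫ x, u x ∂circleMeasure : ℝ) : ℂ) := by
    rw [← integral_complex_ofReal, fourierCoeff]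
    refine integral_congr_ae (.of_forall fun x => ?_)
    simp [hU]
  have cneg : fourierCoeff U (-1) = (starRingEnd ℂ) (fourierCoeff U 1) := by
    rw [fourierCoeff, fourierCoeff, ← integral_conj]
    refine integral_congr_ae (.of_forall fun x => ?_)
    simp only [smul_eq_mul, map_mul, hU, Complex.conj_ofReal, ← fourier_neg]
  simp only [hwu, hUn] at hD1 hF1 hF2 hP
  -- The frequencies `0` and `1` produce no frequency `2` in `|w|²`, whereas `-1, 0, 1` produce the
  -- square of the first coefficient of `u` there.
  have s1 : ∀ c : ℤ → ℂ, ∑ n ∈ ({0, 1} : Finset ℤ), ∑ m ∈ ({0, 1} : Finset ℤ),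
      (if n - m = 2 then c n * (starRingEnd ℂ) (c m) else 0) = 0 := fun c => by simp
  have s2 : ∑ n ∈ ({-1, 0, 1} : Finset ℤ), ∑ m ∈ ({-1, 0, 1} : Finset ℤ),
      (if n - m = 2 then fourierCoeff U n * (starRingEnd ℂ) (fourierCoeff U m) else 0)
      = fourierCoeff U 1 * fourierCoeff U 1 := by
    simp [cneg]
  have s3 : ∑ n ∈ ({-1, 0, 1} : Finset ℤ), ‖fourierCoeff U n‖ ^ 2
      = (∫ x, u x ∂circleMeasure) ^ 2 + 2 * ‖fourierCoeff U 1‖ ^ 2 := by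
    simp [cneg, c0]
    ring
  rw [s1, sub_zero] at hF1
  rw [s2] at hF2
  rw [s3] at hP
  set M := ∫ x, u x ^ 2 ∂circleMeasure
  set A := ∫ x, u x ∂circleMeasure
  set Rw := ∫ x, ‖w x - trig {0, 1} (fourierCoeff w) x‖ ^ 2 ∂circleMeasure
  set Ru := ∫ x, ‖U x - trig {-1, 0, 1} (fourierCoeff U) x‖ ^ 2 ∂circleMeasure
  set G := ∫ x, ((u x ^ 2 : ℝ) : ℂ) * fourier (-2) x ∂circleMeasure
  set b := fourierCoeff U 1
  set D1 := ∫ x, ‖w' x - Complex.I * ((1 / 2 : ℝ) : ℂ) * w x‖ ^ 2 ∂circleMeasure - 1 / 4 * M with hD1'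
  set D2 := ∫ x, u' x ^ 2 ∂circleMeasure - (M - A ^ 2) with hD2'
  have hM : 0 ≤ M := integral_nonneg fun x => sq_nonneg _
  have hRw : 0 ≤ Rw := integral_nonneg fun x => sq_nonneg _
  have hRu : 0 ≤ Ru := integral_nonneg fun x => sq_nonneg _
  -- Since `|w|² = u²`, the same coefficient `G` is close to `0` by the truncation of `w` and close
  -- to `b²` by the truncation of `u`; hence `b` is small.
  have hb : ‖b‖ ^ 2 ≤ ‖G‖ + ‖G - b * b‖ := by
    have := norm_sub_le G (G - b * b)
    rw [sub_sub_cancel, norm_mul] at this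
    linarith
  have hx : M - A ^ 2 ≤ 2 * (‖G‖ + ‖G - b * b‖) + Ru := by linarith
  have hx0 : 0 ≤ M - A ^ 2 := by nlinarith [sq_nonneg ‖b‖]
  have hRuM : Ru ≤ M := by nlinarith [sq_nonneg ‖b‖, sq_nonneg A]
  have hRu2 : Ru ^ 2 ≤ M * Ru := by nlinarith
  -- Both truncation errors carry a factor `4M`, so this gives `48 M Rw + 51 M Ru`; with `Rw ≤ D1 /
  -- 2` and `Ru ≤ D2 / 3` the constant `25` suffices.
  have h5 : (2 * (‖G‖ + ‖G - b * b‖) + Ru) ^ 2 ≤ 12 * (‖G‖ ^ 2 + ‖G - b * b‖ ^ 2) + 3 * Ru ^ 2 := by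
    nlinarith [sq_nonneg (‖G‖ - ‖G - b * b‖), sq_nonneg (2 * ‖G‖ - Ru), sq_nonneg (2 * ‖G - b * b‖ - Ru)]
  have h6 := pow_le_pow_left₀ hx0 hx 2
  have hw2 : M * Rw ≤ M * (D1 / 2) := mul_le_mul_of_nonneg_left (by linarith) hM
  have hu2 : M * Ru ≤ M * (D2 / 3) := mul_le_mul_of_nonneg_left (by linarith) hM
  have hd1 : 0 ≤ M * D1 := mul_nonneg hM (by linarith)
  have hd2 : 0 ≤ M * D2 := mul_nonneg hM (by linarith)
  nlinarith

/-- Split the energy by `exists_phase`: the half-flux part yields `a² ‖ψ‖₂²`, and the coefficient `1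
- 4a²` of `∫ u'²` leaves room for `μ` times the Beckner inequality. -/
theorem rigidity_of_ne_zero {ψ ψ' : S1 → ℂ} (h : HasCircleDeriv ψ ψ') (hψ' : Continuous ψ')
    (h0 : ∀ x, ψ x ≠ 0) {a p μ : ℝ} (ha : a ∈ Set.Icc (0 : ℝ) (1 / 2)) (hp : p ∈ Set.Ico (1 : ℝ) 2)
    (hμ : 0 < μ) (hc : μ * (2 - p) + 4 * a ^ 2 ≤ 1) :
    (a ^ 2 + μ) * ∫ x, ‖ψ x‖ ^ 2 ∂circleMeasure ≤ circleEnergy a p μ ψ ψ' := by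
  obtain ⟨u', w, w', hu, cu', hw, cw', hwu, hE⟩ := exists_phase h hψ' h0 ha
  have hb := beckner_of_pos hu cu' (fun x => norm_pos_iff.2 (h0 x)) hp 0
  have hf := half_flux_le hw cw'
  simp only [hwu] at hf
  have h1 : 0 ≤ ∫ x, ‖w x - trig {0, 1} (fourierCoeff w) x‖ ^ 2 ∂circleMeasure :=
    integral_nonneg fun x => sq_nonneg _
  have h2 : 0 ≤ ∫ x, u' x ^ 2 ∂circleMeasure := integral_nonneg fun x => sq_nonneg _
  have h3 := mul_le_mul_of_nonneg_right hc h2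
  have h4 := mul_le_mul_of_nonneg_left hb hμ.le
  have h5 := mul_nonneg (sq_nonneg a) h1
  have h6 := mul_le_mul_of_nonneg_left hf (sq_nonneg a)
  rw [circleEnergy, lpNormSq]
  linear_combination hE + h3 + h4 + 8 * h5 + 4 * h6

/-- Rigidity with a quantitative deficit. The inequality involves only quantities continuous in
`H¹`, and so will extend to functions with zeros, which a bare discussion of equality cases would
not. -/
theorem rigidity_remainder_of_ne_zero {a p μ : ℝ} (ha : a ∈ Set.Icc (0 : ℝ) (1 / 2))
    (hp : p ∈ Set.Ico (1 : ℝ) 2) (hμ : 0 < μ) (hc : μ * (2 - p) + 4 * a ^ 2 ≤ 1)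
    (hne : ¬ (a = 0 ∧ p = 1 ∧ μ = 1)) :
    ∃ c, 0 < c ∧ ∀ ψ ψ' : S1 → ℂ, HasCircleDeriv ψ ψ' → Continuous ψ' → (∀ x, ψ x ≠ 0) →
      c * (∫ x, ‖ψ x‖ ^ 2 ∂circleMeasure - lpNormSq circleMeasure p ψ) ^ 2
        ≤ (∫ x, ‖ψ x‖ ^ 2 ∂circleMeasure) *
          (circleEnergy a p μ ψ ψ' - (a ^ 2 + μ) * ∫ x, ‖ψ x‖ ^ 2 ∂circleMeasure) := by
  by_cases hp1 : p = 1
  · subst hp1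
    rcases eq_or_lt_of_le ha.1 with ha0 | ha0
    · -- no flux
      subst ha0
      have hμ1 : μ < 1 := lt_of_le_of_ne (by linarith) fun h => hne ⟨rfl, rfl, h⟩
      refine ⟨1 - μ, by linarith, fun ψ ψ' h hψ' h0 => ?_⟩
      have hb := beckner h hψ' hp 0
      simp only [circleEnergy, lpNormSq_one, Complex.ofReal_zero, mul_zero, zero_mul, sub_zero] at hb ⊢
      set M := ∫ x, ‖ψ x‖ ^ 2 ∂circleMeasure
      set A := ∫ x, ‖ψ x‖ ∂circleMeasure
      set K := ∫ x, ‖ψ' x‖ ^ 2 ∂circleMeasure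
      have hM : 0 ≤ M := integral_nonneg fun x => sq_nonneg _
      have hA : A ^ 2 ≤ M := by
        have := sq_integral_le (f := fun x => ‖ψ x‖) (g := fun _ => 1) h.continuous.norm
          continuous_const
        simpa using this
      have h1 : M - A ^ 2 ≤ K := by linarith
      have h2 : (M - A ^ 2) * (M - A ^ 2) ≤ M * (M - A ^ 2) :=
        mul_le_mul_of_nonneg_right (by nlinarith [sq_nonneg A]) (by linarith)
      have h3 : M * (M - A ^ 2) ≤ M * K := mul_le_mul_of_nonneg_left h1 hM
      nlinarith
    · have ha2 : 0 < a ^ 2 := by positivity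
      -- Here the deficit dominates `4a²` times the half-flux deficit plus `μ` times the Poincaré
      -- deficit; `25` is the constant of `sq_variance_le`.
      refine ⟨min (4 * a ^ 2) μ / 25, by positivity, fun ψ ψ' h hψ' h0 => ?_⟩
      obtain ⟨u', w, w', hu, cu', hw, cw', hwu, hE⟩ := exists_phase h hψ' h0 ha
      have hv := sq_variance_le hu cu' hw cw' hwu
      have hf := half_flux_le hw cw'
      have hpr := poincare_remainder hu cu'
      simp only [hwu] at hf
      have h1 : 0 ≤ ∫ x, ‖w x - trig {0, 1} (fourierCoeff w) x‖ ^ 2 ∂circleMeasure :=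
        integral_nonneg fun x => sq_nonneg _
      have h1' : 0 ≤ ∫ x, ‖((‖ψ x‖ : ℝ) : ℂ) - trig {-1, 0, 1} (fourierCoeff fun x => ((‖ψ x‖ : ℝ) : ℂ)) x‖ ^ 2
          ∂circleMeasure := integral_nonneg fun x => sq_nonneg _
      have h2 : 0 ≤ ∫ x, u' x ^ 2 ∂circleMeasure := integral_nonneg fun x => sq_nonneg _
      simp only [circleEnergy, lpNormSq_one]
      set M := ∫ x, ‖ψ x‖ ^ 2 ∂circleMeasure
      set A := ∫ x, ‖ψ x‖ ∂circleMeasure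
      set K := ∫ x, ‖w' x - Complex.I * ((1 / 2 : ℝ) : ℂ) * w x‖ ^ 2 ∂circleMeasure
      set Q := ∫ x, u' x ^ 2 ∂circleMeasure
      set Z := ∫ x, ‖ψ' x - Complex.I * (a : ℂ) * ψ x‖ ^ 2 ∂circleMeasure
      have hM : 0 ≤ M := integral_nonneg fun x => sq_nonneg _
      have hd1 : 0 ≤ K - 1 / 4 * M := by linarith
      have hd2 : 0 ≤ Q - (M - A ^ 2) := by linarith
      have hδ : min (4 * a ^ 2) μ * ((K - 1 / 4 * M) + (Q - (M - A ^ 2)))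
          ≤ Z + μ * A ^ 2 - (a ^ 2 + μ) * M := by
        have h3 := mul_le_mul_of_nonneg_right (min_le_left (4 * a ^ 2) μ) hd1
        have h4 := mul_le_mul_of_nonneg_right (min_le_right (4 * a ^ 2) μ) hd2
        have h5 := mul_le_mul_of_nonneg_right hc h2
        linear_combination h3 + h4 + h5 + hE
      have h6 := mul_le_mul_of_nonneg_left hδ hM
      have hmin : 0 < min (4 * a ^ 2) μ := by positivity
      have h7 := mul_le_mul_of_nonneg_left hv hmin.le
      linear_combination h6 + h7 / 25
  · have hκ := remainderConst_pos hp hp1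
    refine ⟨μ * remainderConst p / 2, by positivity, fun ψ ψ' h hψ' h0 => ?_⟩
    obtain ⟨u', w, w', hu, cu', hw, cw', hwu, hE⟩ := exists_phase h hψ' h0 ha
    have hb := beckner_of_pos hu cu' (fun x => norm_pos_iff.2 (h0 x)) hp
    have hf := half_flux_le hw cw'
    simp only [hwu] at hf
    have h1 : 0 ≤ ∫ x, ‖w x - trig {0, 1} (fourierCoeff w) x‖ ^ 2 ∂circleMeasure :=
      integral_nonneg fun x => sq_nonneg _
    have h2 : 0 ≤ ∫ x, u' x ^ 2 ∂circleMeasure := integral_nonneg fun x => sq_nonneg _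
    simp only [circleEnergy]
    rw [← lpNormSq] at hb
    set M := ∫ x, ‖ψ x‖ ^ 2 ∂circleMeasure
    set L := lpNormSq circleMeasure p ψ
    set K := ∫ x, ‖w' x - Complex.I * ((1 / 2 : ℝ) : ℂ) * w x‖ ^ 2 ∂circleMeasure
    set Q := ∫ x, u' x ^ 2 ∂circleMeasure
    set Z := ∫ x, ‖ψ' x - Complex.I * (a : ℂ) * ψ x‖ ^ 2 ∂circleMeasure
    have hM : 0 < M := by
      obtain ⟨m, hm, hm'⟩ := exists_pos_lower_bound (f := fun x => ‖ψ x‖ ^ 2)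
        (h.continuous.norm.pow 2) fun x => by have := norm_pos_iff.2 (h0 x); positivity
      refine hm.trans_le ?_
      calc m = ∫ _, m ∂circleMeasure := by simp
        _ ≤ _ := integral_mono (integrable_const _)
          (integrable_of_continuous (h.continuous.norm.pow 2)) hm'
    -- The optimal `σ`, for which the linearized remainder becomes `(M - L)² / (2M)`.
    have hb' := hb ((M - L) / M)
    have e1 : remainderConst p * ((M - L) / M) * (M - L) = remainderConst p * ((M - L) ^ 2 / M) := by
      ring
    have e2 : remainderConst p / 2 * ((M - L) / M) ^ 2 * M
        = remainderConst p / 2 * ((M - L) ^ 2 / M) := by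
      field_simp
    have h3 := mul_le_mul_of_nonneg_right hc h2
    have h4 := mul_le_mul_of_nonneg_left hb' hμ.le
    have h5 := mul_nonneg (sq_nonneg a) h1
    have h6 := mul_le_mul_of_nonneg_left hf (sq_nonneg a)
    have hδ : μ * remainderConst p / 2 * ((M - L) ^ 2 / M) ≤ Z + μ * L - (a ^ 2 + μ) * M := by
      linear_combination hE + h3 + h4 + 8 * h5 + 4 * h6 - μ * e1 + μ * e2
    have h7 := mul_le_mul_of_nonneg_left hδ hM.le
    have e3 : M * (μ * remainderConst p / 2 * ((M - L) ^ 2 / M))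
        = μ * remainderConst p / 2 * (M - L) ^ 2 := by
      field_simp
    linarith

/-! ### Convergence in `L²` -/

/-- The functions `F i` converge to `f` in `L²` along the filter `l`. -/
structure L2Tendsto {X ι : Type*} [MeasurableSpace X] (m : Measure X) (l : Filter ι)
    (F : ι → X → ℂ) (f : X → ℂ) : Prop where
  memLp : ∀ i, MemLp (F i) 2 m
  memLp_lim : MemLp f 2 m
  tendsto : Tendsto (fun i => eLpNorm (F i - f) 2 m) l (𝓝 0)

theorem eLpNorm_two_eq {X : Type*} [MeasurableSpace X] {m : Measure X} {f : X → ℂ}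
    (hf : MemLp f 2 m) : eLpNorm f 2 m = ENNReal.ofReal (Real.sqrt (∫ x, ‖f x‖ ^ 2 ∂m)) := by
  rw [hf.eLpNorm_eq_integral_rpow_norm (by norm_num) (by norm_num), Real.sqrt_eq_rpow]
  simp

theorem lpNormSq_eq {X : Type*} [MeasurableSpace X] {m : Measure X} [IsFiniteMeasure m] {f : X → ℂ}
    (hf : MemLp f 2 m) {p : ℝ} (hp1 : 1 ≤ p) (hp2 : p ≤ 2) :
    lpNormSq m p f = (eLpNorm f (ENNReal.ofReal p) m).toReal ^ 2 := by
  have hp0 : 0 < p := by linarith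
  have hp : MemLp f (ENNReal.ofReal p) m := hf.mono_exponent (by
    rw [show (2 : ENNReal) = ENNReal.ofReal 2 by simp]
    exact ENNReal.ofReal_le_ofReal hp2)
  rw [hp.eLpNorm_eq_integral_rpow_norm (by simpa using hp0) ENNReal.ofReal_ne_top,
    ENNReal.toReal_ofReal hp0.le, ENNReal.toReal_ofReal
      (Real.rpow_nonneg (integral_nonneg fun x => Real.rpow_nonneg (norm_nonneg _) _) _),
    lpNormSq, ← Real.rpow_natCast, ← Real.rpow_mul
      (integral_nonneg fun x => Real.rpow_nonneg (norm_nonneg _) _)]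
  congr 1
  push_cast
  field_simp

theorem lpNormSq_two {X : Type*} [MeasurableSpace X] (m : Measure X) (f : X → ℂ) :
    lpNormSq m 2 f = ∫ x, ‖f x‖ ^ 2 ∂m := by
  simp [lpNormSq]

theorem lpNormSq_nonneg {X : Type*} [MeasurableSpace X] (m : Measure X) (p : ℝ) (f : X → ℂ) :
    0 ≤ lpNormSq m p f :=
  Real.rpow_nonneg (integral_nonneg fun _ => Real.rpow_nonneg (norm_nonneg _) _) _

theorem L2Tendsto.of_integral {X ι : Type*} [MeasurableSpace X] {m : Measure X} {l : Filter ι}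
    {F : ι → X → ℂ} {f : X → ℂ} (hF : ∀ i, MemLp (F i) 2 m) (hf : MemLp f 2 m)
    (h : Tendsto (fun i => ∫ x, ‖f x - F i x‖ ^ 2 ∂m) l (𝓝 0)) : L2Tendsto m l F f := by
  refine ⟨hF, hf, ?_⟩
  have e : ∀ i, eLpNorm (F i - f) 2 m = ENNReal.ofReal (Real.sqrt (∫ x, ‖f x - F i x‖ ^ 2 ∂m)) :=
    fun i => by
    rw [eLpNorm_two_eq ((hF i).sub hf)]
    simp only [Pi.sub_apply, norm_sub_rev]
  simp only [e]
  have h1 := (Real.continuous_sqrt.tendsto 0).comp h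
  rw [Real.sqrt_zero] at h1
  have h2 := ENNReal.tendsto_ofReal h1
  rw [ENNReal.ofReal_zero] at h2
  exact h2

theorem L2Tendsto.sub_const_mul {X ι : Type*} [MeasurableSpace X] {m : Measure X} {l : Filter ι}
    {F G : ι → X → ℂ} {f g : X → ℂ} (hF : L2Tendsto m l F f) (hG : L2Tendsto m l G g) (z : ℂ) :
    L2Tendsto m l (fun i x => G i x - z * F i x) fun x => g x - z * f x := by
  refine ⟨fun i => (hG.memLp i).sub ((hF.memLp i).const_mul z),
    hG.memLp_lim.sub (hF.memLp_lim.const_mul z), ?_⟩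
  have h1 : Tendsto (fun i => eLpNorm (G i - g) 2 m + ‖z‖ₑ * eLpNorm (F i - f) 2 m) l (𝓝 0) := by
    have := hG.tendsto.add (ENNReal.Tendsto.const_mul hF.tendsto (.inr enorm_ne_top) (a := ‖z‖ₑ))
    simpa using this
  refine tendsto_of_tendsto_of_tendsto_of_le_of_le tendsto_const_nhds h1 (fun _ => zero_le)
    fun i => ?_
  have e : ((fun x => G i x - z * F i x) - fun x => g x - z * f x) = (G i - g) - z • (F i - f) := by
    funext x
    simp only [Pi.sub_apply, Pi.smul_apply, smul_eq_mul]
    ring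
  simp only
  rw [e, ← eLpNorm_const_smul]
  exact eLpNorm_sub_le ((hG.memLp i).sub hG.memLp_lim).1
    (((hF.memLp i).sub hF.memLp_lim).const_smul z).1 (by norm_num)

/-- On a probability space the `p`-norm is at most the `2`-norm, so the reverse triangle inequality
suffices. -/
theorem L2Tendsto.tendsto_lpNormSq {X ι : Type*} [MeasurableSpace X] {m : Measure X}
    [IsProbabilityMeasure m] {l : Filter ι} {F : ι → X → ℂ} {f : X → ℂ} (h : L2Tendsto m l F f)
    {p : ℝ} (hp1 : 1 ≤ p) (hp2 : p ≤ 2) :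
    Tendsto (fun i => lpNormSq m p (F i)) l (𝓝 (lpNormSq m p f)) := by
  have hle : ENNReal.ofReal p ≤ 2 := by
    rw [show (2 : ENNReal) = ENNReal.ofReal 2 by simp]
    exact ENNReal.ofReal_le_ofReal hp2
  have h1p : 1 ≤ ENNReal.ofReal p := by
    rw [show (1 : ENNReal) = ENNReal.ofReal 1 by simp]
    exact ENNReal.ofReal_le_ofReal hp1
  have hm : ∀ {g : X → ℂ}, MemLp g 2 m → MemLp g (ENNReal.ofReal p) m := fun hg => hg.mono_exponent hle
  simp only [lpNormSq_eq h.memLp_lim hp1 hp2, fun i => lpNormSq_eq (h.memLp i) hp1 hp2]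
  refine Tendsto.pow (tendsto_iff_dist_tendsto_zero.2 ?_) 2
  have h2 := (ENNReal.tendsto_toReal ENNReal.zero_ne_top).comp h.tendsto
  refine squeeze_zero (fun _ => dist_nonneg) (fun i => ?_) h2
  have hd := (h.memLp i).sub h.memLp_lim
  have h3 : (eLpNorm (F i - f) (ENNReal.ofReal p) m).toReal ≤ (eLpNorm (F i - f) 2 m).toReal :=
    ENNReal.toReal_mono hd.2.ne (eLpNorm_le_eLpNorm_of_exponent_le hle hd.1)
  refine le_trans ?_ h3
  have key : ∀ {u v : X → ℂ}, MemLp u (ENNReal.ofReal p) m → MemLp v (ENNReal.ofReal p) m →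
      (eLpNorm u (ENNReal.ofReal p) m).toReal ≤ (eLpNorm (u - v) (ENNReal.ofReal p) m).toReal
        + (eLpNorm v (ENNReal.ofReal p) m).toReal := fun {u v} hu hv => by
    rw [← ENNReal.toReal_add (hu.sub hv).2.ne hv.2.ne]
    refine ENNReal.toReal_mono (ENNReal.add_ne_top.2 ⟨(hu.sub hv).2.ne, hv.2.ne⟩) ?_
    have := eLpNorm_add_le (hu.sub hv).1 hv.1 h1p
    rwa [sub_add_cancel] at this
  rw [Real.dist_eq, abs_le]
  have k1 := key (hm (h.memLp i)) (hm h.memLp_lim)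
  have k2 := key (hm h.memLp_lim) (hm (h.memLp i))
  rw [← eLpNorm_neg (f - F i), neg_sub] at k2
  constructor <;> linarith

theorem L2Tendsto.tendsto_integral_sq {X ι : Type*} [MeasurableSpace X] {m : Measure X}
    [IsProbabilityMeasure m] {l : Filter ι} {F : ι → X → ℂ} {f : X → ℂ} (h : L2Tendsto m l F f) :
    Tendsto (fun i => ∫ x, ‖F i x‖ ^ 2 ∂m) l (𝓝 (∫ x, ‖f x‖ ^ 2 ∂m)) := by
  simpa only [lpNormSq_two] using h.tendsto_lpNormSq one_le_two le_rfl

theorem L2Tendsto.circleEnergy {ι : Type*} {l : Filter ι} {F G : ι → S1 → ℂ} {f g : S1 → ℂ}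
    (hF : L2Tendsto circleMeasure l F f) (hG : L2Tendsto circleMeasure l G g) {a p μ : ℝ}
    (hp1 : 1 ≤ p) (hp2 : p ≤ 2) :
    Tendsto (fun i => circleEnergy a p μ (F i) (G i)) l (𝓝 (circleEnergy a p μ f g)) :=
  (hF.sub_const_mul hG _).tendsto_integral_sq.add ((hF.tendsto_lpNormSq hp1 hp2).const_mul μ)

theorem L2Tendsto.comp {X ι κ : Type*} [MeasurableSpace X] {m : Measure X} {l : Filter ι}
    {F : ι → X → ℂ} {f : X → ℂ} (h : L2Tendsto m l F f) {k : Filter κ} {s : κ → ι}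
    (hs : Tendsto s k l) : L2Tendsto m k (fun j => F (s j)) f :=
  ⟨fun _ => h.memLp _, h.memLp_lim, h.tendsto.comp hs⟩

/-! ### Approximation in `H¹` of the circle -/

theorem l2Tendsto_trig {f : S1 → ℂ} (hf : MemLp f 2 circleMeasure) :
    L2Tendsto circleMeasure atTop (fun s => trig s (fourierCoeff f)) f := by
  refine .of_integral (fun s => memLp_of_continuous (continuous_trig s _) _) hf ?_
  simp only [integral_sq_sub_trig hf]
  have h : Tendsto (fun s : Finset ℤ => ∑ n ∈ s, ‖fourierCoeff f n‖ ^ 2) atTop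
      (𝓝 (∫ x, ‖f x‖ ^ 2 ∂circleMeasure)) := hasSum_sq_fourierCoeff_circle hf
  have h1 := h.const_sub (∫ x, ‖f x‖ ^ 2 ∂circleMeasure)
  have e : ∫ x, ‖f x‖ ^ 2 ∂circleMeasure - ∫ x, ‖f x‖ ^ 2 ∂circleMeasure = 0 := sub_self _
  exact e ▸ h1

theorem isSmoothCircle_trig (s : Finset ℤ) (c : ℤ → ℂ) : IsSmoothCircle (trig s c) := by
  unfold IsSmoothCircle trig
  exact ContDiff.sum fun n _ => contDiff_const.mul (isSmoothCircle_fourier n)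

/-- A smooth curve in the plane has a range with dense complement, so an arbitrarily small constant
shift avoids zero. -/
theorem exists_small_notMem_range {f : S1 → ℂ} (hf : IsSmoothCircle f) {ε : ℝ} (hε : 0 < ε) :
    ∃ z : ℂ, ‖z‖ < ε ∧ ∀ x, f x ≠ z := by
  have h := ContDiff.dense_compl_range_of_finrank_lt_finrank (f := fun t : ℝ => f (t : S1))
    (hf.of_le (by simp)) (by simp)
  obtain ⟨z, hz, hd⟩ := h.exists_dist_lt 0 hε
  rw [dist_zero_left] at hd
  refine ⟨z, hd, fun x hx => ?_⟩
  induction x using QuotientAddGroup.induction_on with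
  | H t => exact hz ⟨t, hx⟩

/-- Truncate the Fourier series and shift by a small constant, which removes the zeros and leaves
the derivative unchanged. -/
theorem IsH1Circle.exists_approx {ψ g : S1 → ℂ} (h : IsH1Circle ψ g) :
    ∃ F G : ℕ → S1 → ℂ, (∀ n, HasCircleDeriv (F n) (G n) ∧ Continuous (G n) ∧ ∀ x, F n x ≠ 0) ∧
      L2Tendsto circleMeasure atTop F ψ ∧ L2Tendsto circleMeasure atTop G g := by
  obtain ⟨s, hs⟩ := exists_seq_tendsto (atTop : Filter (Finset ℤ))
  choose z hz hz' using fun n : ℕ => exists_small_notMem_range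
    (isSmoothCircle_trig (s n) (fourierCoeff ψ)) (ε := 1 / ((n : ℝ) + 1)) (by positivity)
  have hz0 : Tendsto z atTop (𝓝 0) := squeeze_zero_norm (fun n => (hz n).le)
    tendsto_one_div_add_atTop_nhds_zero_nat
  have hzL : L2Tendsto circleMeasure atTop (fun n (_ : S1) => z n) fun _ => 0 := by
    refine .of_integral (fun n => memLp_const _) (memLp_const _) ?_
    simpa using hz0.norm.pow 2
  have hg : derivCoeff (fourierCoeff ψ) = fourierCoeff g := funext fun n =>
    (h.fourierCoeff_deriv n).symm
  refine ⟨fun n x => trig (s n) (fourierCoeff ψ) x - 1 * z n,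
    fun n => trig (s n) (fourierCoeff g), fun n => ⟨fun t => ?_, continuous_trig _ _, fun x => ?_⟩,
    ?_, (l2Tendsto_trig h.memLp_deriv).comp hs⟩
  · rw [← hg]
    exact (trig_hasCircleDeriv _ _ t).sub_const _
  · simp only [one_mul]
    exact sub_ne_zero.2 (hz' n x)
  · simpa using hzL.sub_const_mul ((l2Tendsto_trig h.memLp).comp hs) 1

theorem rigidity {a p μ : ℝ} (ha : a ∈ Set.Icc (0 : ℝ) (1 / 2)) (hp : p ∈ Set.Ico (1 : ℝ) 2)
    (hμ : 0 < μ) (hc : μ * (2 - p) + 4 * a ^ 2 ≤ 1) : a ^ 2 + μ ∈ circleConstants a p μ := by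
  intro ψ g h
  obtain ⟨F, G, hFG, hF, hG⟩ := h.exists_approx
  refine le_of_tendsto_of_tendsto' (hF.tendsto_integral_sq.const_mul _)
    (hF.circleEnergy hG hp.1 hp.2.le) fun n => ?_
  exact rigidity_of_ne_zero (hFG n).1 (hFG n).2.1 (hFG n).2.2 ha hp hμ hc

theorem rigidity_remainder {a p μ : ℝ} (ha : a ∈ Set.Icc (0 : ℝ) (1 / 2))
    (hp : p ∈ Set.Ico (1 : ℝ) 2) (hμ : 0 < μ) (hc : μ * (2 - p) + 4 * a ^ 2 ≤ 1)
    (hne : ¬ (a = 0 ∧ p = 1 ∧ μ = 1)) :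
    ∃ c, 0 < c ∧ ∀ ψ g : S1 → ℂ, IsH1Circle ψ g →
      c * (∫ x, ‖ψ x‖ ^ 2 ∂circleMeasure - lpNormSq circleMeasure p ψ) ^ 2
        ≤ (∫ x, ‖ψ x‖ ^ 2 ∂circleMeasure) *
          (circleEnergy a p μ ψ g - (a ^ 2 + μ) * ∫ x, ‖ψ x‖ ^ 2 ∂circleMeasure) := by
  obtain ⟨c, hc0, hc'⟩ := rigidity_remainder_of_ne_zero ha hp hμ hc hne
  refine ⟨c, hc0, fun ψ g h => ?_⟩
  obtain ⟨F, G, hFG, hF, hG⟩ := h.exists_approx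
  have l2 := hF.tendsto_integral_sq
  refine le_of_tendsto_of_tendsto' (((l2.sub (hF.tendsto_lpNormSq hp.1 hp.2.le)).pow 2).const_mul c)
    (l2.mul ((hF.circleEnergy hG hp.1 hp.2.le).sub (l2.const_mul _))) fun n => ?_
  exact hc' _ _ (hFG n).1 (hFG n).2.1 (hFG n).2.2

/-- Zero deficit gives `‖ψ‖₂ = ‖ψ‖ₚ` by `rigidity_remainder`, hence the kinetic energy is exactly
`a² ‖ψ‖₂²`. Since `(n - a)² > a²` for `n ≠ 0`, only the mode `0` survives. -/
theorem ae_eq_const_of_energy_eq {a p μ : ℝ} (ha : a ∈ Set.Icc (0 : ℝ) (1 / 2))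
    (hp : p ∈ Set.Ico (1 : ℝ) 2) (hμ : 0 < μ) (hc : μ * (2 - p) + 4 * a ^ 2 ≤ 1)
    (hne : ¬ (a = 0 ∧ p = 1 ∧ μ = 1)) {ψ g : S1 → ℂ} (h : IsH1Circle ψ g)
    (hE : circleEnergy a p μ ψ g = (a ^ 2 + μ) * ∫ x, ‖ψ x‖ ^ 2 ∂circleMeasure) :
    ∃ z : ℂ, ∀ᵐ x ∂circleMeasure, ψ x = z := by
  obtain ⟨c, hc0, hc'⟩ := rigidity_remainder ha hp hμ hc hne
  have h1 := hc' ψ g h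
  rw [hE, sub_self, mul_zero] at h1
  have h2 : (∫ x, ‖ψ x‖ ^ 2 ∂circleMeasure - lpNormSq circleMeasure p ψ) ^ 2 = 0 :=
    le_antisymm (by by_contra hlt; nlinarith [not_le.1 hlt]) (sq_nonneg _)
  have h3 := pow_eq_zero_iff (two_ne_zero) |>.1 h2
  have hK : ∫ x, ‖g x - Complex.I * (a : ℂ) * ψ x‖ ^ 2 ∂circleMeasure
      = a ^ 2 * ∫ x, ‖ψ x‖ ^ 2 ∂circleMeasure := by
    rw [circleEnergy] at hE
    linear_combination hE + μ * h3
  -- At `a = 1/2` the mode `1` would tie with the mode `0`; the condition `hc` excludes this because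
  -- `μ (2 - p) > 0`.
  have ha2 : a < 1 / 2 := by
    have : 0 < μ * (2 - p) := mul_pos hμ (by linarith [hp.2])
    nlinarith [ha.1, ha.2]
  have hs := (h.hasSum_kinetic a).sub ((hasSum_sq_fourierCoeff_circle h.memLp).mul_left (a ^ 2))
  rw [hK, sub_self] at hs
  have hn : ∀ n : ℤ, n ≠ 0 → 0 < ((n : ℝ) - a) ^ 2 - a ^ 2 := fun n hn => by
    have e : ((n : ℝ) - a) ^ 2 - a ^ 2 = n * (n - 2 * a) := by ring
    rw [e]
    rcases lt_or_gt_of_ne hn with h4 | h4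
    · have : (n : ℝ) ≤ -1 := by exact_mod_cast (by omega : n ≤ -1)
      nlinarith [ha.1]
    · have : (1 : ℝ) ≤ n := by exact_mod_cast h4
      exact mul_pos (by linarith) (by linarith)
  have hnn : ∀ n : ℤ, 0 ≤ ((n : ℝ) - a) ^ 2 * ‖fourierCoeff ψ n‖ ^ 2 - a ^ 2 * ‖fourierCoeff ψ n‖ ^ 2 :=
    fun n => by
    rw [← sub_mul]
    refine mul_nonneg ?_ (sq_nonneg _)
    rcases eq_or_ne n 0 with rfl | hn0
    · simp
    · exact (hn n hn0).le
  have hz := (hasSum_zero_iff_of_nonneg hnn).1 hs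
  have hcoef : ∀ n : ℤ, n ≠ 0 → fourierCoeff ψ n = 0 := fun n hn0 => by
    have := congrFun hz n
    simp only [Pi.zero_apply, ← sub_mul] at this
    have h5 := (mul_eq_zero.1 this).resolve_left (hn n hn0).ne'
    simpa using h5
  have h6 := hasSum_sq_sub_trig h.memLp {0}
  have h7 : ∫ x, ‖ψ x - trig {0} (fourierCoeff ψ) x‖ ^ 2 ∂circleMeasure = 0 := by
    refine h6.unique ?_
    convert hasSum_zero using 2 with n
    simp only [Finset.mem_singleton, ite_eq_left_iff]
    intro hn0
    simp [hcoef n hn0]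
  have hd : MemLp (fun x => ψ x - trig {0} (fourierCoeff ψ) x) 2 circleMeasure :=
    h.memLp.sub (memLp_of_continuous (continuous_trig _ _) _)
  rw [integral_eq_zero_iff_of_nonneg (fun x => sq_nonneg _) (by
    simpa using hd.integrable_norm_rpow (by norm_num) (by norm_num))] at h7
  refine ⟨fourierCoeff ψ 0, ?_⟩
  filter_upwards [h7] with x hx
  have h8 : ψ x - trig {0} (fourierCoeff ψ) x = 0 := by simpa using hx
  rw [sub_eq_zero.1 h8]
  simp [trig]

/-! ### The optimal constant on the circle -/

/-- Each constraint is a closed condition on `L`, void in `L` when `m i = 0`, so the supremum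
satisfies all of them. -/
theorem isGreatest_csSup_of_linear {ι : Type*} {P : ι → Prop} {m e : ι → ℝ}
    (hm : ∀ i, P i → 0 ≤ m i) (hne : {L : ℝ | ∀ i, P i → L * m i ≤ e i}.Nonempty)
    (hb : BddAbove {L : ℝ | ∀ i, P i → L * m i ≤ e i}) :
    IsGreatest {L : ℝ | ∀ i, P i → L * m i ≤ e i} (sSup {L : ℝ | ∀ i, P i → L * m i ≤ e i}) := by
  refine ⟨fun i hi => ?_, fun L hL => le_csSup hb hL⟩
  rcases (hm i hi).eq_or_lt with h0 | h0
  · obtain ⟨L, hL⟩ := hne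
    have := hL i hi
    rw [← h0, mul_zero] at this ⊢
    exact this
  · rw [← le_div_iff₀ h0]
    exact csSup_le hne fun L hL => by rw [le_div_iff₀ h0]; exact hL i hi

theorem lpNormSq_const {X : Type*} [MeasurableSpace X] {m : Measure X} [IsProbabilityMeasure m]
    {p : ℝ} (hp : p ≠ 0) (z : ℂ) : lpNormSq m p (fun _ => z) = ‖z‖ ^ 2 := by
  rw [lpNormSq]
  simp only [integral_const, probReal_univ, one_smul]
  rw [← Real.rpow_mul (norm_nonneg _), mul_div_cancel₀ _ hp]
  exact Real.rpow_two _

theorem circleEnergy_const {p : ℝ} (hp : p ≠ 0) (a μ : ℝ) (z : ℂ) :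
    circleEnergy a p μ (fun _ => z) (fun _ => 0) = (a ^ 2 + μ) * ‖z‖ ^ 2 := by
  rw [circleEnergy, lpNormSq_const hp]
  simp [mul_pow]
  ring

theorem isH1Circle_const (z : ℂ) : IsH1Circle (fun _ => z) fun _ => 0 :=
  HasCircleDeriv.isH1Circle (fun _ => hasDerivAt_const _ _) continuous_const

theorem le_of_mem_circleConstants {a p μ L : ℝ} (hp : 1 ≤ p) (h : L ∈ circleConstants a p μ) :
    L ≤ a ^ 2 + μ := by
  have := h _ _ (isH1Circle_const 1)
  rw [circleEnergy_const (by linarith)] at this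
  simpa using this

theorem isGreatest_circleOptimal {a p μ : ℝ} (hp : 1 ≤ p) (hμ : 0 < μ) :
    IsGreatest (circleConstants a p μ) (circleOptimal a p μ) := by
  have e : circleConstants a p μ = {L : ℝ | ∀ i : (S1 → ℂ) × (S1 → ℂ), IsH1Circle i.1 i.2 →
      L * ∫ θ, ‖i.1 θ‖ ^ 2 ∂circleMeasure ≤ circleEnergy a p μ i.1 i.2} :=
    Set.ext fun L => ⟨fun h i hi => h i.1 i.2 hi, fun h ψ g hi => h (ψ, g) hi⟩
  have hb : BddAbove (circleConstants a p μ) := ⟨a ^ 2 + μ, fun L hL => le_of_mem_circleConstants hp hL⟩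
  have hne : (circleConstants a p μ).Nonempty := ⟨0, fun ψ g _ => by
    rw [zero_mul]
    exact add_nonneg (integral_nonneg fun _ => sq_nonneg _) (mul_nonneg hμ.le (lpNormSq_nonneg _ _ _))⟩
  rw [circleOptimal]
  rw [e] at hb hne ⊢
  exact isGreatest_csSup_of_linear (fun i _ => integral_nonneg fun _ => sq_nonneg _) hne hb

theorem circleOptimal_le {a p μ : ℝ} (hp : 1 ≤ p) (hμ : 0 < μ) : circleOptimal a p μ ≤ a ^ 2 + μ :=
  le_of_mem_circleConstants hp (isGreatest_circleOptimal hp hμ).1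

/-! ### Second variation at the constant function -/

/-- Second-order Taylor upper bound with an explicit cubic error, through `exp (r log (1 + X))` and
the known remainders of `log` and `exp`. -/
theorem one_add_rpow_le {r X : ℝ} (hr0 : 0 ≤ r) (hr1 : r ≤ 1) (hX : |X| ≤ 1 / 2) :
    (1 + X) ^ r ≤ 1 + r * X - r * (1 - r) / 2 * X ^ 2 + 7 * |X| ^ 3 := by
  have hX' := abs_le.1 hX
  have hlog := Real.abs_log_sub_add_sum_range_le (x := -X) (by rw [abs_neg]; linarith) 2
  simp only [Finset.sum_range_succ, Finset.sum_range_zero, abs_neg, sub_neg_eq_add] at hlog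
  norm_num at hlog
  set t := |X| with ht
  have ht0 : 0 ≤ t := abs_nonneg X
  have htX : X ^ 2 = t ^ 2 := (sq_abs X).symm
  have hfrac : t ^ 3 / (1 - t) ≤ 2 * t ^ 3 := by
    rw [div_le_iff₀ (by linarith)]
    nlinarith [pow_nonneg ht0 3]
  set w := Real.log (1 + X) - X with hw
  have hw1 : |w| ≤ 3 / 2 * t ^ 2 := by
    have h1 := abs_le.1 (hlog.trans hfrac)
    have h3 : t ^ 3 ≤ t ^ 2 / 2 := by nlinarith [sq_nonneg t]
    rw [abs_le]
    constructor <;> rw [hw] <;> nlinarith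
  have hw2 : w ≤ -(X ^ 2 / 2) + 2 * t ^ 3 := by
    have h1 := (abs_le.1 (hlog.trans hfrac)).2
    rw [hw]; linarith
  have hz : |r * (X + w)| ≤ 2 * t := by
    rw [abs_mul, abs_of_nonneg hr0]
    have h1 : |X + w| ≤ 2 * t := (abs_add_le X w).trans (by nlinarith)
    have := mul_le_mul hr1 h1 (abs_nonneg _) zero_le_one
    linarith
  have he := Real.exp_bound (x := r * (X + w)) (hz.trans (by linarith)) (n := 3) (by norm_num)
  simp only [Finset.sum_range_succ, Finset.sum_range_zero, Nat.factorial] at he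
  norm_num at he
  have hz3 : |r * (X + w)| ^ 3 ≤ 8 * t ^ 3 := by
    have := pow_le_pow_left₀ (abs_nonneg _) hz 3
    linarith [this, (by ring : (2 * t) ^ 3 = 8 * t ^ 3)]
  have he2 := (abs_le.1 he).2
  have e : (1 + X) ^ r = Real.exp (r * (X + w)) := by
    rw [Real.rpow_def_of_pos (by linarith), hw]
    congr 1
    ring
  rw [← abs_mul] at he2
  have hsq : (X + w) ^ 2 ≤ X ^ 2 + 21 / 4 * t ^ 3 := by
    have h1 : X * w ≤ t * (3 / 2 * t ^ 2) := by
      calc X * w ≤ |X * w| := le_abs_self _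
        _ = t * |w| := abs_mul _ _
        _ ≤ _ := mul_le_mul_of_nonneg_left hw1 ht0
    have h2 : w ^ 2 ≤ (3 / 2 * t ^ 2) ^ 2 := by
      rw [← sq_abs w]; exact pow_le_pow_left₀ (abs_nonneg _) hw1 2
    have h3 : t ^ 4 ≤ t ^ 3 / 2 := by nlinarith [pow_nonneg ht0 3]
    nlinarith [pow_nonneg ht0 3]
  have hrsq : r ^ 2 * (X + w) ^ 2 ≤ r ^ 2 * X ^ 2 + 21 / 4 * t ^ 3 := by
    have h1 := mul_le_mul_of_nonneg_left hsq (sq_nonneg r)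
    have h2 : r ^ 2 * (21 / 4 * t ^ 3) ≤ 21 / 4 * t ^ 3 :=
      mul_le_of_le_one_left (by positivity) (pow_le_one₀ hr0 hr1)
    linarith
  have hrw : r * w ≤ r * -(X ^ 2 / 2) + 2 * t ^ 3 := by
    have h1 := mul_le_mul_of_nonneg_left hw2 hr0
    have h2 : r * (2 * t ^ 3) ≤ 2 * t ^ 3 := mul_le_of_le_one_left (by positivity) hr1
    linarith
  rw [e]
  nlinarith [pow_nonneg ht0 3]

/-- Bernoulli's inequality for the exponent `s - 1`, multiplied by `1 + Y`. -/
theorem one_add_rpow_le_of_mem_Icc {s Y : ℝ} (hs1 : 1 ≤ s) (hs2 : s ≤ 2) (hY : 0 ≤ Y) :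
    (1 + Y) ^ s ≤ 1 + s * Y + Y ^ 2 := by
  have h1 := rpow_one_add_le_one_add_mul_self (s := Y) (by linarith) (p := s - 1) (by linarith)
    (by linarith)
  have e : (1 + Y) ^ s = (1 + Y) * (1 + Y) ^ (s - 1) := by
    rw [Real.rpow_sub_one (by linarith)]
    field_simp
  rw [e]
  have := mul_le_mul_of_nonneg_left h1 (by linarith : 0 ≤ 1 + Y)
  nlinarith [sq_nonneg Y]

/-- The coefficients of the perturbation `1 + ε (cos y + 2 i a sin y)` of the constant `1`. -/
noncomputable def perturbCoeff (a ε : ℝ) (n : ℤ) : ℂ :=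
  if n = 0 then 1 else if n = 1 then ((ε * (1 / 2 + a) : ℝ) : ℂ) else ((ε * (1 / 2 - a) : ℝ) : ℂ)

theorem integral_fourier_re_sq :
    ∫ x : S1, (fourier 1 x : ℂ).re ^ 2 ∂circleMeasure = 1 / 2 := by
  have h := hasCircleDeriv_fourier 1
  have e : ∀ x : S1, (fourier 1 x : ℂ).re ^ 2 = 1 / 2 + 1 / 2 * (fourier 2 x : ℂ).re := fun x => by
    have h1 := norm_fourier 1 x
    have h2 : (fourier 2 x : ℂ) = fourier 1 x * fourier 1 x := by
      rw [← fourier_add]; rfl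
    have h3 : (fourier 1 x : ℂ).re * (fourier 1 x : ℂ).re + (fourier 1 x : ℂ).im * (fourier 1 x : ℂ).im
        = 1 := by
      rw [← Complex.normSq_apply, Complex.normSq_eq_norm_sq, h1, one_pow]
    rw [h2, Complex.mul_re]
    linarith
  have c2 := continuous_fourier 2
  have h0 : ∫ x : S1, (fourier 2 x : ℂ).re ∂circleMeasure = 0 := by
    have := integral_re (integrable_of_continuous (m := circleMeasure) c2)
    refine this.trans ?_
    rw [integral_fourier]
    simp
  simp only [e]
  rw [integral_add (integrable_const _) (integrable_of_continuous (by fun_prop)), integral_const_mul,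
    h0]
  simp

theorem perturb_rpow_le {a p ε : ℝ} (hp : p ∈ Set.Ico (1 : ℝ) 2) (h4a : 4 * a ^ 2 ≤ 1)
    (hε0 : 0 < ε) (hε : ε ≤ 1 / 6) :
    (1 + (ε ^ 2 * (p / 2 * (1 / 2 + 2 * a ^ 2) - p / 2 * (1 - p / 2)) + 190 * ε ^ 3)) ^ (2 / p)
      ≤ 1 + ε ^ 2 * (2 * a ^ 2 + (p - 1) / 2) + 40000 * ε ^ 3 := by
  obtain ⟨hp1, hp2⟩ := hp
  have h2p : 2 / p = 1 / (p / 2) := by field_simp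
  have hpr : p = 2 * (p / 2) := by ring
  rw [h2p]
  generalize hY : ε ^ 2 * (p / 2 * (1 / 2 + 2 * a ^ 2) - p / 2 * (1 - p / 2)) + 190 * ε ^ 3 = Y
  generalize hr : p / 2 = r at *
  have hr0 : 0 < r := by linarith
  have hr1 : r ≤ 1 := by linarith
  have hr2 : 1 / 2 ≤ r := by linarith
  have hε3 := pow_pos hε0 3
  have hk0 : 0 ≤ r * (1 / 2 + 2 * a ^ 2) - r * (1 - r) := by
    have : 0 ≤ r * (2 * a ^ 2 + (r - 1 / 2)) := mul_nonneg hr0.le (by nlinarith [sq_nonneg a])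
    linarith
  have hk1 : r * (1 / 2 + 2 * a ^ 2) - r * (1 - r) ≤ 1 := by
    have : r * (2 * a ^ 2 + (r - 1 / 2)) ≤ 1 * 1 :=
      mul_le_mul hr1 (by nlinarith) (by nlinarith [sq_nonneg a]) zero_le_one
    linarith
  have hY0 : 0 ≤ Y := by
    have := mul_nonneg (sq_nonneg ε) hk0
    rw [← hY]; linarith
  have hY1 : Y ≤ 191 * ε ^ 2 := by
    have h1 := mul_le_mul_of_nonneg_left hk1 (sq_nonneg ε)
    have h2 : ε ^ 3 ≤ ε ^ 2 := pow_le_pow_of_le_one hε0.le (by linarith) (by norm_num)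
    rw [← hY]; linarith
  have hY2 : Y ^ 2 ≤ 39000 * ε ^ 3 := by
    have h1 := pow_le_pow_left₀ hY0 hY1 2
    have h2 : ε ^ 4 ≤ ε ^ 3 := pow_le_pow_of_le_one hε0.le (by linarith) (by norm_num)
    have h3 : (191 * ε ^ 2) ^ 2 = 36481 * ε ^ 4 := by ring
    linarith
  have hs1 : 1 ≤ 1 / r := by rw [le_div_iff₀ hr0]; linarith
  have hs2 : 1 / r ≤ 2 := by rw [div_le_iff₀ hr0]; linarith
  refine (one_add_rpow_le_of_mem_Icc hs1 hs2 hY0).trans ?_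
  have e : 1 / r * Y = ε ^ 2 * (2 * a ^ 2 + (p - 1) / 2) + 190 * (1 / r) * ε ^ 3 := by
    rw [← hY, hpr]
    field_simp
    ring
  have h2 : 190 * (1 / r) * ε ^ 3 ≤ 190 * 2 * ε ^ 3 :=
    mul_le_mul_of_nonneg_right (by linarith) hε3.le
  rw [e]
  linarith

/-- Expand `|ψ|²` to second order in `ε`, raise to the power `p / 2`, average, and raise to the
power `2 / p`; only an upper bound with a cubic error is needed. -/
theorem lpNormSq_perturb_le {a p ε : ℝ} (ha : a ∈ Set.Icc (0 : ℝ) (1 / 2)) (hp : p ∈ Set.Ico (1 : ℝ) 2)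
    (hε0 : 0 < ε) (hε : ε ≤ 1 / 6) :
    lpNormSq circleMeasure p (trig {-1, 0, 1} (perturbCoeff a ε))
      ≤ 1 + ε ^ 2 * (2 * a ^ 2 + (p - 1) / 2) + 40000 * ε ^ 3 := by
  obtain ⟨ha0, ha1⟩ := ha
  obtain ⟨hp1, hp2⟩ := hp
  set r := p / 2 with hr
  let C : S1 → ℝ := fun x => (fourier 1 x : ℂ).re
  let D : S1 → ℝ := fun x => (fourier 1 x : ℂ).im
  have cC : Continuous C := Complex.continuous_re.comp (continuous_fourier 1)
  have hCD : ∀ x, C x * C x + D x * D x = 1 := fun x => by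
    rw [← Complex.normSq_apply, Complex.normSq_eq_norm_sq, norm_fourier, one_pow]
  have hψ : ∀ x, ‖trig {-1, 0, 1} (perturbCoeff a ε) x‖ ^ 2
      = 1 + (2 * ε * C x + ε ^ 2 * (C x ^ 2 + 4 * a ^ 2 * D x ^ 2)) := fun x => by
    have h1 : trig {-1, 0, 1} (perturbCoeff a ε) x
        = ((1 + ε * C x : ℝ) : ℂ) + ((2 * a * ε * D x : ℝ) : ℂ) * Complex.I := by
      have e0 : (fourier 0 x : ℂ) = 1 := fourier_zero
      have e1 : (fourier 1 x : ℂ) = (C x : ℂ) + (D x : ℂ) * Complex.I := (Complex.re_add_im _).symm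
      have e2 : (fourier (-1) x : ℂ) = (C x : ℂ) - (D x : ℂ) * Complex.I := by
        rw [fourier_neg, e1]; simp; ring
      rw [trig, Finset.sum_insert (by decide), Finset.sum_insert (by decide), Finset.sum_singleton,
        e0, e1, e2]
      simp only [perturbCoeff]
      norm_num
      ring
    rw [h1, Complex.sq_norm, Complex.normSq_add_mul_I]
    ring
  have hC1 : ∀ x, |C x| ≤ 1 := fun x => abs_le_one_iff_mul_self_le_one.2
    (by nlinarith [hCD x, mul_self_nonneg (D x)])
  have h4a : 4 * a ^ 2 ≤ 1 := by nlinarith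
  let Q : S1 → ℝ := fun x => C x ^ 2 + 4 * a ^ 2 * D x ^ 2
  have hQ0 : ∀ x, 0 ≤ Q x := fun x => by positivity
  have hQ1 : ∀ x, Q x ≤ 1 := fun x => by nlinarith [hCD x, sq_nonneg (D x)]
  have hr0 : 0 < r := by rw [hr]; linarith
  have hr1 : r ≤ 1 := by rw [hr]; linarith
  have hr2 : 1 / 2 ≤ r := by rw [hr]; linarith
  have hpt : ∀ x, ‖trig {-1, 0, 1} (perturbCoeff a ε) x‖ ^ p
      ≤ 1 + r * (2 * ε * C x + ε ^ 2 * (4 * a ^ 2 + (1 - 4 * a ^ 2) * C x ^ 2))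
        - 2 * r * (1 - r) * ε ^ 2 * C x ^ 2 + 190 * ε ^ 3 := fun x => by
    have h1 : ‖trig {-1, 0, 1} (perturbCoeff a ε) x‖ ^ p
        = (1 + (2 * ε * C x + ε ^ 2 * Q x)) ^ r := by
      rw [← hψ, ← Real.rpow_natCast, ← Real.rpow_mul (norm_nonneg _)]
      congr 1
      rw [hr]; push_cast; ring
    have h2 : |2 * ε * C x + ε ^ 2 * Q x| ≤ 3 * ε := by
      obtain ⟨hc1, hc2⟩ := abs_le.1 (hC1 x)
      have := hQ0 x; have := hQ1 x
      have h5 : 0 ≤ ε ^ 2 * Q x := by positivity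
      have h6 : ε ^ 2 * Q x ≤ ε := by nlinarith
      rw [abs_le]
      constructor <;> nlinarith
    -- The bound `ε ≤ 1/6` makes `3ε ≤ 1/2`. The cubic error is at most `7 * 27 + 1/2 ≤ 190` times
    -- `ε³`.
    have h3 := one_add_rpow_le hr0.le hr1 (h2.trans (by linarith))
    have h4 := pow_le_pow_left₀ (abs_nonneg _) h2 3
    have h5 : (2 * ε * C x + ε ^ 2 * Q x) ^ 2 ≥ 4 * ε ^ 2 * C x ^ 2 - 4 * ε ^ 3 := by
      obtain ⟨hc1, hc2⟩ := abs_le.1 (hC1 x)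
      have h6 : -1 ≤ C x * Q x := by nlinarith [hQ0 x, hQ1 x]
      have h7 : 0 ≤ (ε ^ 2 * Q x) ^ 2 := sq_nonneg _
      have h8 : 0 ≤ ε ^ 3 * (1 + C x * Q x) := mul_nonneg (by positivity) (by linarith)
      nlinarith
    have h6 : 0 ≤ r * (1 - r) / 2 := by
      have : 0 ≤ 1 - r := by linarith
      positivity
    have h6' : r * (1 - r) / 2 ≤ 1 / 8 := by nlinarith [sq_nonneg (r - 1 / 2)]
    have h7 := mul_le_mul_of_nonneg_left h5 h6
    have h8 : r * (1 - r) / 2 * (4 * ε ^ 3) ≤ 1 / 8 * (4 * ε ^ 3) :=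
      mul_le_mul_of_nonneg_right h6' (by positivity)
    have e9 : Q x = 4 * a ^ 2 + (1 - 4 * a ^ 2) * C x ^ 2 := by
      simp only [Q]
      linear_combination (4 * a ^ 2) * hCD x
    rw [h1]
    rw [← e9]
    have e10 : (3 * ε) ^ 3 = 27 * ε ^ 3 := by ring
    have := pow_pos hε0 3
    nlinarith
  set ψ := trig {-1, 0, 1} (perturbCoeff a ε) with hψdef
  have cψ : Continuous ψ := continuous_trig _ _
  have hC0 : ∫ x, C x ∂circleMeasure = 0 := by
    have := integral_re (integrable_of_continuous (m := circleMeasure) (continuous_fourier 1))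
    refine this.trans ?_
    rw [integral_fourier]
    simp
  have hC2 : ∫ x, C x ^ 2 ∂circleMeasure = 1 / 2 := integral_fourier_re_sq
  set Y := ε ^ 2 * (p / 2 * (1 / 2 + 2 * a ^ 2) - p / 2 * (1 - p / 2)) + 190 * ε ^ 3 with hY
  have hint : ∫ x, ‖ψ x‖ ^ p ∂circleMeasure ≤ 1 + Y := by
    have h1 := integral_mono (μ := circleMeasure)
      (integrable_of_continuous (cψ.norm.rpow_const fun x => .inr (by linarith)))
      (integrable_of_continuous (by fun_prop)) hpt
    refine h1.trans_eq ?_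
    have e : ∀ x, 1 + r * (2 * ε * C x + ε ^ 2 * (4 * a ^ 2 + (1 - 4 * a ^ 2) * C x ^ 2))
        - 2 * r * (1 - r) * ε ^ 2 * C x ^ 2 + 190 * ε ^ 3
        = (1 + 4 * a ^ 2 * r * ε ^ 2 + 190 * ε ^ 3) + (2 * r * ε * C x
          + (r * ε ^ 2 * (1 - 4 * a ^ 2) - 2 * r * (1 - r) * ε ^ 2) * C x ^ 2) := fun x => by ring
    simp only [e]
    have eK : 1 + Y = (1 + 4 * a ^ 2 * r * ε ^ 2 + 190 * ε ^ 3) + (2 * r * ε * 0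
        + (r * ε ^ 2 * (1 - 4 * a ^ 2) - 2 * r * (1 - r) * ε ^ 2) * (1 / 2)) := by
      rw [hY]; ring
    rw [eK]
    generalize 1 + 4 * a ^ 2 * r * ε ^ 2 + 190 * ε ^ 3 = K
    rw [integral_add (integrable_const _) (integrable_of_continuous (by fun_prop)),
      integral_add (integrable_of_continuous (by fun_prop)) (integrable_of_continuous (by fun_prop)),
      integral_const_mul, integral_const_mul, hC0, hC2]
    simp only [integral_const, probReal_univ, one_smul]
  rw [lpNormSq]
  exact (Real.rpow_le_rpow (integral_nonneg fun x => Real.rpow_nonneg (norm_nonneg (ψ x)) p)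
    hint (by positivity)).trans (perturb_rpow_le ⟨hp1, hp2⟩ h4a hε0 hε)

/-- The coefficients `1/2 ± a` come from adding to `cos y` the imaginary part that minimizes the
second variation. Along this perturbation, energy minus `a² + μ` times mass is at most `-ε² d / 2`
plus a cubic error. -/
theorem notMem_circleConstants {a p μ : ℝ} (ha : a ∈ Set.Icc (0 : ℝ) (1 / 2))
    (hp : p ∈ Set.Ico (1 : ℝ) 2) (hμ : 0 < μ) (hc : 1 < μ * (2 - p) + 4 * a ^ 2) :
    a ^ 2 + μ ∉ circleConstants a p μ := by
  intro hmem
  set d := μ * (2 - p) + 4 * a ^ 2 - 1 with hd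
  have hd0 : 0 < d := by linarith
  -- The gain `ε² d / 2` must beat `40000 μ ε³`, so any constant above `80000` would do.
  set ε := min (1 / 6) (d / (100000 * μ)) with hε
  have hε0 : 0 < ε := by positivity
  have hε1 : ε ≤ 1 / 6 := min_le_left _ _
  have hε2 : ε * (100000 * μ) ≤ d := (le_div_iff₀ (by positivity)).1 (min_le_right _ _)
  have hH : IsH1Circle (trig {-1, 0, 1} (perturbCoeff a ε)) (trig {-1, 0, 1} (derivCoeff (perturbCoeff a ε))) :=
    (trig_hasCircleDeriv _ _).isH1Circle (continuous_trig _ _)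
  have h1 := hmem _ _ hH
  have hl := mul_le_mul_of_nonneg_left (lpNormSq_perturb_le ha hp hε0 hε1) hμ.le
  have hk : ∀ x, trig {-1, 0, 1} (derivCoeff (perturbCoeff a ε)) x
      - Complex.I * (a : ℂ) * trig {-1, 0, 1} (perturbCoeff a ε) x
      = trig {-1, 0, 1} (fun n => Complex.I * (((n : ℝ) - a : ℝ) : ℂ) * perturbCoeff a ε n) x := fun x => by
    simp only [trig, Finset.mul_sum, ← Finset.sum_sub_distrib]
    refine Finset.sum_congr rfl fun n _ => ?_
    simp only [derivCoeff]
    push_cast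
    ring
  rw [circleEnergy] at h1
  simp only [hk] at h1
  rw [integral_norm_sq_trig, integral_norm_sq_trig] at h1
  have n0 : ‖perturbCoeff a ε 0‖ ^ 2 = 1 := by simp [perturbCoeff]
  have n1 : ‖perturbCoeff a ε 1‖ ^ 2 = (ε * (1 / 2 + a)) ^ 2 := by
    rw [perturbCoeff, if_neg one_ne_zero, if_pos rfl, Complex.norm_real, Real.norm_eq_abs, sq_abs]
  have n2 : ‖perturbCoeff a ε (-1)‖ ^ 2 = (ε * (1 / 2 - a)) ^ 2 := by
    rw [perturbCoeff, if_neg (by decide), if_neg (by decide), Complex.norm_real, Real.norm_eq_abs,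
      sq_abs]
  have nk : ∀ n : ℤ, ‖Complex.I * (((n : ℝ) - a : ℝ) : ℂ) * perturbCoeff a ε n‖ ^ 2
      = ((n : ℝ) - a) ^ 2 * ‖perturbCoeff a ε n‖ ^ 2 := fun n => by
    rw [norm_mul, norm_mul, Complex.norm_I, one_mul, Complex.norm_real, mul_pow, Real.norm_eq_abs,
      sq_abs]
  simp only [nk] at h1
  rw [Finset.sum_insert (by decide), Finset.sum_insert (by decide), Finset.sum_singleton,
    Finset.sum_insert (by decide), Finset.sum_insert (by decide), Finset.sum_singleton,
    n0, n1, n2] at h1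
  push_cast at h1
  have h2 : ε ^ 2 * d ≤ 2 * (μ * (40000 * ε ^ 3)) := by
    rw [hd]
    linear_combination 2 * h1 + 2 * hl
  have h3 : ε ^ 2 * (ε * (100000 * μ)) ≤ ε ^ 2 * d := mul_le_mul_of_nonneg_left hε2 (sq_nonneg ε)
  have h4 : 0 < μ * ε ^ 3 := by positivity
  nlinarith

theorem circleOptimal_eq_iff {a p μ : ℝ} (ha : a ∈ Set.Icc (0 : ℝ) (1 / 2))
    (hp : p ∈ Set.Ico (1 : ℝ) 2) (hμ : 0 < μ) :
    circleOptimal a p μ = a ^ 2 + μ ↔ μ * (2 - p) + 4 * a ^ 2 ≤ 1 := by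
  have hg := isGreatest_circleOptimal (a := a) hp.1 hμ
  constructor
  · intro h
    by_contra hlt
    refine notMem_circleConstants ha hp hμ (not_le.1 hlt) ?_
    rw [← h]
    exact hg.1
  · intro h
    exact le_antisymm (circleOptimal_le hp.1 hμ) (hg.2 (rigidity ha hp hμ h))

/-! ### Fourier series on the torus -/

theorem HasSum.of_eq {ι : Type*} {f g : ι → ℝ} {r : ℝ} (hf : HasSum f r) (h : ∀ i, f i = g i) :
    HasSum g r :=
  funext h ▸ hf

/-- The `k`-th Fourier coefficient in the variable `x`, as a function of `y`. -/
noncomputable def sliceCoeff (f : T2 → ℂ) (k : ℤ) (y : S1) : ℂ :=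
  ∫ x, (fourier (-k) x : ℂ) * f (x, y) ∂circleMeasure

/-- The Fourier coefficients of a function on the torus. -/
noncomputable def torusCoeff (f : T2 → ℂ) (q : ℤ × ℤ) : ℂ :=
  ∫ z, (fourier (-q.1) z.1 : ℂ) * fourier (-q.2) z.2 * f z ∂torusMeasure

theorem continuous_fourier_mul_fourier (q : ℤ × ℤ) :
    Continuous fun z : T2 => (fourier q.1 z.1 : ℂ) * fourier q.2 z.2 :=
  ((continuous_fourier q.1).comp continuous_fst).mul ((continuous_fourier q.2).comp continuous_snd)

theorem norm_fourier_mul_fourier (q : ℤ × ℤ) (z : T2) :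
    ‖(fourier q.1 z.1 : ℂ) * fourier q.2 z.2‖ = 1 := by
  rw [norm_mul, norm_fourier, norm_fourier, one_mul]

theorem integrable_norm_sq {X : Type*} [MeasurableSpace X] {m : Measure X} {f : X → ℂ}
    (hf : MemLp f 2 m) : Integrable (fun x => ‖f x‖ ^ 2) m := by
  simpa using hf.integrable_norm_rpow (by norm_num) (by norm_num)

theorem MemLp.slice_ae {f : T2 → ℂ} (hf : MemLp f 2 torusMeasure) :
    ∀ᵐ y ∂circleMeasure, MemLp (fun x => f (x, y)) 2 circleMeasure := by
  have h1 := (integrable_norm_sq hf).prod_left_ae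
  have h2 : ∀ᵐ y ∂circleMeasure, AEStronglyMeasurable (fun x => f (x, y)) circleMeasure :=
    hf.1.prod_swap.prodMk_left
  filter_upwards [h1, h2] with y h3 h4
  exact (memLp_two_iff_integrable_sq_norm h4).2 h3

theorem hasSum_sq_sliceCoeff {f : T2 → ℂ} (hf : MemLp f 2 torusMeasure) :
    ∀ᵐ y ∂circleMeasure, HasSum (fun k => ‖sliceCoeff f k y‖ ^ 2)
      (∫ x, ‖f (x, y)‖ ^ 2 ∂circleMeasure) := by
  filter_upwards [MemLp.slice_ae hf] with y hy
  exact hasSum_sq_fourierCoeff_circle hy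

theorem integrable_fourier_mul {f : T2 → ℂ} (hf : MemLp f 2 torusMeasure) (q : ℤ × ℤ) :
    Integrable (fun z : T2 => (fourier q.1 z.1 : ℂ) * fourier q.2 z.2 * f z) torusMeasure :=
  (hf.integrable (by norm_num)).bdd_mul (continuous_fourier_mul_fourier q).aestronglyMeasurable
    (.of_forall fun z => (norm_fourier_mul_fourier q z).le)

theorem memLp_sliceCoeff {f : T2 → ℂ} (hf : MemLp f 2 torusMeasure) (k : ℤ) :
    MemLp (sliceCoeff f k) 2 circleMeasure := by
  have hi : Integrable (fun z : T2 => (fourier (-k) z.1 : ℂ) * f z) torusMeasure := by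
    simpa using integrable_fourier_mul hf (-k, 0)
  have hm : AEStronglyMeasurable (sliceCoeff f k) circleMeasure := hi.integral_prod_right.1
  refine (memLp_two_iff_integrable_sq_norm hm).2 ?_
  refine Integrable.mono' (integrable_norm_sq hf).integral_prod_right (hm.norm.pow 2) ?_
  filter_upwards [hasSum_sq_sliceCoeff hf] with y hy
  rw [Real.norm_of_nonneg (by positivity)]
  exact le_hasSum hy k fun j _ => by positivity

theorem fourierCoeff_sliceCoeff {f : T2 → ℂ} (hf : MemLp f 2 torusMeasure) (q : ℤ × ℤ) :
    fourierCoeff (sliceCoeff f q.1) q.2 = torusCoeff f q := by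
  have h := integral_prod_symm _ (integrable_fourier_mul hf (-q.1, -q.2))
  refine Eq.trans ?_ h.symm
  refine integral_congr_ae (.of_forall fun y => ?_)
  simp only [sliceCoeff, smul_eq_mul, ← integral_const_mul]
  refine integral_congr_ae (.of_forall fun x => ?_)
  simp only
  ring

theorem hasSum_integral_sq_sliceCoeff {f : T2 → ℂ} (hf : MemLp f 2 torusMeasure) :
    HasSum (fun k => ∫ y, ‖sliceCoeff f k y‖ ^ 2 ∂circleMeasure) (∫ z, ‖f z‖ ^ 2 ∂torusMeasure) := by
  have e : ∫ z, ‖f z‖ ^ 2 ∂torusMeasure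
      = ∫ y, ∫ x, ‖f (x, y)‖ ^ 2 ∂circleMeasure ∂circleMeasure :=
    integral_prod_symm _ (integrable_norm_sq hf)
  have hs := hasSum_sq_sliceCoeff hf
  rw [e]
  refine hasSum_integral_of_dominated_convergence (fun k y => ‖sliceCoeff f k y‖ ^ 2)
    (fun k => (memLp_sliceCoeff hf k).1.norm.pow 2) (fun k => .of_forall fun y => ?_) ?_ ?_ hs
  · rw [Real.norm_of_nonneg (by positivity)]
  · filter_upwards [hs] with y hy using hy.summable
  · refine (integrable_norm_sq hf).integral_prod_right.congr ?_
    filter_upwards [hs] with y hy using hy.tsum_eq.symm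

/-- Parseval in `x` on almost every slice, then Parseval in `y` for each slice coefficient. -/
theorem hasSum_sq_torusCoeff {f : T2 → ℂ} (hf : MemLp f 2 torusMeasure) :
    HasSum (fun q => ‖torusCoeff f q‖ ^ 2) (∫ z, ‖f z‖ ^ 2 ∂torusMeasure) := by
  have h1 : ∀ k, HasSum (fun l => ‖torusCoeff f (k, l)‖ ^ 2)
      (∫ y, ‖sliceCoeff f k y‖ ^ 2 ∂circleMeasure) := fun k => by
    have := hasSum_sq_fourierCoeff_circle (memLp_sliceCoeff hf k)
    simpa only [fun l => fourierCoeff_sliceCoeff hf (k, l)] using this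
  have h2 := hasSum_integral_sq_sliceCoeff hf
  have hs : Summable fun q => ‖torusCoeff f q‖ ^ 2 := by
    refine (summable_prod_of_nonneg fun q => by positivity).2 ⟨fun k => (h1 k).summable, ?_⟩
    simpa only [(h1 _).tsum_eq] using h2.summable
  have h3 := hs.hasSum.prod_fiberwise h1
  rw [h2.unique h3]
  exact hs.hasSum

theorem torusCoeff_sub_mul {f g : T2 → ℂ} (hf : MemLp f 2 torusMeasure)
    (hg : MemLp g 2 torusMeasure) (w : ℂ) (q : ℤ × ℤ) :
    torusCoeff (fun z => g z - w * f z) q = torusCoeff g q - w * torusCoeff f q := by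
  rw [torusCoeff, torusCoeff, torusCoeff, ← integral_const_mul,
    ← integral_sub (integrable_fourier_mul hg (-q.1, -q.2))
      ((integrable_fourier_mul hf (-q.1, -q.2)).const_mul w)]
  refine integral_congr_ae (.of_forall fun z => ?_)
  simp only
  ring

theorem ae_eq_of_torusCoeff_eq {f g : T2 → ℂ} (hf : MemLp f 2 torusMeasure)
    (hg : MemLp g 2 torusMeasure) (h : ∀ q, torusCoeff f q = torusCoeff g q) :
    ∀ᵐ z ∂torusMeasure, f z = g z := by
  have hd : MemLp (fun z => g z - 1 * f z) 2 torusMeasure := hg.sub (hf.const_mul 1)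
  have e : ∀ q, ‖torusCoeff (fun z => g z - 1 * f z) q‖ ^ 2 = 0 := fun q => by
    rw [torusCoeff_sub_mul hf hg, h, one_mul, sub_self, norm_zero, sq, mul_zero]
  have h1 := HasSum.of_eq (hasSum_sq_torusCoeff hd) e
  have h2 := (integral_eq_zero_iff_of_nonneg (fun z => by positivity) (integrable_norm_sq hd)).1
    (h1.unique hasSum_zero)
  filter_upwards [h2] with z hz
  have h8 : g z - 1 * f z = 0 := norm_eq_zero.1 (pow_eq_zero_iff two_ne_zero |>.1 hz)
  rw [one_mul] at h8
  exact (sub_eq_zero.1 h8).symm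

/-- The trigonometric polynomial `∑ c_{kl} e^{i(kx+ly)}` on the torus. -/
noncomputable def torusTrig (s : Finset (ℤ × ℤ)) (c : ℤ × ℤ → ℂ) (z : T2) : ℂ :=
  ∑ q ∈ s, c q * ((fourier q.1 z.1 : ℂ) * fourier q.2 z.2)

theorem continuous_torusTrig (s : Finset (ℤ × ℤ)) (c : ℤ × ℤ → ℂ) : Continuous (torusTrig s c) :=
  continuous_finsetSum _ fun q _ => continuous_const.mul (continuous_fourier_mul_fourier q)

theorem torusTrig_hasCircleDeriv_fst (s : Finset (ℤ × ℤ)) (c : ℤ × ℤ → ℂ) (y : S1) :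
    HasCircleDeriv (fun x => torusTrig s c (x, y))
      fun x => torusTrig s (fun q => Complex.I * q.1 * c q) (x, y) := fun t =>
  HasDerivAt.fun_sum fun q _ => ((((hasCircleDeriv_fourier q.1) t).mul_const
    (fourier q.2 y : ℂ)).const_mul (c q)).congr_deriv (by simp only; ring)

theorem torusTrig_hasCircleDeriv_snd (s : Finset (ℤ × ℤ)) (c : ℤ × ℤ → ℂ) (x : S1) :
    HasCircleDeriv (fun y => torusTrig s c (x, y))
      fun y => torusTrig s (fun q => Complex.I * q.2 * c q) (x, y) := fun t =>
  HasDerivAt.fun_sum fun q _ => ((((hasCircleDeriv_fourier q.2) t).const_mul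
    (fourier q.1 x : ℂ)).const_mul (c q)).congr_deriv (by simp only; ring)

theorem torusCoeff_torusTrig (s : Finset (ℤ × ℤ)) (c : ℤ × ℤ → ℂ) (q : ℤ × ℤ) :
    torusCoeff (torusTrig s c) q = if q ∈ s then c q else 0 := by
  have e : ∀ z : T2, (fourier (-q.1) z.1 : ℂ) * fourier (-q.2) z.2 * torusTrig s c z
      = ∑ r ∈ s, c r * ((fourier (r.1 - q.1) z.1 : ℂ) * fourier (r.2 - q.2) z.2) := fun z => by
    rw [torusTrig, Finset.mul_sum]
    refine Finset.sum_congr rfl fun r _ => ?_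
    rw [sub_eq_add_neg, sub_eq_add_neg, fourier_add, fourier_add]
    ring
  have hi : ∀ r ∈ s, Integrable (fun z : T2 => c r * ((fourier (r.1 - q.1) z.1 : ℂ)
      * fourier (r.2 - q.2) z.2)) torusMeasure := fun r _ =>
    integrable_of_continuous
      (continuous_const.mul (continuous_fourier_mul_fourier (r.1 - q.1, r.2 - q.2)))
  have h1 : ∀ r : ℤ × ℤ, ∫ z : T2, (fourier (r.1 - q.1) z.1 : ℂ) * fourier (r.2 - q.2) z.2 ∂torusMeasure
      = if r = q then 1 else 0 := fun r => by
    have := integral_prod_mul (μ := circleMeasure) (ν := circleMeasure)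
      (fun x => (fourier (r.1 - q.1) x : ℂ)) fun y => (fourier (r.2 - q.2) y : ℂ)
    refine this.trans ?_
    rw [integral_fourier, integral_fourier]
    simp only [sub_eq_zero, Prod.ext_iff, ite_and, mul_ite, mul_one, mul_zero]
    split_ifs <;> rfl
  rw [torusCoeff]
  simp only [e]
  rw [integral_finsetSum s hi]
  simp only [integral_const_mul, h1, mul_ite, mul_one, mul_zero, Finset.sum_ite_eq']

theorem l2Tendsto_torusTrig {f : T2 → ℂ} (hf : MemLp f 2 torusMeasure) :
    L2Tendsto torusMeasure atTop (fun s => torusTrig s (torusCoeff f)) f := by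
  have hF := fun s => memLp_of_continuous (m := torusMeasure)
    (continuous_torusTrig s (torusCoeff f)) 2
  refine .of_integral hF hf ?_
  have hs := hasSum_sq_torusCoeff hf
  have e : ∀ s, ∫ z, ‖f z - torusTrig s (torusCoeff f) z‖ ^ 2 ∂torusMeasure
      = ∫ z, ‖f z‖ ^ 2 ∂torusMeasure - ∑ q ∈ s, ‖torusCoeff f q‖ ^ 2 := fun s => by
    have h := hasSum_sq_torusCoeff (hf.sub ((hF s).const_mul 1))
    have h0 : ∀ q, torusCoeff (f - fun z => 1 * torusTrig s (torusCoeff f) z) q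
        = if q ∈ s then 0 else torusCoeff f q := fun q => by
      refine (torusCoeff_sub_mul (hF s) hf 1 q).trans ?_
      rw [torusCoeff_torusTrig]
      split_ifs <;> simp
    simp only [h0, Pi.sub_apply] at h
    simp only [one_mul] at h
    have h2 : HasSum (fun q => if q ∈ s then ‖torusCoeff f q‖ ^ 2 else 0)
        (∑ q ∈ s, ‖torusCoeff f q‖ ^ 2) := by
      rw [← Finset.sum_congr rfl fun q (hq : q ∈ s) =>
        if_pos (t := ‖torusCoeff f q‖ ^ 2) (e := 0) hq]
      exact hasSum_sum_of_ne_finset_zero fun q hq => if_neg hq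
    refine h.unique ?_
    refine HasSum.of_eq (hs.sub h2) fun q => ?_
    split_ifs <;> simp
  simp only [e]
  have h : Tendsto (fun s : Finset (ℤ × ℤ) => ∑ q ∈ s, ‖torusCoeff f q‖ ^ 2) atTop
      (𝓝 (∫ z, ‖f z‖ ^ 2 ∂torusMeasure)) := hs
  have h1 := h.const_sub (∫ z, ‖f z‖ ^ 2 ∂torusMeasure)
  have e0 : ∫ z, ‖f z‖ ^ 2 ∂torusMeasure - ∫ z, ‖f z‖ ^ 2 ∂torusMeasure = 0 := sub_self _
  exact e0 ▸ h1

/-! ### Sobolev functions on the torus -/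

theorem torusDerivX_mul (u v : S1 → ℂ) (z : T2) :
    torusDerivX (fun z => u z.1 * v z.2) z = circleDeriv u z.1 * v z.2 :=
  deriv_mul_const_field (v z.2)

theorem torusDerivY_mul (u v : S1 → ℂ) (z : T2) :
    torusDerivY (fun z => u z.1 * v z.2) z = u z.1 * circleDeriv v z.2 :=
  deriv_const_mul_field (u z.1)

theorem IsSmoothCircle.mul_torus {u v : S1 → ℂ} (hu : IsSmoothCircle u) (hv : IsSmoothCircle v) :
    IsSmoothTorus fun z => u z.1 * v z.2 :=
  ContDiff.mul (ContDiff.comp (g := fun t : ℝ => u t) hu contDiff_fst)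
    (ContDiff.comp (g := fun t : ℝ => v t) hv contDiff_snd)

theorem IsH1Torus.torusCoeff_derivX {ψ gx gy : T2 → ℂ} (h : IsH1Torus ψ gx gy) (q : ℤ × ℤ) :
    torusCoeff gx q = Complex.I * q.1 * torusCoeff ψ q := by
  have h1 := h.weakDerivX _ ((isSmoothCircle_fourier (-q.1)).mul_torus (isSmoothCircle_fourier (-q.2)))
  simp only [torusDerivX_mul, (hasCircleDeriv_fourier (-q.1)).circleDeriv_eq] at h1
  have h2 : ∫ z, ψ z * (Complex.I * ((-q.1 : ℤ) : ℂ) * fourier (-q.1) z.1 * fourier (-q.2) z.2)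
      ∂torusMeasure = -(Complex.I * q.1 * torusCoeff ψ q) := by
    rw [torusCoeff, ← integral_const_mul, ← integral_neg]
    refine integral_congr_ae (.of_forall fun z => ?_)
    simp only
    push_cast
    ring
  rw [h2] at h1
  rw [neg_inj.1 h1, torusCoeff]
  refine integral_congr_ae (.of_forall fun z => ?_)
  simp only
  ring

theorem IsH1Torus.torusCoeff_derivY {ψ gx gy : T2 → ℂ} (h : IsH1Torus ψ gx gy) (q : ℤ × ℤ) :
    torusCoeff gy q = Complex.I * q.2 * torusCoeff ψ q := by
  have h1 := h.weakDerivY _ ((isSmoothCircle_fourier (-q.1)).mul_torus (isSmoothCircle_fourier (-q.2)))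
  simp only [torusDerivY_mul, (hasCircleDeriv_fourier (-q.2)).circleDeriv_eq] at h1
  have h2 : ∫ z, ψ z * (fourier (-q.1) z.1 * (Complex.I * ((-q.2 : ℤ) : ℂ) * fourier (-q.2) z.2))
      ∂torusMeasure = -(Complex.I * q.2 * torusCoeff ψ q) := by
    rw [torusCoeff, ← integral_const_mul, ← integral_neg]
    refine integral_congr_ae (.of_forall fun z => ?_)
    simp only
    push_cast
    ring
  rw [h2] at h1
  rw [neg_inj.1 h1, torusCoeff]
  refine integral_congr_ae (.of_forall fun z => ?_)
  simp only
  ring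

theorem sliceCoeff_zero (f : T2 → ℂ) (y : S1) : sliceCoeff f 0 y = ∫ x, f (x, y) ∂circleMeasure := by
  simp [sliceCoeff]

theorem integral_mul_snd {f : T2 → ℂ} (hf : MemLp f 2 torusMeasure) {v : S1 → ℂ} (hv : Continuous v) :
    ∫ z, f z * v z.2 ∂torusMeasure = ∫ y, sliceCoeff f 0 y * v y ∂circleMeasure := by
  obtain ⟨C, hC⟩ := isCompact_univ.exists_bound_of_continuousOn hv.continuousOn
  have hi : Integrable (fun z : T2 => f z * v z.2) torusMeasure :=
    (hf.integrable (by norm_num)).mul_bdd (hv.comp continuous_snd).aestronglyMeasurable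
      (c := C) (.of_forall fun z => hC z.2 trivial)
  have h := integral_prod_symm _ hi
  refine h.trans (integral_congr_ae (.of_forall fun y => ?_))
  simp only [sliceCoeff_zero, integral_mul_const]

/-- The average in `x` of a Sobolev function on the torus is a Sobolev function on the circle. -/
theorem IsH1Torus.isH1Circle_sliceCoeff {ψ gx gy : T2 → ℂ} (h : IsH1Torus ψ gx gy) :
    IsH1Circle (sliceCoeff ψ 0) (sliceCoeff gy 0) where
  memLp := memLp_sliceCoeff h.memLp 0
  memLp_deriv := memLp_sliceCoeff h.memLp_derivY 0
  weakDeriv φ hφ := by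
    have h1 : IsSmoothCircle fun _ => 1 := contDiff_const
    have h2 := h.weakDerivY _ (h1.mul_torus hφ)
    simp only [torusDerivY_mul (fun _ => 1) φ] at h2
    simp only [one_mul] at h2
    rwa [integral_mul_snd h.memLp hφ.continuous_circleDeriv,
      integral_mul_snd h.memLp_derivY hφ.hasCircleDeriv.continuous] at h2

theorem memLp_comp_snd {f : S1 → ℂ} (hf : MemLp f 2 circleMeasure) :
    MemLp (fun z : T2 => f z.2) 2 torusMeasure :=
  hf.comp_measurePreserving measurePreserving_snd

theorem integral_comp_snd {E : Type*} [NormedAddCommGroup E] [NormedSpace ℝ E] (f : S1 → E) :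
    ∫ z, f z.2 ∂torusMeasure = ∫ y, f y ∂circleMeasure := by
  have h := integral_fun_snd (μ := circleMeasure) (ν := circleMeasure) f
  rwa [probReal_univ, one_smul] at h

theorem torusCoeff_comp_snd (f : S1 → ℂ) (q : ℤ × ℤ) :
    torusCoeff (fun z => f z.2) q = if q.1 = 0 then fourierCoeff f q.2 else 0 := by
  have h := integral_prod_mul (μ := circleMeasure) (ν := circleMeasure)
    (fun x => (fourier (-q.1) x : ℂ)) fun y => (fourier (-q.2) y : ℂ) * f y
  have e : torusCoeff (fun z => f z.2) q
      = ∫ z : T2, (fourier (-q.1) z.1 : ℂ) * ((fourier (-q.2) z.2 : ℂ) * f z.2)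
        ∂circleMeasure.prod circleMeasure :=
    integral_congr_ae (.of_forall fun z => mul_assoc _ _ _)
  rw [e, h, integral_fourier]
  simp only [neg_eq_zero, ite_mul, one_mul, zero_mul]
  rfl

/-- Without modes `q.1 ≠ 0`, a function has the same Fourier coefficients as its average in `x`. -/
theorem ae_eq_sliceCoeff {f : T2 → ℂ} (hf : MemLp f 2 torusMeasure)
    (h : ∀ q : ℤ × ℤ, q.1 ≠ 0 → torusCoeff f q = 0) :
    ∀ᵐ z ∂torusMeasure, f z = sliceCoeff f 0 z.2 := by
  refine ae_eq_of_torusCoeff_eq hf (memLp_comp_snd (memLp_sliceCoeff hf 0)) fun q => ?_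
  rw [torusCoeff_comp_snd]
  split_ifs with hq
  · rw [← fourierCoeff_sliceCoeff hf q, hq]
  · exact h q hq

/-! ### Functions of `y` alone -/

theorem IsSmoothTorus.slice_fst {φ : T2 → ℂ} (h : IsSmoothTorus φ) (y : S1) :
    IsSmoothCircle fun x => φ (x, y) := by
  induction y using QuotientAddGroup.induction_on with
  | H t =>
    exact ContDiff.comp (g := fun q : ℝ × ℝ => φ ((q.1 : S1), (q.2 : S1))) h
      (contDiff_id.prodMk contDiff_const)

theorem IsSmoothTorus.slice_snd {φ : T2 → ℂ} (h : IsSmoothTorus φ) (x : S1) :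
    IsSmoothCircle fun y => φ (x, y) := by
  induction x using QuotientAddGroup.induction_on with
  | H t =>
    exact ContDiff.comp (g := fun q : ℝ × ℝ => φ ((q.1 : S1), (q.2 : S1))) h
      (contDiff_const.prodMk contDiff_id)

theorem continuous_torus_iff {Y : Type*} [TopologicalSpace Y] {f : T2 → Y} :
    Continuous f ↔ Continuous fun q : ℝ × ℝ => f ((q.1 : S1), (q.2 : S1)) := by
  have h : IsOpenQuotientMap fun t : ℝ => (t : S1) := QuotientAddGroup.isOpenQuotientMap_mk
  exact (h.prodMap h).isQuotientMap.continuous_iff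

theorem IsSmoothTorus.continuous {φ : T2 → ℂ} (h : IsSmoothTorus φ) : Continuous φ :=
  continuous_torus_iff.2 (ContDiff.continuous h)

theorem IsSmoothTorus.continuous_torusDerivX {φ : T2 → ℂ} (h : IsSmoothTorus φ) :
    Continuous (torusDerivX φ) := by
  have hc : Continuous fun q : ℝ × ℝ =>
      fderiv ℝ (fun q : ℝ × ℝ => φ ((q.1 : S1), (q.2 : S1))) q (1, 0) :=
    (ContDiff.continuous_fderiv h (by simp)).clm_apply continuous_const
  refine continuous_torus_iff.2 (hc.congr fun q => ?_)
  have h1 := (ContDiff.differentiable h (by simp) (q.1, q.2)).hasFDerivAt.comp_hasDerivAt q.1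
    ((hasDerivAt_id q.1).prodMk (hasDerivAt_const q.1 q.2))
  have h2 := ((h.slice_fst (q.2 : S1)).hasCircleDeriv q.1)
  exact h1.unique h2

theorem IsSmoothTorus.continuous_torusDerivY {φ : T2 → ℂ} (h : IsSmoothTorus φ) :
    Continuous (torusDerivY φ) := by
  have hc : Continuous fun q : ℝ × ℝ =>
      fderiv ℝ (fun q : ℝ × ℝ => φ ((q.1 : S1), (q.2 : S1))) q (0, 1) :=
    (ContDiff.continuous_fderiv h (by simp)).clm_apply continuous_const
  refine continuous_torus_iff.2 (hc.congr fun q => ?_)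
  have h1 := (ContDiff.differentiable h (by simp) (q.1, q.2)).hasFDerivAt.comp_hasDerivAt q.2
    ((hasDerivAt_const q.2 q.1).prodMk (hasDerivAt_id q.2))
  have h2 := ((h.slice_snd (q.1 : S1)).hasCircleDeriv q.2)
  exact h1.unique h2

theorem integrable_comp_snd_mul {f : S1 → ℂ} (hf : MemLp f 2 circleMeasure) {φ : T2 → ℂ}
    (hφ : Continuous φ) : Integrable (fun z => f z.2 * φ z) torusMeasure := by
  obtain ⟨C, hC⟩ := isCompact_univ.exists_bound_of_continuousOn hφ.continuousOn
  exact ((memLp_comp_snd hf).integrable (by norm_num)).mul_bdd hφ.aestronglyMeasurable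
    (c := C) (.of_forall fun z => hC z trivial)

theorem IsH1Circle.comp_snd {ψ g : S1 → ℂ} (h : IsH1Circle ψ g) :
    IsH1Torus (fun z => ψ z.2) (fun _ => 0) fun z => g z.2 where
  memLp := memLp_comp_snd h.memLp
  memLp_derivX := memLp_const _
  memLp_derivY := memLp_comp_snd h.memLp_deriv
  weakDerivX φ hφ := by
    have h1 := integral_prod_symm _ (integrable_comp_snd_mul h.memLp hφ.continuous_torusDerivX)
    have h2 : ∀ y, ∫ x, ψ y * torusDerivX φ (x, y) ∂circleMeasure = 0 := fun y => by
      have h3 := (hφ.slice_fst y).hasCircleDeriv.integral_eq_zero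
        (hφ.slice_fst y).continuous_circleDeriv
      rw [integral_const_mul]
      exact mul_eq_zero_of_right _ h3
    simp only [h2, integral_zero] at h1
    simp only [zero_mul, integral_zero, neg_zero]
    exact h1
  weakDerivY φ hφ := by
    have h1 := integral_prod _ (integrable_comp_snd_mul h.memLp hφ.continuous_torusDerivY)
    have h2 := integral_prod _ (integrable_comp_snd_mul h.memLp_deriv hφ.continuous)
    refine h1.trans (Eq.trans ?_ (congrArg Neg.neg h2.symm))
    rw [← integral_neg]
    exact integral_congr_ae (.of_forall fun x => h.weakDeriv _ (hφ.slice_snd x))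

theorem lpNormSq_comp_snd (p : ℝ) (f : S1 → ℂ) :
    lpNormSq torusMeasure p (fun z => f z.2) = lpNormSq circleMeasure p f := by
  rw [lpNormSq, lpNormSq, integral_comp_snd fun y => ‖f y‖ ^ p]

theorem torusEnergy_comp_snd (a p μ : ℝ) (ψ g : S1 → ℂ) :
    torusEnergy a p μ (fun z => ψ z.2) (fun _ => 0) (fun z => g z.2) = circleEnergy a p μ ψ g := by
  rw [torusEnergy, circleEnergy, lpNormSq_comp_snd,
    ← integral_comp_snd fun y => ‖g y - Complex.I * (a : ℂ) * ψ y‖ ^ 2]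
  simp

/-- Functions of `y` alone are admissible on the torus and have the same energy and mass as on the
circle. -/
theorem torusConstants_subset (a p μ : ℝ) : torusConstants a p μ ⊆ circleConstants a p μ :=
  fun L hL ψ g h => by
  have := hL _ _ _ h.comp_snd
  rwa [torusEnergy_comp_snd, integral_comp_snd fun y => ‖ψ y‖ ^ 2] at this

theorem torusEnergy_nonneg {μ : ℝ} (hμ : 0 ≤ μ) (a p : ℝ) (ψ gx gy : T2 → ℂ) :
    0 ≤ torusEnergy a p μ ψ gx gy :=
  add_nonneg (integral_nonneg fun _ => by positivity) (mul_nonneg hμ (lpNormSq_nonneg _ _ _))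

theorem isGreatest_torusOptimal {a p μ : ℝ} (hp : 1 ≤ p) (hμ : 0 < μ) :
    IsGreatest (torusConstants a p μ) (torusOptimal a p μ) := by
  have e : torusConstants a p μ = {L : ℝ | ∀ i : (T2 → ℂ) × (T2 → ℂ) × (T2 → ℂ),
      IsH1Torus i.1 i.2.1 i.2.2 →
      L * ∫ z, ‖i.1 z‖ ^ 2 ∂torusMeasure ≤ torusEnergy a p μ i.1 i.2.1 i.2.2} :=
    Set.ext fun L => ⟨fun h i hi => h _ _ _ hi, fun h ψ gx gy hi => h (ψ, gx, gy) hi⟩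
  have hb : BddAbove (torusConstants a p μ) :=
    ⟨a ^ 2 + μ, fun L hL => le_of_mem_circleConstants hp (torusConstants_subset _ _ _ hL)⟩
  have hne : (torusConstants a p μ).Nonempty := ⟨0, fun ψ gx gy _ => by
    rw [zero_mul]; exact torusEnergy_nonneg hμ.le _ _ _ _ _⟩
  rw [torusOptimal]
  rw [e] at hb hne ⊢
  exact isGreatest_csSup_of_linear (fun i _ => integral_nonneg fun _ => by positivity) hne hb

theorem torusOptimal_le_circleOptimal {a p μ : ℝ} (hp : 1 ≤ p) (hμ : 0 < μ) :
    torusOptimal a p μ ≤ circleOptimal a p μ :=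
  (isGreatest_circleOptimal hp hμ).2
    (torusConstants_subset _ _ _ (isGreatest_torusOptimal hp hμ).1)

/-! ### Subadditivity of the entropy `∫ f ^ q - (∫ f) ^ q` -/

theorem add_le_of_deriv2_nonneg {h h₁ h₂ : ℝ → ℝ}
    (hh : ∀ t ∈ Set.Icc (0 : ℝ) 1, HasDerivAt h (h₁ t) t)
    (hh₁ : ∀ t ∈ Set.Icc (0 : ℝ) 1, HasDerivAt h₁ (h₂ t) t)
    (hn : ∀ t ∈ Set.Icc (0 : ℝ) 1, 0 ≤ h₂ t) : h 0 + h₁ 0 ≤ h 1 := by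
  have i0 : (0 : ℝ) ∈ Set.Icc (0 : ℝ) 1 := ⟨le_rfl, zero_le_one⟩
  have i1 : (1 : ℝ) ∈ Set.Icc (0 : ℝ) 1 := ⟨zero_le_one, le_rfl⟩
  have m1 : MonotoneOn h₁ (Set.Icc 0 1) := by
    refine monotoneOn_of_hasDerivWithinAt_nonneg (convex_Icc 0 1)
      (fun t ht => (hh₁ t ht).continuousAt.continuousWithinAt) (f' := h₂)
      (fun t ht => (hh₁ t (interior_subset ht)).hasDerivWithinAt) fun t ht => hn t (interior_subset ht)
  have hk : ∀ t ∈ Set.Icc (0 : ℝ) 1, HasDerivAt (fun t => h t - t * h₁ 0) (h₁ t - 1 * h₁ 0) t :=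
    fun t ht => (hh t ht).sub ((hasDerivAt_id t).mul_const (h₁ 0))
  have m2 : MonotoneOn (fun t => h t - t * h₁ 0) (Set.Icc 0 1) := by
    refine monotoneOn_of_hasDerivWithinAt_nonneg (convex_Icc 0 1)
      (fun t ht => (hk t ht).continuousAt.continuousWithinAt)
      (fun t ht => (hk t (interior_subset ht)).hasDerivWithinAt) fun t ht => ?_
    have := m1 i0 (interior_subset ht) (interior_subset ht).1
    linarith
  have := m2 i0 i1 zero_le_one
  simp only [zero_mul, sub_zero, one_mul] at this
  linarith

/-- The Bregman divergence of the power function `t ↦ t ^ q`. -/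
noncomputable def powDivergence (q s t : ℝ) : ℝ := s ^ q + (q - 1) * t ^ q - q * (t ^ (q - 1) * s)

/-- Up to the factor `q (q - 1)`, the expression is the Hessian of `powDivergence q` at `(S, T)`
evaluated on `(u, v)`. Complete the square in `u`; what remains is the weighted AM–GM inequality `T
^ (q - 1) S ^ (2 - q) ≤ (q - 1) T + (2 - q) S`. The range `1 < q ≤ 2` makes the weights nonnegative.
-/
theorem powDivergence_hessian_nonneg {q S T : ℝ} (hq1 : 1 < q) (hq2 : q ≤ 2) (hS : 0 < S)
    (hT : 0 < T) (u v : ℝ) :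
    0 ≤ S ^ (q - 2) * u ^ 2 + (q - 1) * T ^ (q - 2) * v ^ 2
      - (q - 2) * T ^ (q - 3) * S * v ^ 2 - 2 * T ^ (q - 2) * u * v := by
  have hA : 0 < S ^ (q - 2) := Real.rpow_pos_of_pos hS _
  have hC : 0 < T ^ (q - 3) := Real.rpow_pos_of_pos hT _
  have hB : T ^ (q - 2) = T ^ (q - 3) * T := by
    rw [← Real.rpow_add_one hT.ne']; congr 1; ring
  have hW := Real.geom_mean_le_arith_mean2_weighted (by linarith : 0 ≤ q - 1)
    (by linarith : 0 ≤ 2 - q) hT.le hS.le (by ring)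
  have hACW : S ^ (q - 2) * (T ^ (q - 3) * (T ^ (q - 1) * S ^ (2 - q))) = (T ^ (q - 2)) ^ 2 := by
    have h1 : S ^ (q - 2) * S ^ (2 - q) = 1 := by
      rw [← Real.rpow_add hS, show q - 2 + (2 - q) = 0 by ring, Real.rpow_zero]
    have h2 : T ^ (q - 3) * T ^ (q - 1) = (T ^ (q - 2)) ^ 2 := by
      rw [sq, ← Real.rpow_add hT, ← Real.rpow_add hT]; congr 1; ring
    linear_combination (T ^ (q - 3) * T ^ (q - 1)) * h1 + h2
  refine (mul_nonneg_iff_of_pos_left hA).1 ?_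
  have h1 := mul_le_mul_of_nonneg_left hW
    (mul_nonneg (mul_pos hA hC).le (sq_nonneg v))
  have h2 : 0 ≤ (S ^ (q - 2) * u - T ^ (q - 2) * v) ^ 2 := sq_nonneg _
  have e : S ^ (q - 2) * (S ^ (q - 2) * u ^ 2 + (q - 1) * T ^ (q - 2) * v ^ 2
      - (q - 2) * T ^ (q - 3) * S * v ^ 2 - 2 * T ^ (q - 2) * u * v)
      = (S ^ (q - 2) * u - T ^ (q - 2) * v) ^ 2
        + (S ^ (q - 2) * T ^ (q - 3) * v ^ 2 * ((q - 1) * T + (2 - q) * S)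
          - S ^ (q - 2) * T ^ (q - 3) * v ^ 2 * (T ^ (q - 1) * S ^ (2 - q))) := by
    linear_combination v ^ 2 * hACW + S ^ (q - 2) * (q - 1) * v ^ 2 * hB
  rw [e]
  linarith

/-- Joint convexity in tangent-plane form, from the second derivative along the segment from `(s₀,
t₀)` to `(s, t)`. This form gives Jensen's inequality by mere integration. -/
theorem powDivergence_tangent_le {q s t s₀ t₀ : ℝ} (hq1 : 1 < q) (hq2 : q ≤ 2) (hs : 0 < s)
    (ht : 0 < t) (hs₀ : 0 < s₀) (ht₀ : 0 < t₀) :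
    powDivergence q s₀ t₀ + ((q * s₀ ^ (q - 1) - q * t₀ ^ (q - 1)) * (s - s₀)
      + (q * (q - 1) * (t₀ ^ (q - 1) - t₀ ^ (q - 2) * s₀)) * (t - t₀)) ≤ powDivergence q s t := by
  have hpos : ∀ {w w₀ : ℝ}, 0 < w → 0 < w₀ → ∀ r ∈ Set.Icc (0 : ℝ) 1, 0 < w₀ + r * (w - w₀) :=
    fun {w w₀} hw hw₀ r hr => by
    have e : w₀ + r * (w - w₀) = (1 - r) * w₀ + r * w := by ring
    rw [e]
    rcases hr.1.eq_or_lt with h0 | h0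
    · rw [← h0]; linarith
    · have := mul_nonneg (sub_nonneg.2 hr.2) hw₀.le
      have := mul_pos h0 hw
      linarith
  have hline : ∀ w w₀ r : ℝ, HasDerivAt (fun r => w₀ + r * (w - w₀)) (w - w₀) r := fun w w₀ r =>
    (((hasDerivAt_id r).mul_const (w - w₀)).const_add w₀).congr_deriv (one_mul _)
  have hpow : ∀ {w w₀ : ℝ}, 0 < w → 0 < w₀ → ∀ k : ℝ, ∀ r ∈ Set.Icc (0 : ℝ) 1,
      HasDerivAt (fun r => (w₀ + r * (w - w₀)) ^ k)
        (k * (w₀ + r * (w - w₀)) ^ (k - 1) * (w - w₀)) r := fun {w w₀} hw hw₀ k r hr =>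
    ((hline w w₀ r).rpow_const (.inl (hpos hw hw₀ r hr).ne')).congr_deriv (by ring)
  have key := add_le_of_deriv2_nonneg
    (h := fun r => powDivergence q (s₀ + r * (s - s₀)) (t₀ + r * (t - t₀)))
    (h₁ := fun r => q * (s₀ + r * (s - s₀)) ^ (q - 1) * (s - s₀)
      + (q - 1) * (q * (t₀ + r * (t - t₀)) ^ (q - 1) * (t - t₀))
      - q * ((q - 1) * (t₀ + r * (t - t₀)) ^ (q - 1 - 1) * (t - t₀) * (s₀ + r * (s - s₀))
        + (t₀ + r * (t - t₀)) ^ (q - 1) * (s - s₀)))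
    (h₂ := fun r => q * ((q - 1) * (s₀ + r * (s - s₀)) ^ (q - 1 - 1) * (s - s₀)) * (s - s₀)
      + (q - 1) * (q * ((q - 1) * (t₀ + r * (t - t₀)) ^ (q - 1 - 1) * (t - t₀)) * (t - t₀))
      - q * ((q - 1) * ((q - 1 - 1) * (t₀ + r * (t - t₀)) ^ (q - 1 - 1 - 1) * (t - t₀)) * (t - t₀)
          * (s₀ + r * (s - s₀))
        + (q - 1) * (t₀ + r * (t - t₀)) ^ (q - 1 - 1) * (t - t₀) * (s - s₀)
        + (q - 1) * (t₀ + r * (t - t₀)) ^ (q - 1 - 1) * (t - t₀) * (s - s₀)))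
    (fun r hr => ((hpow hs hs₀ q r hr).add ((hpow ht ht₀ q r hr).const_mul _)).sub
      (((hpow ht ht₀ (q - 1) r hr).mul (hline s s₀ r)).const_mul q))
    (fun r hr => ((((hpow hs hs₀ (q - 1) r hr).const_mul q).mul_const _).add
      ((((hpow ht ht₀ (q - 1) r hr).const_mul q).mul_const _).const_mul _)).sub
      ((((((hpow ht ht₀ (q - 1 - 1) r hr).const_mul (q - 1)).mul_const _).mul (hline s s₀ r)).add
        ((hpow ht ht₀ (q - 1) r hr).mul_const _)).const_mul q))
    (fun r hr => by
      have := powDivergence_hessian_nonneg hq1 hq2 (hpos hs hs₀ r hr) (hpos ht ht₀ r hr)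
        (s - s₀) (t - t₀)
      have h2 := mul_nonneg (mul_nonneg (by linarith : 0 ≤ q) (by linarith : 0 ≤ q - 1)) this
      rw [show q - 1 - 1 - 1 = q - 3 by ring, show q - 1 - 1 = q - 2 by ring]
      refine h2.trans_eq ?_
      ring)
  simp only [zero_mul, add_zero, one_mul, add_sub_cancel, show q - 1 - 1 = q - 2 by ring] at key
  refine le_trans (le_of_eq ?_) key
  ring

theorem continuous_integral_fst {f : T2 → ℝ} (hf : Continuous f) :
    Continuous fun y => ∫ x, f (x, y) ∂circleMeasure := by
  have := continuous_parametric_integral_of_continuous (μ := circleMeasure)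
    (f := fun y x => f (x, y)) (by fun_prop) isCompact_univ
  simpa only [setIntegral_univ] using this

theorem continuous_integral_snd {f : T2 → ℝ} (hf : Continuous f) :
    Continuous fun x => ∫ y, f (x, y) ∂circleMeasure := by
  have := continuous_parametric_integral_of_continuous (μ := circleMeasure)
    (f := fun x y => f (x, y)) (by fun_prop) isCompact_univ
  simpa only [setIntegral_univ] using this

theorem integral_torus_eq {f : T2 → ℝ} (hf : Continuous f) :
    ∫ z, f z ∂torusMeasure = ∫ x, ∫ y, f (x, y) ∂circleMeasure ∂circleMeasure :=
  integral_prod _ (integrable_of_continuous (m := torusMeasure) hf)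

theorem integral_torus_eq_symm {f : T2 → ℝ} (hf : Continuous f) :
    ∫ z, f z ∂torusMeasure = ∫ y, ∫ x, f (x, y) ∂circleMeasure ∂circleMeasure :=
  integral_prod_symm _ (integrable_of_continuous (m := torusMeasure) hf)

theorem integral_pos_of_pos {f : S1 → ℝ} (hf : Continuous f) (h : ∀ x, 0 < f x) :
    0 < ∫ x, f x ∂circleMeasure :=
  hf.integral_pos_of_hasCompactSupport_nonneg_nonzero (.of_compactSpace f) (fun x => (h x).le)
    (h 0).ne'

/-- Let `F` and `G` be the averages in `x` and in `y`. The divergence of `f` from `F` integrates to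
`∫ f ^ q - ∫ F ^ q`, that of `G` from the mean to `∫ G ^ q - m ^ q`. Averaging in `y` sends the pair
`(f, F)` to `(G, m)`, and joint convexity says that this lowers the divergence. -/
theorem entropy_subadditive_of_pos {f : T2 → ℝ} (hf : Continuous f) (h0 : ∀ z, 0 < f z) {q : ℝ}
    (hq1 : 1 < q) (hq2 : q ≤ 2) :
    ∫ y, (∫ x, f (x, y) ∂circleMeasure) ^ q ∂circleMeasure
      + ∫ x, (∫ y, f (x, y) ∂circleMeasure) ^ q ∂circleMeasure
      ≤ ∫ z, f z ^ q ∂torusMeasure + (∫ z, f z ∂torusMeasure) ^ q := by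
  set F : S1 → ℝ := fun y => ∫ x, f (x, y) ∂circleMeasure with hF
  set G : S1 → ℝ := fun x => ∫ y, f (x, y) ∂circleMeasure with hG
  set m := ∫ z, f z ∂torusMeasure with hm
  have cF : Continuous F := continuous_integral_fst hf
  have cG : Continuous G := continuous_integral_snd hf
  have F0 : ∀ y, 0 < F y := fun y => integral_pos_of_pos (by fun_prop) fun x => h0 _
  have G0 : ∀ x, 0 < G x := fun x => integral_pos_of_pos (by fun_prop) fun y => h0 _
  have mG : ∫ x, G x ∂circleMeasure = m := (integral_torus_eq hf).symm
  have mF : ∫ y, F y ∂circleMeasure = m := (integral_torus_eq_symm hf).symm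
  have m0 : 0 < m := mG ▸ integral_pos_of_pos cG G0
  have cq : ∀ {X : Type} [TopologicalSpace X] {g : X → ℝ} (k : ℝ), Continuous g → (∀ x, 0 < g x) →
      Continuous fun x => g x ^ k := fun k hg hg0 => continuous_rpow_of_pos hg hg0 k
  have cfq := cq q hf h0
  have cFq := cq q cF F0
  have cFq' := cq (q - 1) cF F0
  have cGq := cq q cG G0
  have h1 : ∀ x, powDivergence q (G x) m ≤ ∫ y, powDivergence q (f (x, y)) (F y) ∂circleMeasure :=
    fun x => by
    have c1 : Continuous fun y => f (x, y) := by fun_prop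
    have i1 : ∫ y, (f (x, y) - G x) ∂circleMeasure = 0 := by
      rw [integral_sub (integrable_of_continuous c1) (integrable_const _)]
      simp [hG]
    have i2 : ∫ y, (F y - m) ∂circleMeasure = 0 := by
      rw [integral_sub (integrable_of_continuous cF) (integrable_const _), mF]
      simp
    have h2 := integral_mono (μ := circleMeasure) (integrable_of_continuous (by fun_prop))
      (integrable_of_continuous (by
        unfold powDivergence
        have := cfq.comp (Continuous.prodMk_right x)
        simp only [Function.comp_def] at this
        fun_prop)) fun y => powDivergence_tangent_le hq1 hq2 (h0 (x, y)) (F0 y) (G0 x) m0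
    refine le_trans (le_of_eq ?_) h2
    rw [integral_add (integrable_const _) (integrable_of_continuous (by fun_prop)),
      integral_add (integrable_of_continuous (by fun_prop)) (integrable_of_continuous (by fun_prop)),
      integral_const_mul, integral_const_mul, i1, i2]
    simp
  have cD : Continuous fun z : T2 => powDivergence q (f z) (F z.2) := by
    unfold powDivergence
    have h2 := cFq.comp (continuous_snd (X := S1))
    have h3 := cFq'.comp (continuous_snd (X := S1))
    simp only [Function.comp_def] at h2 h3
    fun_prop
  have h2 := integral_mono (μ := circleMeasure) (integrable_of_continuous (by
    unfold powDivergence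
    fun_prop)) (integrable_of_continuous (continuous_integral_snd cD)) h1
  rw [← integral_torus_eq cD, integral_torus_eq_symm cD] at h2
  have e1 : ∀ y, ∫ x, powDivergence q (f (x, y)) (F y) ∂circleMeasure
      = ∫ x, f (x, y) ^ q ∂circleMeasure - F y ^ q := fun y => by
    have c1 : Continuous fun x => f (x, y) := by fun_prop
    have c2 := cq q c1 fun x => h0 _
    have e : F y ^ (q - 1) * F y = F y ^ q := by
      rw [← Real.rpow_add_one (F0 y).ne', sub_add_cancel]
    unfold powDivergence
    rw [integral_sub (integrable_of_continuous (by fun_prop)) (integrable_of_continuous (by fun_prop)),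
      integral_add (integrable_of_continuous (by fun_prop)) (integrable_const _),
      integral_const_mul, integral_const_mul, integral_const_mul]
    simp only [integral_const, probReal_univ, one_smul]
    change _ - q * (F y ^ (q - 1) * F y) = _
    rw [e]
    ring
  have e2 : ∫ x, powDivergence q (G x) m ∂circleMeasure = ∫ x, G x ^ q ∂circleMeasure - m ^ q := by
    have e : m ^ (q - 1) * m = m ^ q := by
      rw [← Real.rpow_add_one m0.ne', sub_add_cancel]
    unfold powDivergence
    rw [integral_sub (integrable_of_continuous (by fun_prop)) (integrable_of_continuous (by fun_prop)),
      integral_add (integrable_of_continuous (by fun_prop)) (integrable_const _),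
      integral_const_mul, integral_const_mul, integral_const_mul, mG, e]
    simp only [integral_const, probReal_univ, one_smul]
    ring
  simp only [e1] at h2
  rw [e2, integral_sub (integrable_of_continuous (continuous_integral_fst cfq))
    (integrable_of_continuous cFq), ← integral_torus_eq_symm cfq] at h2
  linarith

theorem tendsto_integral_add_rpow {X : Type*} [TopologicalSpace X] [CompactSpace X]
    [MeasurableSpace X] [OpensMeasurableSpace X] {m : Measure X} [IsFiniteMeasure m] {u : X → ℝ}
    (hu : Continuous u) (h0 : ∀ x, 0 ≤ u x) {q : ℝ} (hq : 0 < q) :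
    Tendsto (fun n : ℕ => ∫ x, (u x + 1 / ((n : ℝ) + 1)) ^ q ∂m) atTop (𝓝 (∫ x, u x ^ q ∂m)) := by
  obtain ⟨C, hC⟩ := isCompact_univ.exists_bound_of_continuousOn hu.continuousOn
  refine tendsto_integral_of_bounded (C := (C + 1) ^ q) (fun n => ?_) (fun n x => ?_) fun x => ?_
  · exact (hu.add continuous_const).rpow_const fun x => .inr hq.le
  · have h1 : 0 < 1 / ((n : ℝ) + 1) := Nat.one_div_pos_of_nat
    have h2 : 1 / ((n : ℝ) + 1) ≤ 1 := by
      rw [div_le_one (by positivity)]; linarith [n.cast_nonneg (α := ℝ)]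
    have h3 : u x ≤ C := (le_abs_self _).trans (hC x trivial)
    have h4 := h0 x
    rw [abs_of_nonneg (Real.rpow_nonneg (by linarith) _)]
    exact Real.rpow_le_rpow (by linarith) (by linarith) hq.le
  · have h1 : Tendsto (fun n : ℕ => u x + 1 / ((n : ℝ) + 1)) atTop (𝓝 (u x + 0)) :=
      tendsto_one_div_add_atTop_nhds_zero_nat.const_add _
    rw [add_zero] at h1
    exact h1.rpow_const (.inr hq.le)

/-- Entropy subadditivity for `|ψ| ^ p` and `q = 2 / p`. Adding `1 / (n + 1)` restores positivity
where `ψ` vanishes. -/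
theorem lpNormSq_subadditive {ψ : T2 → ℂ} (hψ : Continuous ψ) {p : ℝ} (hp : p ∈ Set.Ico (1 : ℝ) 2) :
    ∫ y, lpNormSq circleMeasure p (fun x => ψ (x, y)) ∂circleMeasure
      + ∫ x, lpNormSq circleMeasure p (fun y => ψ (x, y)) ∂circleMeasure
      ≤ ∫ z, ‖ψ z‖ ^ 2 ∂torusMeasure + lpNormSq torusMeasure p ψ := by
  obtain ⟨hp1, hp2⟩ := hp
  have hp0 : 0 < p := by linarith
  have hq1 : 1 < 2 / p := by rw [lt_div_iff₀ hp0]; linarith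
  have hq2 : 2 / p ≤ 2 := by rw [div_le_iff₀ hp0]; linarith
  have hq0 : 0 < 2 / p := by linarith
  set u : T2 → ℝ := fun z => ‖ψ z‖ ^ p with hu
  have cu : Continuous u := hψ.norm.rpow_const fun _ => .inr hp0.le
  have u0 : ∀ z, 0 ≤ u z := fun z => Real.rpow_nonneg (norm_nonneg _) _
  have hq : ∀ z, u z ^ (2 / p) = ‖ψ z‖ ^ 2 := fun z => by
    rw [hu]
    simp only
    rw [← Real.rpow_mul (norm_nonneg _), mul_div_cancel₀ _ hp0.ne', Real.rpow_two]
  have key : ∀ n : ℕ, ∫ y, (∫ x, u (x, y) ∂circleMeasure + 1 / ((n : ℝ) + 1)) ^ (2 / p) ∂circleMeasure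
      + ∫ x, (∫ y, u (x, y) ∂circleMeasure + 1 / ((n : ℝ) + 1)) ^ (2 / p) ∂circleMeasure
      ≤ ∫ z, (u z + 1 / ((n : ℝ) + 1)) ^ (2 / p) ∂torusMeasure
        + (∫ z, u z ∂torusMeasure + 1 / ((n : ℝ) + 1)) ^ (2 / p) := fun n => by
    have h1 : 0 < 1 / ((n : ℝ) + 1) := Nat.one_div_pos_of_nat
    generalize 1 / ((n : ℝ) + 1) = ε at h1
    have h2 := entropy_subadditive_of_pos (f := fun z => u z + ε) (cu.add (continuous_const (y := ε)))
      (fun z => add_pos_of_nonneg_of_pos (u0 z) h1) hq1 hq2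
    have e1 : ∀ y, ∫ x, (u (x, y) + ε) ∂circleMeasure = ∫ x, u (x, y) ∂circleMeasure + ε := fun y => by
      rw [integral_add (integrable_of_continuous (by fun_prop)) (integrable_const _)]
      simp
    have e2 : ∀ x, ∫ y, (u (x, y) + ε) ∂circleMeasure = ∫ y, u (x, y) ∂circleMeasure + ε := fun x => by
      rw [integral_add (integrable_of_continuous (by fun_prop)) (integrable_const _)]
      simp
    have e3 : ∫ z, (u z + ε) ∂torusMeasure = ∫ z, u z ∂torusMeasure + ε := by
      rw [integral_add (integrable_of_continuous cu) (integrable_const _)]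
      simp
    simpa only [e1, e2, e3] using h2
  have t1 := tendsto_integral_add_rpow (m := circleMeasure) (continuous_integral_fst cu)
    (fun y => integral_nonneg fun x => u0 _) hq0
  have t2 := tendsto_integral_add_rpow (m := circleMeasure) (continuous_integral_snd cu)
    (fun x => integral_nonneg fun y => u0 _) hq0
  have t3 := tendsto_integral_add_rpow (m := torusMeasure) cu u0 hq0
  have t4 : Tendsto (fun n : ℕ => (∫ z, u z ∂torusMeasure + 1 / ((n : ℝ) + 1)) ^ (2 / p)) atTop
      (𝓝 ((∫ z, u z ∂torusMeasure + 0) ^ (2 / p))) :=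
    (tendsto_one_div_add_atTop_nhds_zero_nat.const_add _).rpow_const (.inr hq0.le)
  rw [add_zero] at t4
  have h := le_of_tendsto_of_tendsto' (t1.add t2) (t3.add t4) key
  simp only [hq] at h
  exact h

/-! ### Comparison of the torus and the circle -/

theorem torusEnergy_eq {gx gy ψ : T2 → ℂ} (hψ : MemLp ψ 2 torusMeasure) (hx : MemLp gx 2 torusMeasure)
    (hy : MemLp gy 2 torusMeasure) (a p μ : ℝ) :
    torusEnergy a p μ ψ gx gy = ∫ z, ‖gx z‖ ^ 2 ∂torusMeasure
      + ∫ z, ‖gy z - Complex.I * (a : ℂ) * ψ z‖ ^ 2 ∂torusMeasure + μ * lpNormSq torusMeasure p ψ := by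
  rw [torusEnergy, integral_add (g := fun z => ‖gy z - Complex.I * (a : ℂ) * ψ z‖ ^ 2)
    (integrable_norm_sq hx)
    (integrable_norm_sq (hy.sub (hψ.const_mul (Complex.I * (a : ℂ)))))]

theorem continuous_lpNormSq_fst {ψ : T2 → ℂ} (hψ : Continuous ψ) {p : ℝ} (hp : 0 < p) :
    Continuous fun y => lpNormSq circleMeasure p fun x => ψ (x, y) :=
  (continuous_integral_fst (f := fun z => ‖ψ z‖ ^ p) (hψ.norm.rpow_const fun _ => .inr hp.le)).rpow_const
    fun _ => .inr (by positivity)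

theorem continuous_lpNormSq_snd {ψ : T2 → ℂ} (hψ : Continuous ψ) {p : ℝ} (hp : 0 < p) :
    Continuous fun x => lpNormSq circleMeasure p fun y => ψ (x, y) :=
  (continuous_integral_snd (f := fun z => ‖ψ z‖ ^ p) (hψ.norm.rpow_const fun _ => .inr hp.le)).rpow_const
    fun _ => .inr (by positivity)

/-- By subadditivity, `‖ψ‖ₚ²` is at least the sum of the sliced norms minus `‖ψ‖₂²`. The slices in
`y` pay for `L ‖ψ‖₂²` by the circle inequality. What remains is `‖∂ₓψ‖₂²` minus `μ` times the
entropy of the slices in `x`, which the improved Beckner inequality bounds. -/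
theorem torusEnergy_sub_ge_of_hasCircleDeriv {ψ ψx ψy : T2 → ℂ} (hψ : Continuous ψ)
    (hψx : Continuous ψx) (hψy : Continuous ψy)
    (hx : ∀ y, HasCircleDeriv (fun x => ψ (x, y)) fun x => ψx (x, y))
    (hy : ∀ x, HasCircleDeriv (fun y => ψ (x, y)) fun y => ψy (x, y)) {a p μ L σ : ℝ}
    (hp : p ∈ Set.Ico (1 : ℝ) 2) (hμ : 0 ≤ μ) (hL : L ∈ circleConstants a p μ) (hσ : 0 ≤ σ) :
    (1 + remainderConst p * σ) * ∫ z, ‖ψx z‖ ^ 2 ∂torusMeasure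
        - μ * ((2 - p) * ∫ z, ‖ψx z‖ ^ 2 ∂torusMeasure
          + remainderConst p / 2 * σ ^ 2 * ∫ z, ‖ψ z‖ ^ 2 ∂torusMeasure)
      ≤ (1 + remainderConst p * σ)
        * (torusEnergy a p μ ψ ψx ψy - L * ∫ z, ‖ψ z‖ ^ 2 ∂torusMeasure) := by
  have hp0 : 0 < p := by linarith [hp.1]
  have cM : Continuous fun z => ‖ψ z‖ ^ 2 := by fun_prop
  have cX : Continuous fun z => ‖ψx z‖ ^ 2 := by fun_prop
  have cY : Continuous fun z => ‖ψy z - Complex.I * (a : ℂ) * ψ z‖ ^ 2 := by fun_prop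
  have cM1 := continuous_integral_fst cM
  have cX1 := continuous_integral_fst cX
  have cM2 := continuous_integral_snd cM
  have cY2 := continuous_integral_snd cY
  have cl1 := continuous_lpNormSq_fst hψ hp0
  have cl2 := continuous_lpNormSq_snd hψ hp0
  have h1 := integral_mono (μ := circleMeasure) (integrable_of_continuous (by fun_prop))
    (integrable_of_continuous (by fun_prop)) fun y =>
      beckner (hx y) (hψx.comp (Continuous.prodMk_left y)) hp σ
  rw [integral_const_mul, integral_sub (integrable_of_continuous cM1) (integrable_of_continuous cl1),
    integral_add (integrable_of_continuous (by fun_prop)) (integrable_of_continuous (by fun_prop)),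
    integral_const_mul, integral_const_mul, ← integral_torus_eq_symm cM, ← integral_torus_eq_symm cX]
    at h1
  have h2 := integral_mono (μ := circleMeasure) (integrable_of_continuous (by fun_prop))
    (integrable_of_continuous (by unfold circleEnergy; fun_prop)) fun x =>
      hL _ _ ((hy x).isH1Circle (hψy.comp (Continuous.prodMk_right x)))
  unfold circleEnergy at h2
  rw [integral_const_mul, integral_add (integrable_of_continuous cY2)
    (integrable_of_continuous (by fun_prop)), integral_const_mul, ← integral_torus_eq cM,
    ← integral_torus_eq cY] at h2
  have h3 := lpNormSq_subadditive hψ hp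
  rw [torusEnergy_eq (memLp_of_continuous hψ 2) (memLp_of_continuous hψx 2)
    (memLp_of_continuous hψy 2)]
  set κ := remainderConst p
  have hκ : 0 ≤ κ := remainderConst_nonneg hp
  have hk : 0 ≤ 1 + κ * σ := by positivity
  have h4 := mul_le_mul_of_nonneg_left h3 hμ
  have h5 := mul_le_mul_of_nonneg_left h1 hμ
  have h6 := mul_le_mul_of_nonneg_left (add_le_add h2 h4) hk
  linarith

/-- Truncated double Fourier series converge in `L²` together with their derivatives. -/
theorem IsH1Torus.torusEnergy_sub_ge {ψ gx gy : T2 → ℂ} (h : IsH1Torus ψ gx gy) {a p μ L σ : ℝ}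
    (hp : p ∈ Set.Ico (1 : ℝ) 2) (hμ : 0 ≤ μ) (hL : L ∈ circleConstants a p μ) (hσ : 0 ≤ σ) :
    (1 + remainderConst p * σ) * ∫ z, ‖gx z‖ ^ 2 ∂torusMeasure
        - μ * ((2 - p) * ∫ z, ‖gx z‖ ^ 2 ∂torusMeasure
          + remainderConst p / 2 * σ ^ 2 * ∫ z, ‖ψ z‖ ^ 2 ∂torusMeasure)
      ≤ (1 + remainderConst p * σ)
        * (torusEnergy a p μ ψ gx gy - L * ∫ z, ‖ψ z‖ ^ 2 ∂torusMeasure) := by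
  have t0 := l2Tendsto_torusTrig h.memLp
  have tx := l2Tendsto_torusTrig h.memLp_derivX
  have ty := l2Tendsto_torusTrig h.memLp_derivY
  have l0 := t0.tendsto_integral_sq
  have lx := tx.tendsto_integral_sq
  have lE : Tendsto (fun s => torusEnergy a p μ (torusTrig s (torusCoeff ψ))
      (torusTrig s (torusCoeff gx)) (torusTrig s (torusCoeff gy))) atTop
      (𝓝 (torusEnergy a p μ ψ gx gy)) := by
    rw [torusEnergy_eq h.memLp h.memLp_derivX h.memLp_derivY]
    simp only [fun s => torusEnergy_eq (t0.memLp s) (tx.memLp s) (ty.memLp s)]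
    exact (lx.add (t0.sub_const_mul ty _).tendsto_integral_sq).add
      ((t0.tendsto_lpNormSq hp.1 hp.2.le).const_mul μ)
  refine le_of_tendsto_of_tendsto' ((lx.const_mul _).sub (((lx.const_mul _).add
    (l0.const_mul _)).const_mul _)) ((lE.sub (l0.const_mul _)).const_mul _) fun s => ?_
  refine torusEnergy_sub_ge_of_hasCircleDeriv (continuous_torusTrig _ _) (continuous_torusTrig _ _)
    (continuous_torusTrig _ _) (fun y => ?_) (fun x => ?_) hp hμ hL hσ
  · have := torusTrig_hasCircleDeriv_fst s (torusCoeff ψ) y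
    simpa only [← h.torusCoeff_derivX] using this
  · have := torusTrig_hasCircleDeriv_snd s (torusCoeff ψ) x
    simpa only [← h.torusCoeff_derivY] using this

/-- The case `σ = 0`, where the lower bound is `(1 - μ (2 - p)) ‖∂ₓψ‖₂² ≥ 0`. -/
theorem circleConstants_subset {a p μ : ℝ} (hp : p ∈ Set.Ico (1 : ℝ) 2) (hμ : 0 ≤ μ)
    (hc : μ * (2 - p) ≤ 1) : circleConstants a p μ ⊆ torusConstants a p μ := fun L hL ψ gx gy h => by
  have h1 := h.torusEnergy_sub_ge hp hμ hL le_rfl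
  have h2 : 0 ≤ ∫ z, ‖gx z‖ ^ 2 ∂torusMeasure := integral_nonneg fun z => by positivity
  nlinarith

theorem torusOptimal_eq_circleOptimal {a p μ : ℝ} (hp : p ∈ Set.Ico (1 : ℝ) 2) (hμ : 0 < μ)
    (hc : μ * (2 - p) ≤ 1) : torusOptimal a p μ = circleOptimal a p μ := by
  rw [torusOptimal, circleOptimal, (torusConstants_subset a p μ).antisymm
    (circleConstants_subset hp hμ.le hc)]

theorem IsH1Torus.hasSum_kineticX {ψ gx gy : T2 → ℂ} (h : IsH1Torus ψ gx gy) :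
    HasSum (fun q : ℤ × ℤ => (q.1 : ℝ) ^ 2 * ‖torusCoeff ψ q‖ ^ 2)
      (∫ z, ‖gx z‖ ^ 2 ∂torusMeasure) := by
  refine HasSum.of_eq (hasSum_sq_torusCoeff h.memLp_derivX) fun q => ?_
  rw [h.torusCoeff_derivX, norm_mul, norm_mul, Complex.norm_I, one_mul, mul_pow, Complex.norm_intCast,
    sq_abs]

theorem IsH1Torus.hasSum_kineticY {ψ gx gy : T2 → ℂ} (h : IsH1Torus ψ gx gy) (a : ℝ) :
    HasSum (fun q : ℤ × ℤ => ((q.2 : ℝ) - a) ^ 2 * ‖torusCoeff ψ q‖ ^ 2)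
      (∫ z, ‖gy z - Complex.I * (a : ℂ) * ψ z‖ ^ 2 ∂torusMeasure) := by
  refine HasSum.of_eq (hasSum_sq_torusCoeff (f := fun z => gy z - Complex.I * (a : ℂ) * ψ z)
    (h.memLp_derivY.sub (h.memLp.const_mul (Complex.I * (a : ℂ))))) fun q => ?_
  have e : torusCoeff (fun z => gy z - Complex.I * (a : ℂ) * ψ z) q
      = Complex.I * (((q.2 : ℝ) - a : ℝ) : ℂ) * torusCoeff ψ q := by
    refine (torusCoeff_sub_mul h.memLp h.memLp_derivY _ q).trans ?_
    rw [h.torusCoeff_derivY]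
    push_cast
    ring
  rw [e, norm_mul, norm_mul, Complex.norm_I, one_mul, mul_pow, Complex.norm_real, Real.norm_eq_abs,
    sq_abs]

theorem IsH1Torus.torusCoeff_eq_zero {ψ gx gy : T2 → ℂ} (h : IsH1Torus ψ gx gy)
    (hX : ∫ z, ‖gx z‖ ^ 2 ∂torusMeasure ≤ 0) (q : ℤ × ℤ) (hq : q.1 ≠ 0) : torusCoeff ψ q = 0 := by
  have h1 := le_hasSum h.hasSum_kineticX q fun j _ => by positivity
  have h2 : (0 : ℝ) < (q.1 : ℝ) ^ 2 := by positivity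
  have h3 : ‖torusCoeff ψ q‖ ^ 2 ≤ 0 := by
    by_contra hlt
    have := mul_pos h2 (not_le.1 hlt)
    linarith
  exact norm_eq_zero.1 (pow_eq_zero_iff two_ne_zero |>.1 (le_antisymm h3 (sq_nonneg _)))

/-- Averaging in `x` does not increase the `L¹` norm. -/
theorem lpNormSq_one_sliceCoeff_le {ψ : T2 → ℂ} (hψ : MemLp ψ 2 torusMeasure) :
    lpNormSq circleMeasure 1 (sliceCoeff ψ 0) ≤ lpNormSq torusMeasure 1 ψ := by
  have hi := (hψ.integrable (by norm_num)).norm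
  rw [lpNormSq_one, lpNormSq_one]
  refine pow_le_pow_left₀ (integral_nonneg fun _ => norm_nonneg _) ?_ 2
  refine (integral_mono_of_nonneg (.of_forall fun y => norm_nonneg _) hi.integral_prod_right
    (.of_forall fun y => ?_)).trans_eq (integral_prod_symm _ hi).symm
  simp only [sliceCoeff_zero]
  exact norm_integral_le_integral_norm _

/-- If a circle constant is less than `1 + a²`, then in the case `p = 1`, `μ ≥ 0` equality in the
torus inequality forces the Fourier modes depending on `x` to vanish. -/
theorem IsH1Torus.torusCoeff_eq_zero_of_one {ψ gx gy : T2 → ℂ} (h : IsH1Torus ψ gx gy) {a μ L : ℝ}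
    (ha : a ∈ Set.Icc (0 : ℝ) (1 / 2)) (hμ : 0 ≤ μ) (hL : L ∈ circleConstants a 1 μ)
    (hL1 : L < 1 + a ^ 2)
    (hE : torusEnergy a 1 μ ψ gx gy ≤ L * ∫ z, ‖ψ z‖ ^ 2 ∂torusMeasure) (q : ℤ × ℤ) (hq : q.1 ≠ 0) :
    torusCoeff ψ q = 0 := by
  have hA := h.isH1Circle_sliceCoeff
  have hT := hA.comp_snd
  have h1 := hL _ _ hA
  rw [circleEnergy, ← integral_comp_snd fun y => ‖sliceCoeff ψ 0 y‖ ^ 2,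
    ← integral_comp_snd fun y => ‖sliceCoeff gy 0 y - Complex.I * (a : ℂ) * sliceCoeff ψ 0 y‖ ^ 2] at h1
  rw [torusEnergy_eq h.memLp h.memLp_derivX h.memLp_derivY] at hE
  have h2 := mul_le_mul_of_nonneg_left (lpNormSq_one_sliceCoeff_le h.memLp) hμ
  have hc : ∀ r : ℤ × ℤ, ‖torusCoeff (fun z => sliceCoeff ψ 0 z.2) r‖ ^ 2
      = if r.1 = 0 then ‖torusCoeff ψ r‖ ^ 2 else 0 := fun r => by
    rw [torusCoeff_comp_snd]
    split_ifs with hr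
    · rw [← fourierCoeff_sliceCoeff h.memLp r, hr]
    · simp
  have s1 := HasSum.of_eq ((hasSum_sq_torusCoeff h.memLp).sub (hasSum_sq_torusCoeff hT.memLp))
    (g := fun r => if r.1 = 0 then 0 else ‖torusCoeff ψ r‖ ^ 2) fun r => by
      rw [hc]; split_ifs <;> simp
  have s2 := HasSum.of_eq
    ((h.hasSum_kineticX.add (h.hasSum_kineticY a)).sub (hT.hasSum_kineticY a))
    (g := fun r => ((r.1 : ℝ) ^ 2 + (((r.2 : ℝ) - a) ^ 2)) *
      (if r.1 = 0 then 0 else ‖torusCoeff ψ r‖ ^ 2)) fun r => by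
      rw [hc]; split_ifs with hr
      · simp [hr]
      · ring
  -- Replacing `ψ` by its average in `x` removes exactly the modes with `r.1 ≠ 0`, each of which
  -- carries kinetic weight at least `1 + a² > L`. At equality nothing can have been removed.
  have h3 := hasSum_le (fun r => ?_) (s1.mul_left (1 + a ^ 2)) s2
  · have h4 := le_hasSum s1 q fun r _ => by split_ifs <;> positivity
    rw [if_neg hq] at h4
    have h5 : ‖torusCoeff ψ q‖ ^ 2 ≤ 0 := by
      refine h4.trans ?_
      by_contra hlt
      have := mul_pos (sub_pos.2 hL1) (not_le.1 hlt)
      linarith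
    exact norm_eq_zero.1 (pow_eq_zero_iff two_ne_zero |>.1 (le_antisymm h5 (sq_nonneg _)))
  · split_ifs with hr
    · simp
    · refine mul_le_mul_of_nonneg_right (add_le_add ?_ ?_) (sq_nonneg _)
      · exact_mod_cast Int.one_le_abs hr |>.trans (by nlinarith [abs_nonneg r.1, sq_abs r.1, Int.one_le_abs hr])
      · have e : ((r.2 : ℝ) - a) ^ 2 - a ^ 2 = r.2 * (r.2 - 2 * a) := by ring
        obtain ⟨ha0, ha1⟩ := ha
        rcases lt_or_ge r.2 1 with h6 | h6
        · have : (r.2 : ℝ) ≤ 0 := by exact_mod_cast (by omega : r.2 ≤ 0)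
          nlinarith
        · have : (1 : ℝ) ≤ r.2 := by exact_mod_cast h6
          nlinarith

/-- At equality `torusEnergy_sub_ge` bounds `‖∂ₓψ‖₂²` for every `σ ≥ 0`. This is decisive unless `p
= μ = 1`, where both the remainder and the margin `1 - μ (2 - p)` vanish and the averaging argument
takes over. -/
theorem torusCoeff_eq_zero_of_isOptimal {a p μ : ℝ} (ha : a ∈ Set.Icc (0 : ℝ) (1 / 2))
    (hp : p ∈ Set.Ico (1 : ℝ) 2) (hμ : 0 < μ) (hc : μ * (2 - p) ≤ 1)
    (hne : ¬ (a = 0 ∧ p = 1 ∧ μ = 1)) {ψ gx gy : T2 → ℂ} (h : IsH1Torus ψ gx gy)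
    (hE : torusEnergy a p μ ψ gx gy = torusOptimal a p μ * ∫ z, ‖ψ z‖ ^ 2 ∂torusMeasure)
    (q : ℤ × ℤ) (hq : q.1 ≠ 0) : torusCoeff ψ q = 0 := by
  rw [torusOptimal_eq_circleOptimal hp hμ hc] at hE
  have hL := (isGreatest_circleOptimal (a := a) hp.1 hμ).1
  by_cases hs : p = 1 ∧ μ = 1
  · obtain ⟨rfl, rfl⟩ := hs
    have ha0 : 0 < a := ha.1.lt_of_ne fun h0 => hne ⟨h0.symm, rfl, rfl⟩
    refine h.torusCoeff_eq_zero_of_one ha hμ.le hL ?_ hE.le q hq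
    rw [add_comm]
    -- With `p = μ = 1` the rigidity condition reads `1 + 4a² ≤ 1`, which fails for `a > 0`; hence
    -- the circle constant lies strictly below `1 + a²`.
    refine (circleOptimal_le hp.1 hμ).lt_of_ne fun h0 => ?_
    have := (circleOptimal_eq_iff ha hp hμ).1 h0
    nlinarith
  · refine h.torusCoeff_eq_zero ?_ q hq
    set X := ∫ z, ‖gx z‖ ^ 2 ∂torusMeasure
    set M := ∫ z, ‖ψ z‖ ^ 2 ∂torusMeasure
    have hX : 0 ≤ X := integral_nonneg fun z => by positivity
    have hM : 0 ≤ M := integral_nonneg fun z => by positivity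
    have key : ∀ σ, 0 ≤ σ → (1 + remainderConst p * σ) * X
        - μ * ((2 - p) * X + remainderConst p / 2 * σ ^ 2 * M) ≤ 0 := fun σ hσ => by
      have := h.torusEnergy_sub_ge hp hμ.le hL hσ
      rwa [hE, sub_self, mul_zero] at this
    by_cases hp1 : p = 1
    · have h0 := key 0 le_rfl
      have h1 : μ < 1 := by
        subst hp1
        exact lt_of_le_of_ne (by linarith) fun h0 => hs ⟨rfl, h0⟩
      subst hp1
      by_contra hlt
      nlinarith [mul_pos (sub_pos.2 h1) (not_le.1 hlt)]
    · have hκ := remainderConst_pos hp hp1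
      -- For small positive `σ` the linear gain `κ σ X` beats the quadratic loss `μ κ σ² M / 2`; the
      -- choice below ensures `σ μ M < X`, and the `1` in its denominator covers `M = 0`.
      by_contra hlt
      have hX0 := not_le.1 hlt
      set σ := X / (μ * M + 1) with hσ
      have hd : 0 < μ * M + 1 := by positivity
      have hσ0 : 0 < σ := div_pos hX0 hd
      have h1 := key σ hσ0.le
      have h2 : μ * (2 - p) * X ≤ 1 * X := mul_le_mul_of_nonneg_right hc hX
      have h3 : σ * (μ * M + 1) = X := div_mul_cancel₀ _ hd.ne'
      have h4 : 0 < remainderConst p * σ * (X / 2 + σ / 2) := by positivity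
      have e : remainderConst p * σ * (X / 2 + σ / 2)
          = remainderConst p * σ * X - μ * (remainderConst p / 2 * σ ^ 2 * M) := by
        linear_combination (remainderConst p * σ / 2) * h3
      linarith

/-! ### Optimal functions -/

theorem IsTorusOptimizer.ae_eq_comp_snd {a p μ : ℝ} (ha : a ∈ Set.Icc (0 : ℝ) (1 / 2))
    (hp : p ∈ Set.Ico (1 : ℝ) 2) (hμ : 0 < μ) (hc : μ * (2 - p) ≤ 1)
    (hne : ¬ (a = 0 ∧ p = 1 ∧ μ = 1)) {ψ : T2 → ℂ} (h : IsTorusOptimizer a p μ ψ) :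
    ∃ f : S1 → ℂ, ∀ᵐ z ∂torusMeasure, ψ z = f z.2 := by
  obtain ⟨gx, gy, h, -, hE⟩ := h
  exact ⟨_, ae_eq_sliceCoeff h.memLp (torusCoeff_eq_zero_of_isOptimal ha hp hμ hc hne h hE)⟩

theorem mul_le_one_of_rigidity {a p μ : ℝ} (hc : μ * (2 - p) + 4 * a ^ 2 ≤ 1) : μ * (2 - p) ≤ 1 := by
  nlinarith [sq_nonneg a]

theorem torusOptimal_eq_iff {a p μ : ℝ} (ha : a ∈ Set.Icc (0 : ℝ) (1 / 2))
    (hp : p ∈ Set.Ico (1 : ℝ) 2) (hμ : 0 < μ) :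
    torusOptimal a p μ = a ^ 2 + μ ↔ μ * (2 - p) + 4 * a ^ 2 ≤ 1 := by
  refine ⟨fun h => ?_, fun hc => ?_⟩
  · rw [← circleOptimal_eq_iff ha hp hμ]
    exact (circleOptimal_le hp.1 hμ).antisymm (h ▸ torusOptimal_le_circleOptimal hp.1 hμ)
  · rw [torusOptimal_eq_circleOptimal hp hμ (mul_le_one_of_rigidity hc)]
    exact (circleOptimal_eq_iff ha hp hμ).2 hc

theorem torusEnergy_congr {ψ ψ' gx gx' gy gy' : T2 → ℂ} (h : ψ =ᵐ[torusMeasure] ψ')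
    (hx : gx =ᵐ[torusMeasure] gx') (hy : gy =ᵐ[torusMeasure] gy') (a p μ : ℝ) :
    torusEnergy a p μ ψ gx gy = torusEnergy a p μ ψ' gx' gy' := by
  have e1 : ∫ z, (‖gx z‖ ^ 2 + ‖gy z - Complex.I * (a : ℂ) * ψ z‖ ^ 2) ∂torusMeasure
      = ∫ z, (‖gx' z‖ ^ 2 + ‖gy' z - Complex.I * (a : ℂ) * ψ' z‖ ^ 2) ∂torusMeasure := by
    refine integral_congr_ae ?_
    filter_upwards [h, hx, hy] with z h1 h2 h3
    rw [h1, h2, h3]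
  have e2 : ∫ z, ‖ψ z‖ ^ p ∂torusMeasure = ∫ z, ‖ψ' z‖ ^ p ∂torusMeasure := by
    refine integral_congr_ae ?_
    filter_upwards [h] with z h1
    rw [h1]
  rw [torusEnergy, torusEnergy, e1, lpNormSq, lpNormSq, e2]

theorem integral_norm_sq_congr {ψ ψ' : T2 → ℂ} (h : ψ =ᵐ[torusMeasure] ψ') :
    ∫ z, ‖ψ z‖ ^ 2 ∂torusMeasure = ∫ z, ‖ψ' z‖ ^ 2 ∂torusMeasure :=
  integral_congr_ae (by filter_upwards [h] with z h1; rw [h1])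

theorem IsH1Torus.congr {ψ ψ' gx gy : T2 → ℂ} (h : IsH1Torus ψ gx gy)
    (he : ψ =ᵐ[torusMeasure] ψ') : IsH1Torus ψ' gx gy where
  memLp := (memLp_congr_ae he).1 h.memLp
  memLp_derivX := h.memLp_derivX
  memLp_derivY := h.memLp_derivY
  weakDerivX φ hφ := (integral_congr_ae (by filter_upwards [he] with z h1; rw [h1])).symm.trans
    (h.weakDerivX φ hφ)
  weakDerivY φ hφ := (integral_congr_ae (by filter_upwards [he] with z h1; rw [h1])).symm.trans
    (h.weakDerivY φ hφ)

theorem isTorusOptimizer_of_ae_eq_const {a p μ : ℝ} (hp : p ≠ 0) (hΛ : torusOptimal a p μ = a ^ 2 + μ)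
    {ψ : T2 → ℂ} {c : ℂ} (hc : c ≠ 0) (h : ∀ᵐ z ∂torusMeasure, ψ z = c) :
    IsTorusOptimizer a p μ ψ := by
  have he : (fun _ => c) =ᵐ[torusMeasure] ψ := by filter_upwards [h] with z hz using hz.symm
  refine ⟨fun _ => 0, fun _ => 0, (isH1Circle_const c).comp_snd.congr he, fun h0 => ?_, ?_⟩
  · obtain ⟨z, h1, h2⟩ := (h.and h0).exists
    exact hc (h1.symm.trans h2)
  · rw [← torusEnergy_congr he .rfl .rfl, ← integral_norm_sq_congr he, hΛ]
    refine (torusEnergy_comp_snd a p μ (fun _ => c) fun _ => 0).trans ?_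
    rw [circleEnergy_const hp]
    simp

/-- An optimal function depends on `y` alone, so its average in `x` is optimal on the circle, where
equality forces a constant. -/
theorem IsTorusOptimizer.ae_eq_const {a p μ : ℝ} (ha : a ∈ Set.Icc (0 : ℝ) (1 / 2))
    (hp : p ∈ Set.Ico (1 : ℝ) 2) (hμ : 0 < μ) (hc : μ * (2 - p) + 4 * a ^ 2 ≤ 1)
    (hne : ¬ (a = 0 ∧ p = 1 ∧ μ = 1)) {ψ : T2 → ℂ} (h : IsTorusOptimizer a p μ ψ) :
    ∃ c : ℂ, c ≠ 0 ∧ ∀ᵐ z ∂torusMeasure, ψ z = c := by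
  obtain ⟨gx, gy, h, h0, hE⟩ := h
  have hz := torusCoeff_eq_zero_of_isOptimal ha hp hμ (mul_le_one_of_rigidity hc) hne h hE
  have e1 := ae_eq_sliceCoeff h.memLp hz
  have e2 : ∀ᵐ z ∂torusMeasure, gy z = sliceCoeff gy 0 z.2 :=
    ae_eq_sliceCoeff h.memLp_derivY fun q hq => by rw [h.torusCoeff_derivY, hz q hq, mul_zero]
  have e3 : ∀ᵐ z ∂torusMeasure, gx z = 0 :=
    ae_eq_of_torusCoeff_eq h.memLp_derivX (memLp_const 0) fun q => by
      rw [h.torusCoeff_derivX]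
      by_cases hq : q.1 = 0
      · simp [hq, torusCoeff]
      · rw [hz q hq, mul_zero, torusCoeff]; simp
  rw [torusEnergy_congr e1 e3 e2, integral_norm_sq_congr e1, torusEnergy_comp_snd,
    (torusOptimal_eq_iff ha hp hμ).2 hc, integral_comp_snd fun y => ‖sliceCoeff ψ 0 y‖ ^ 2] at hE
  obtain ⟨c, hc'⟩ := ae_eq_const_of_energy_eq ha hp hμ hc hne h.isH1Circle_sliceCoeff hE
  have e4 : ∀ᵐ z ∂torusMeasure, sliceCoeff ψ 0 z.2 = c :=
    Measure.quasiMeasurePreserving_snd.ae hc'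
  have e5 : ∀ᵐ z ∂torusMeasure, ψ z = c := by
    filter_upwards [e1, e4] with z h1 h2 using h1.trans h2
  refine ⟨c, fun hc0 => h0 ?_, e5⟩
  rwa [hc0] at e5

end MagneticTorus

theorem theorem3p11 (a p μ : ℝ) (ha : a ∈ Set.Icc (0 : ℝ) (1 / 2)) (hp : p ∈ Set.Ico (1 : ℝ) 2)
    (hμ : 0 < μ) :
    -- both optimal constants exist, as largest constants in the respective inequalities
    IsGreatest (MagneticTorus.circleConstants a p μ) (MagneticTorus.circleOptimal a p μ) ∧
    IsGreatest (MagneticTorus.torusConstants a p μ) (MagneticTorus.torusOptimal a p μ) ∧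
    -- equality of the constants, and symmetry of the optimal functions
    (μ ≤ 1 / (2 - p) →
      MagneticTorus.torusOptimal a p μ = MagneticTorus.circleOptimal a p μ ∧
      (¬ (a = 0 ∧ p = 1 ∧ μ = 1) →
        ∀ ψ : MagneticTorus.T2 → ℂ, MagneticTorus.IsTorusOptimizer a p μ ψ →
          ∃ f : MagneticTorus.S1 → ℂ,
            ∀ᵐ z ∂MagneticTorus.torusMeasure, ψ z = f z.2)) ∧
    -- the rigidity range
    (MagneticTorus.torusOptimal a p μ = a ^ 2 + μ ↔ μ * (2 - p) + 4 * a ^ 2 ≤ 1) ∧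
    (μ * (2 - p) + 4 * a ^ 2 ≤ 1 → ¬ (a = 0 ∧ p = 1 ∧ μ = 1) →
      ∀ ψ : MagneticTorus.T2 → ℂ, MagneticTorus.IsTorusOptimizer a p μ ψ ↔
        ∃ c : ℂ, c ≠ 0 ∧ ∀ᵐ z ∂MagneticTorus.torusMeasure, ψ z = c) := by
  have h2p : 0 < 2 - p := by linarith [hp.2]
  refine ⟨MagneticTorus.isGreatest_circleOptimal hp.1 hμ, MagneticTorus.isGreatest_torusOptimal hp.1 hμ,
    fun hc => ?_, MagneticTorus.torusOptimal_eq_iff ha hp hμ, fun hc hne ψ => ⟨fun h => ?_, ?_⟩⟩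
  · rw [le_div_iff₀ h2p] at hc
    exact ⟨MagneticTorus.torusOptimal_eq_circleOptimal hp hμ hc,
      fun hne ψ h => h.ae_eq_comp_snd ha hp hμ hc hne⟩
  · exact h.ae_eq_const ha hp hμ hc hne
  · rintro ⟨c, hc0, h⟩
    exact MagneticTorus.isTorusOptimizer_of_ae_eq_const (by linarith [hp.1])
      ((MagneticTorus.torusOptimal_eq_iff ha hp hμ).2 hc) hc0 h
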